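/- Let $\Bbbk$ be a commutative ring and $n\ge 0$. \textbf{Trees.} Objects of $\Omega_n^{epi}$ are sequences $\underline\tau=\{\underline t_0\xrightarrow{\tau_1}\underline t_1\to\cdots\xrightarrow{\tau_n}\underline t_n\}$ of non-decreasing surjections of finite ordered sets $\underline t_i=\{1<\dots<t_i\}$ with $t_n=1$. A morphism $u:\underline\tau\to\underline\sigma$ is a sequence of surjections $u:\underline t_i\to\underline s_i$ commuting with the $\tau_i,\sigma_i$ and non-decreasing on every fibre $\tau_{i+1}^{-1}(x)\subset\underline t_i$. Put $\deg\underline\tau=t_0+\dots+t_{n-1}$ and $\deg(u)=\deg\underline\tau-\deg\underline\sigma$. \textbf{Signs.} Give each vertex of level $<n$ of a tree a symbol of degree $1$, and order the vertices by running through the tree along the edges from the root upwards and then from left to right. A morphism $u:\underline\tau\to\underline\sigma$ of degree $1$ identifies exactly two vertices $x_i<x_j$ of level $<n$, which have the same level. Its sign $\mathrm{sgn}(u)$ is the product of the sign of the permutation which moves $x_i,x_j$ (in this order) to the front of the word of vertices of $\underline\tau$, and of the sign of the permutation which puts the word formed by the merged vertex followed by the other vertices of $\underline\tau$ (in the order of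 $\underline\tau$) into the order of $\underline\sigma$. \textbf{Koszul complex.} For a contravariant functor $S$ and a covariant functor $T$ from $\Omega_n^{epi}$ to $\Bbbk$-modules, let $$K(S,\Omega_n^{epi},T)_d=\bigoplus_{u:\underline\tau\to\underline\sigma,\ \deg(u)=d}S(\underline\sigma)\otimes\{u\}\otimes T(\underline\tau),$$ $$\partial(x\otimes\{u\}\otimes y)=\sum_{u=vw,\ \deg v=1}\mathrm{sgn}(v)\,v^*(x)\otimes\{w\}\otimes y+\sum_{u=vw,\ \deg w=1}(-1)^{\deg v}\,\mathrm{sgn}(w)\,x\otimes\{v\}\otimes w_*(y).$$ Let $\mathrm{pt}_{\underline\sigma}$ be the contravariant functor with value $\Bbbk$ at $\underline\sigma$ and $0$ at every other object, and let $\Omega_n^{epi}(\underline\tau,-)$ be the covariant functor which sends $\underline\theta$ to the free $\Bbbk$-module on the set of morphisms $\underline\tau\to\underline\theta$. \textbf{Lemma.} For all objects $\underline\tau,\underline\sigma$ of $\Omega_n^{epi}$, the graded module $$L_n(\underline\tau,\underline\sigma)=K(\mathrm{pt}_{\underline\sigma},\Omega_n^{epi},\Omega_n^{epi}(\underline\tau,-))$$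 with $\partial$ is a chain complex ($\partial^2=0$), and if $\underline\tau\ne\underline\sigma$, then its homology is zero in every degree. -/

import Mathlib

open CategoryTheory Opposite TensorProduct DirectSum

universe u v w

/-- A pruned planar tree with levels `0, …, n`: a sequence of non-decreasing surjections
`t₀ → t₁ → ⋯ → tₙ` between the finite ordered sets `tᵢ = Fin (size i)`, ending in the one-point
set. `map i` is the surjection from level `i` to level `i + 1`. -/
structure PrunedTree (n : ℕ) where
  size : Fin (n + 1) → ℕ
  map : ∀ i : Fin n, Fin (size i.castSucc) → Fin (size i.succ)
  monotone_map : ∀ i, Monotone (map i)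
  surjective_map : ∀ i, Function.Surjective (map i)
  size_last : size (Fin.last n) = 1

namespace PrunedTree

variable {n : ℕ}

/-- A morphism of pruned trees: level-wise surjections that commute with the structure maps and
are non-decreasing on every fibre of the structure maps of the source. -/
@[ext]
structure Hom (T S : PrunedTree n) where
  app : ∀ i : Fin (n + 1), Fin (T.size i) → Fin (S.size i)
  surjective_app : ∀ i, Function.Surjective (app i)
  comm : ∀ (i : Fin n) (x : Fin (T.size i.castSucc)),
    S.map i (app i.castSucc x) = app i.succ (T.map i x)
  mono_fibre : ∀ (i : Fin n) (x y : Fin (T.size i.castSucc)),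
    T.map i x = T.map i y → x ≤ y → app i.castSucc x ≤ app i.castSucc y

/-- The identity morphism. -/
def Hom.id (T : PrunedTree n) : Hom T T where
  app _ x := x
  surjective_app _ := Function.surjective_id
  comm _ _ := rfl
  mono_fibre _ _ _ _ h := h

/-- Composition (in diagrammatic order). -/
def Hom.comp {T S R : PrunedTree n} (f : Hom T S) (g : Hom S R) : Hom T R where
  app i x := g.app i (f.app i x)
  surjective_app i := (g.surjective_app i).comp (f.surjective_app i)
  comm i x := by rw [g.comm, f.comm]
  mono_fibre i x y h hxy :=
    g.mono_fibre i _ _ (by rw [f.comm, f.comm, h]) (f.mono_fibre i x y h hxy)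

/-- The category `Ω_n^epi` of pruned trees. -/
instance : Category (PrunedTree n) where
  Hom := Hom
  id := Hom.id
  comp := Hom.comp

/-- The degree `t₀ + ⋯ + tₙ₋₁` of a tree. The degree of a morphism `T ⟶ S` is
`T.deg - S.deg`; below it is always written as an equation `T.deg = S.deg + d`. -/
def deg (T : PrunedTree n) : ℕ := ∑ i : Fin n, T.size i.castSucc

/-! ### The sign of a morphism of degree one -/

/-- The tree obtained by removing level `0`. -/
def tr (T : PrunedTree (n + 1)) : PrunedTree n where
  size i := T.size i.succ
  map i := T.map i.succ
  monotone_map i := T.monotone_map i.succ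
  surjective_map i := T.surjective_map i.succ
  size_last := T.size_last

/-- The path from the root to the vertex `x` of level `i`: the list of the vertices of levels
`n - 1, n - 2, …, i` (in this order) through which it passes. The root has the empty path. -/
def path : {n : ℕ} → (T : PrunedTree n) → (i : Fin (n + 1)) → Fin (T.size i) → List ℕ
  | 0, _, _, _ => []
  | _ + 1, T, i, x =>
    Fin.cases (motive := fun i => Fin (T.size i) → List ℕ)
      (fun x => path T.tr 0 (T.map 0 x) ++ [x.val]) (fun j x => path T.tr j x) i x

/-- The vertices of level `< n`; each of them carries a symbol of degree one. -/
abbrev Vertex (T : PrunedTree n) : Type := Σ i : Fin n, Fin (T.size i.castSucc)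

/-- The planar order on vertices: the tree is run through along the edges from bottom to top,
and then from left to right. This is the lexicographic order on paths from the root. -/
def Before (T : PrunedTree n) (x y : T.Vertex) : Prop :=
  T.path x.1.castSucc x.2 < T.path y.1.castSucc y.2

instance (T : PrunedTree n) : DecidableRel T.Before := fun x y =>
  inferInstanceAs (Decidable (T.path x.1.castSucc x.2 < T.path y.1.castSucc y.2))

/-- The action of a morphism on vertices. -/
def Hom.onVertex {T S : PrunedTree n} (f : Hom T S) (x : T.Vertex) : S.Vertex :=
  ⟨x.1, f.app x.1.castSucc x.2⟩

/-- The vertices that a morphism identifies with some other vertex. A morphism of degree one has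
exactly two of them. -/
def Hom.Merged {T S : PrunedTree n} (f : Hom T S) (x : T.Vertex) : Prop :=
  ∃ y, y ≠ x ∧ f.onVertex y = f.onVertex x

instance {T S : PrunedTree n} (f : Hom T S) : DecidablePred f.Merged := fun x =>
  inferInstanceAs (Decidable (∃ y, y ≠ x ∧ f.onVertex y = f.onVertex x))

/-- Number of transpositions of symbols needed to move the two merged vertices in front of the
word of all vertices of the source (without exchanging the two). -/
def Hom.frontExponent {T S : PrunedTree n} (f : Hom T S) : ℕ :=
  (Finset.univ.filter fun p : T.Vertex × T.Vertex =>
    ¬ f.Merged p.1 ∧ f.Merged p.2 ∧ T.Before p.1 p.2).card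

/-- Number of transpositions of symbols needed to bring the word
"merged vertex, then the other vertices in the order of the source" into the order of the target:
first the inversions between the merged vertex and another vertex, then those between two other
vertices. -/
def Hom.reorderExponent {T S : PrunedTree n} (f : Hom T S) : ℕ :=
  (Finset.univ.filter fun y : T.Vertex =>
    ¬ f.Merged y ∧ ∃ x, f.Merged x ∧ S.Before (f.onVertex y) (f.onVertex x)).card +
  (Finset.univ.filter fun p : T.Vertex × T.Vertex =>
    ¬ f.Merged p.1 ∧ ¬ f.Merged p.2 ∧ T.Before p.1 p.2 ∧
      S.Before (f.onVertex p.2) (f.onVertex p.1)).card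

/-- The sign of a morphism; only used for morphisms of degree one (and with all inputs
of degree zero). -/
def Hom.sgn {T S : PrunedTree n} (f : Hom T S) : ℤ :=
  (-1) ^ (f.frontExponent + f.reorderExponent)

/-! ### Factorizations of a morphism -/

/-- A factorization `T ⟶ mid ⟶ S` of a morphism. -/
structure Factorization {T S : PrunedTree n} (f : T ⟶ S) where
  mid : PrunedTree n
  fst : T ⟶ mid
  snd : mid ⟶ S
  fac : fst ≫ snd = f

theorem size_le_of_hom {T S : PrunedTree n} (f : T ⟶ S) (i : Fin (n + 1)) :
    S.size i ≤ T.size i := by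
  simpa using Fintype.card_le_of_surjective _ (Hom.surjective_app f i)

instance {T S : PrunedTree n} (f : T ⟶ S) : Finite (Factorization f) := by
  let F : Factorization f →
      Σ s : (∀ i : Fin (n + 1), Fin (T.size i + 1)),
        (∀ i : Fin n, Fin (s i.castSucc).val → Fin (s i.succ).val) ×
        (∀ i, Fin (T.size i) → Fin (s i).val) ×
        (∀ i, Fin (s i).val → Fin (S.size i)) := fun a =>
    ⟨fun i => ⟨a.mid.size i, Nat.lt_succ_of_le (size_le_of_hom a.fst i)⟩,
      a.mid.map, Hom.app a.fst, Hom.app a.snd⟩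
  refine Finite.of_injective F ?_
  rintro ⟨⟨s, m, _, _, _⟩, ⟨f₁, _, _, _⟩, ⟨f₂, _, _, _⟩, _⟩
    ⟨⟨s', m', _, _, _⟩, ⟨g₁, _, _, _⟩, ⟨g₂, _, _, _⟩, _⟩ h
  have hs : s = s' := by
    funext i
    have := congrFun (congrArg Sigma.fst h) i
    exact congrArg Fin.val this
  subst hs
  simp only [F, Sigma.mk.injEq, heq_eq_eq, Prod.mk.injEq, true_and] at h
  obtain ⟨rfl, rfl, rfl⟩ := h
  rfl

/-- Two trees with morphisms in both directions are equal. -/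
theorem eq_of_homs {T S : PrunedTree n} (f : T ⟶ S) (g : S ⟶ T) : T = S := by
  have hs : T.size = S.size :=
    funext fun i => le_antisymm (size_le_of_hom g i) (size_le_of_hom f i)
  obtain ⟨s, m, hm, hms, hl⟩ := T
  obtain ⟨s', m', hm', hms', hl'⟩ := S
  obtain rfl : s = s' := hs
  have key : ∀ i : Fin (n + 1), ∀ x, Hom.app f i x = x := by
    intro i
    induction i using Fin.reverseInduction with
    | last =>
      intro x
      have : Subsingleton (Fin (s (Fin.last n))) := by rw [hl]; infer_instance
      exact Subsingleton.elim (α := Fin (s (Fin.last n))) _ _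
    | cast i ih =>
      have hc : ∀ x, m' i (Hom.app f i.castSucc x) = m i x := fun x =>
        (Hom.comm f i x).trans (ih _)
      have hmono : Monotone (Hom.app f i.castSucc) := by
        intro x y hxy
        rcases (hm i hxy).eq_or_lt with h | h
        · exact Hom.mono_fibre f i x y h hxy
        · rw [← hc x, ← hc y] at h
          exact ((hm' i).reflect_lt h).le
      have hinj : Function.Injective (Hom.app f i.castSucc) :=
        Finite.injective_iff_surjective.2 (Hom.surjective_app f i.castSucc)
      have hstrict := hmono.strictMono_of_injective hinj
      let e : Fin (s i.castSucc) ≃o Fin (s i.castSucc) :=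
        hstrict.orderIsoOfSurjective _ (Hom.surjective_app f i.castSucc)
      intro x
      exact DFunLike.congr_fun (Subsingleton.elim e (OrderIso.refl _)) x
  have : m = m' := by
    funext i x
    have := Hom.comm f i x
    rw [key, key] at this
    exact this.symm
  subst this
  rfl

/-! ### Diagrams and the Koszul complex with coefficients -/

section Koszul

variable (k : Type u) [CommRing k]

open scoped Classical in
/-- The contravariant punctual diagram `pt_S`: its value is `k` at `S` and `0` elsewhere (written
as the module of functions from the truth value of `R = S` to `k`). -/
noncomputable def pt (S : PrunedTree n) : (PrunedTree n)ᵒᵖ ⥤ ModuleCat.{u} k where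
  obj R := ModuleCat.of k (PLift (R.unop = S) → k)
  map {R R'} _ := ModuleCat.ofHom
    { toFun := fun a _ => if h : R.unop = S then a ⟨h⟩ else 0
      map_add' := fun a b => by
        funext _
        by_cases h : R.unop = S <;> simp [h]
      map_smul' := fun c a => by
        funext _
        by_cases h : R.unop = S <;> simp [h] }
  map_id R := by
    refine ModuleCat.hom_ext (LinearMap.ext fun a => funext fun h => ?_)
    simp [h.down]
  map_comp {R R' R''} f g := by
    refine ModuleCat.hom_ext (LinearMap.ext fun a => funext fun h'' => ?_)
    by_cases h : R.unop = S
    · have h' : R'.unop = S := by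
        have e := eq_of_homs f.unop (eqToHom (h.trans h''.down.symm) ≫ g.unop)
        rw [e, h]
      simp [h, h']
    · simp [h]

/-- The Yoneda diagram `Ω_n^epi(T, -)`: the free `k`-module on the morphisms out of `T`. -/
noncomputable def yonedaDiagram (T : PrunedTree n) : PrunedTree n ⥤ ModuleCat.{u} k where
  obj R := ModuleCat.of k ((T ⟶ R) →₀ k)
  map f := ModuleCat.ofHom (Finsupp.lmapDomain k k fun g => g ≫ f)
  map_id R := by
    ext g
    simp
  map_comp f f' := by
    ext g
    simp

variable {k}

/-- The morphisms of degree `d` of `Ω_n^epi`. -/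
structure MorOfDeg (n d : ℕ) where
  src : PrunedTree n
  tgt : PrunedTree n
  mor : src ⟶ tgt
  deg_src : src.deg = tgt.deg + d

variable (S : (PrunedTree n)ᵒᵖ ⥤ ModuleCat.{v} k) (T : PrunedTree n ⥤ ModuleCat.{w} k)

/-- The component of degree `d` of `K(S, Ω_n^epi, T)`: the direct sum of the modules
`S(σ) ⊗ T(τ)` over all morphisms `f : τ ⟶ σ` of degree `d`. -/
abbrev KoszulModule (d : ℕ) : Type _ :=
  ⨁ f : MorOfDeg n d, (S.obj (op f.tgt) : Type v) ⊗[k] (T.obj f.src : Type w)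

open scoped Classical in
/-- The inclusion of the summand of `f`, `x ⊗ y ↦ x ⊗ {f} ⊗ y`. -/
noncomputable def koszulIncl {d : ℕ} (f : MorOfDeg n d) :
    (S.obj (op f.tgt) : Type v) ⊗[k] (T.obj f.src : Type w) →ₗ[k] KoszulModule S T d :=
  DirectSum.lof k (MorOfDeg n d)
    (fun f => (S.obj (op f.tgt) : Type v) ⊗[k] (T.obj f.src : Type w)) f

/-- The factorizations `u = v w` with `v` of degree one. -/
abbrev LeftFactor {d : ℕ} (f : MorOfDeg n d) : Type :=
  {a : Factorization f.mor // a.mid.deg = f.tgt.deg + 1}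

/-- The factorizations `u = v w` with `w` of degree one. -/
abbrev RightFactor {d : ℕ} (f : MorOfDeg n d) : Type :=
  {a : Factorization f.mor // f.src.deg = a.mid.deg + 1}

noncomputable instance {d : ℕ} (f : MorOfDeg n d) : Fintype (LeftFactor f) := Fintype.ofFinite _

noncomputable instance {d : ℕ} (f : MorOfDeg n d) : Fintype (RightFactor f) := Fintype.ofFinite _

/-- For `u = v w` with `v` of degree one, the remaining factor `w`. -/
abbrev LeftFactor.rest {d : ℕ} {f : MorOfDeg n (d + 1)} (a : LeftFactor f) : MorOfDeg n d where
  src := f.src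
  tgt := a.1.mid
  mor := a.1.fst
  deg_src := by
    have h₁ := a.2
    have h₂ := f.deg_src
    omega

/-- For `u = v w` with `w` of degree one, the remaining factor `v`. -/
abbrev RightFactor.rest {d : ℕ} {f : MorOfDeg n (d + 1)} (a : RightFactor f) : MorOfDeg n d where
  src := a.1.mid
  tgt := f.tgt
  mor := a.1.snd
  deg_src := by
    have h₁ := a.2
    have h₂ := f.deg_src
    omega

open scoped Classical in
/-- The differential of `K(S, Ω_n^epi, T)`:
`∂(x ⊗ {u} ⊗ y) = ∑_{u = v w, deg v = 1} sgn(v) v^*(x) ⊗ {w} ⊗ y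
  + ∑_{u = v w, deg w = 1} (-1)^{deg v} sgn(w) x ⊗ {v} ⊗ w_*(y)`. -/
noncomputable def koszulDiff (d : ℕ) : KoszulModule S T (d + 1) →ₗ[k] KoszulModule S T d :=
  DirectSum.toModule k (MorOfDeg n (d + 1)) (KoszulModule S T d) fun f =>
    (∑ a : LeftFactor f, Hom.sgn a.1.snd •
      (koszulIncl S T a.rest ∘ₗ
        LinearMap.rTensor (T.obj f.src : Type w) (S.map a.1.snd.op).hom)) +
    (∑ a : RightFactor f, ((-1) ^ d * Hom.sgn a.1.fst) •
      (koszulIncl S T a.rest ∘ₗ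
        LinearMap.lTensor (S.obj (op f.tgt) : Type v) (T.map a.1.fst).hom))

/-- The differential squares to zero. -/
def KoszulSquareZero : Prop :=
  ∀ d, koszulDiff S T d ∘ₗ koszulDiff S T (d + 1) = 0

/-- The chain complex `K(S, Ω_n^epi, T)`. -/
noncomputable def koszulComplex (h : KoszulSquareZero S T) :
    ChainComplex (ModuleCat.{max v w} k) ℕ :=
  ChainComplex.of (fun d => ModuleCat.of k (KoszulModule S T d))
    (fun d => ModuleCat.ofHom (koszulDiff S T d))
    (fun d => by rw [← ModuleCat.ofHom_comp, h d]; rfl)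

end Koszul

end PrunedTree

namespace PrunedTree

variable {n : ℕ}

/-! ### Morphisms as quotients of ordered level sets -/

/-! Because `pt_σ` vanishes away from `σ`, splitting off a left factor of degree one contributes
nothing to the differential. What remains is a complex with a basis of pairs: a morphism `h : τ ⟶ σ`
and a factorization `τ ⟶ θ ⟶ σ` of it, in degree `deg θ - deg σ`. The differential sums, with signs,
over the ways of merging one further pair of vertices of `θ`. Thus the complex splits over `h`, and
each summand is spanned by the quotients of `τ` lying over `σ`. A quotient is the same as the family
of preorders it induces on the levels of `τ`. It can be built from the root upwards, and the only
freedom is how to compare vertices that have the same image under `h` and whose parents are already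
identified (`ext_of_fibres`, `exists_of_tieBreak`).

Square zero. The factors `(-1)^d` and `(-1)^(d+1)` always multiply to `-1`, so it suffices that for
a morphism of degree two the products of the signs of its factorizations cancel. The sign of a
degree-one morphism is the product of the sorting signs of a word in the source and of its image
word in the target (`sgn_eq_wordSign`). In a composite the word of the middle tree then occurs
twice, up to a permutation. If there is one factorization, there are exactly two, of opposite sign
(`isDiamond_of_mid`). They come from a triple of siblings, from two disjoint pairs of siblings, or
from a pair that becomes siblings only after the first merge and may then be put in either order.

Exactness. If `τ ≠ σ`, every `h` has positive degree, and its factorizations carry an acyclic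
perfect matching (`hasAcyclicMatching`): a chosen leaf `z` is either alone or in a block, and the
move splits it off to the place right after its block. If `h` identifies sibling leaves, one fixed
`z` works for all factorizations. Otherwise `z` is the least leaf standing out of order relative to
a later leaf with the same parent and image. Factorizations without such a leaf are determined by
their truncation, where induction on the height applies. The rank of the matching makes the
differential triangular with units `±1` on matched pairs. Hence every chain is a boundary plus a
chain on upper elements, and the differential is injective on the latter (`exists_eq_add_supported`,
`eq_zero_of_supported`). -/

@[simp]
theorem comp_app {T S R : PrunedTree n} (f : T ⟶ S) (g : S ⟶ R) (i : Fin (n + 1))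
    (x : Fin (T.size i)) : Hom.app (f ≫ g) i x = Hom.app g i (Hom.app f i x) := rfl

theorem hom_ext {T S : PrunedTree n} {f g : T ⟶ S}
    (h : ∀ i x, Hom.app f i x = Hom.app g i x) : f = g :=
  Hom.ext (funext fun i => funext fun x => h i x)

theorem hom_cancel {T S R : PrunedTree n} (g : T ⟶ S) {w w' : S ⟶ R} (h : g ≫ w = g ≫ w') :
    w = w' := by
  refine hom_ext fun i x => ?_
  obtain ⟨y, rfl⟩ := Hom.surjective_app g i x
  exact congrArg (fun f : T ⟶ R => Hom.app f i y) h

theorem subsingleton_level_last (T : PrunedTree n) (x y : Fin (T.size (Fin.last n))) : x = y := by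
  have : Subsingleton (Fin (T.size (Fin.last n))) := by rw [T.size_last]; infer_instance
  exact Subsingleton.elim _ _

/-- A morphism factors through a quotient as soon as it is compatible with the identifications
and with the order on the fibres of the quotient. -/
theorem exists_factor {T M S : PrunedTree n} (g : T ⟶ M) (f : T ⟶ S)
    (h₁ : ∀ i x y, Hom.app g i x = Hom.app g i y → Hom.app f i x = Hom.app f i y)
    (h₂ : ∀ (i : Fin n) x y, Hom.app g i.succ (T.map i x) = Hom.app g i.succ (T.map i y) →
      Hom.app g i.castSucc x ≤ Hom.app g i.castSucc y →
      Hom.app f i.castSucc x ≤ Hom.app f i.castSucc y) :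
    ∃ w : M ⟶ S, g ≫ w = f := by
  let w : ∀ i, Fin (M.size i) → Fin (S.size i) := fun i x =>
    Hom.app f i (Function.surjInv (Hom.surjective_app g i) x)
  have hw : ∀ i x, w i (Hom.app g i x) = Hom.app f i x := fun i x =>
    h₁ i _ _ (Function.surjInv_eq (Hom.surjective_app g i) _)
  refine ⟨⟨w, fun i y => ?_, fun i x => ?_, fun i x y hxy hle => ?_⟩, hom_ext hw⟩
  · obtain ⟨x, rfl⟩ := Hom.surjective_app f i y
    exact ⟨Hom.app g i x, hw i x⟩
  · obtain ⟨x, rfl⟩ := Hom.surjective_app g i.castSucc x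
    rw [hw, Hom.comm, Hom.comm, hw]
  · obtain ⟨x, rfl⟩ := Hom.surjective_app g i.castSucc x
    obtain ⟨y, rfl⟩ := Hom.surjective_app g i.castSucc y
    rw [hw, hw]
    exact h₂ i x y (by rwa [← Hom.comm, ← Hom.comm]) hle

/-- The parents of two vertices are ordered as the vertices are. -/
theorem app_parent_le {T M : PrunedTree n} (g : T ⟶ M) (i : Fin n) {x y : Fin (T.size i.castSucc)}
    (h : Hom.app g i.castSucc x ≤ Hom.app g i.castSucc y) :
    Hom.app g i.succ (T.map i x) ≤ Hom.app g i.succ (T.map i y) := by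
  rw [← Hom.comm, ← Hom.comm]
  exact M.monotone_map i h

theorem app_parent_eq {T M : PrunedTree n} (g : T ⟶ M) (i : Fin n) {x y : Fin (T.size i.castSucc)}
    (h : Hom.app g i.castSucc x = Hom.app g i.castSucc y) :
    Hom.app g i.succ (T.map i x) = Hom.app g i.succ (T.map i y) := by
  rw [← Hom.comm, ← Hom.comm, h]

theorem app_lt_of_parent_lt {T M : PrunedTree n} (g : T ⟶ M) (i : Fin n)
    {x y : Fin (T.size i.castSucc)}
    (h : Hom.app g i.succ (T.map i x) < Hom.app g i.succ (T.map i y)) :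
    Hom.app g i.castSucc x < Hom.app g i.castSucc y :=
  not_le.1 fun h' => absurd (app_parent_le g i h') (not_le.2 h)

/-! ### Trees with prescribed level orders -/

section Realize

variable (T : PrunedTree n) (r : ∀ i : Fin (n + 1), Fin (T.size i) → ℕ)

/-- The position of `r i x` among the values of `r i`. -/
def rankIndex (i : Fin (n + 1)) (x : Fin (T.size i)) :
    Fin ((Finset.univ.image (r i)).card) :=
  ((Finset.univ.image (r i)).orderIsoOfFin rfl).symm
    ⟨r i x, Finset.mem_image_of_mem _ (Finset.mem_univ _)⟩

theorem rankIndex_le (i : Fin (n + 1)) (x y : Fin (T.size i)) :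
    T.rankIndex r i x ≤ T.rankIndex r i y ↔ r i x ≤ r i y := by
  simp [rankIndex]

theorem rankIndex_eq (i : Fin (n + 1)) (x y : Fin (T.size i)) :
    T.rankIndex r i x = T.rankIndex r i y ↔ r i x = r i y := by
  simp [le_antisymm_iff, rankIndex_le]

theorem rankIndex_surjective (i : Fin (n + 1)) : Function.Surjective (T.rankIndex r i) := by
  intro y
  have h := ((Finset.univ.image (r i)).orderIsoOfFin rfl y).2
  obtain ⟨x, -, hx⟩ := Finset.mem_image.1 h
  refine ⟨x, ?_⟩
  rw [rankIndex, OrderIso.symm_apply_eq]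
  exact Subtype.ext hx

/-- The quotient of a tree by the level preorders given by rank functions. -/
noncomputable def realize (h₂ : ∀ (i : Fin n) x y, r i.castSucc x ≤ r i.castSucc y →
      r i.succ (T.map i x) ≤ r i.succ (T.map i y)) : PrunedTree n where
  size i := (Finset.univ.image (r i)).card
  map i x := T.rankIndex r i.succ (T.map i (Function.surjInv (T.rankIndex_surjective r _) x))
  monotone_map i x y hxy := by
    rw [rankIndex_le]
    apply h₂
    rwa [← rankIndex_le, Function.surjInv_eq (T.rankIndex_surjective r _),
      Function.surjInv_eq (T.rankIndex_surjective r _)]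
  surjective_map i y := by
    obtain ⟨y, rfl⟩ := T.rankIndex_surjective r _ y
    obtain ⟨x, rfl⟩ := T.surjective_map i y
    refine ⟨T.rankIndex r _ x, ?_⟩
    have h := (rankIndex_eq T r _ _ _).1
      (Function.surjInv_eq (T.rankIndex_surjective r _) (T.rankIndex r i.castSucc x))
    rw [rankIndex_eq]
    exact le_antisymm (h₂ i _ _ h.le) (h₂ i _ _ h.ge)
  size_last := by
    have : Subsingleton (Fin (T.size (Fin.last n))) := ⟨T.subsingleton_level_last⟩
    rw [Finset.card_image_of_injective _ (Function.injective_of_subsingleton _)]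
    simp [T.size_last]

/-- The level preorders can be prescribed subject to two constraints only: `h₂` makes the structure
maps of the quotient well defined and monotone, and `h₃` is the fibre condition on the quotient map.
-/
theorem exists_quotient
    (h₂ : ∀ (i : Fin n) x y, r i.castSucc x ≤ r i.castSucc y →
      r i.succ (T.map i x) ≤ r i.succ (T.map i y))
    (h₃ : ∀ (i : Fin n) x y, T.map i x = T.map i y → x ≤ y →
      r i.castSucc x ≤ r i.castSucc y) :
    ∃ (M : PrunedTree n) (g : T ⟶ M),
      ∀ i x y, Hom.app g i x ≤ Hom.app g i y ↔ r i x ≤ r i y := by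
  refine ⟨T.realize r h₂, ⟨T.rankIndex r, T.rankIndex_surjective r, fun i x => ?_,
    fun i x y h hxy => ?_⟩, T.rankIndex_le r⟩
  · have h := (rankIndex_eq T r _ _ _).1
      (Function.surjInv_eq (T.rankIndex_surjective r _) (T.rankIndex r i.castSucc x))
    change T.rankIndex r i.succ _ = _
    rw [rankIndex_eq]
    exact le_antisymm (h₂ i _ _ h.le) (h₂ i _ _ h.ge)
  · exact (T.rankIndex_le r _ _ _).2 (h₃ i x y h hxy)

end Realize

/-! ### Factorizations as families of preorders -/

theorem eq_of_fac {T S : PrunedTree n} {f : T ⟶ S} (a : Factorization f) (i : Fin (n + 1))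
    (x : Fin (T.size i)) : Hom.app a.snd i (Hom.app a.fst i x) = Hom.app f i x := by
  rw [← comp_app, a.fac]

theorem Factorization.app_eq {T S : PrunedTree n} {f : T ⟶ S} (a : Factorization f)
    {i : Fin (n + 1)} {x y : Fin (T.size i)} (h : Hom.app a.fst i x = Hom.app a.fst i y) :
    Hom.app f i x = Hom.app f i y := by
  rw [← eq_of_fac a, ← eq_of_fac a, h]

theorem Factorization.app_le {T S : PrunedTree n} {f : T ⟶ S} (a : Factorization f)
    {i : Fin n} {x y : Fin (T.size i.castSucc)}
    (hp : Hom.app a.fst i.succ (T.map i x) = Hom.app a.fst i.succ (T.map i y))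
    (h : Hom.app a.fst i.castSucc x ≤ Hom.app a.fst i.castSucc y) :
    Hom.app f i.castSucc x ≤ Hom.app f i.castSucc y := by
  rw [← eq_of_fac a, ← eq_of_fac a]
  exact Hom.mono_fibre a.snd i _ _ (by rwa [Hom.comm, Hom.comm]) h

/-- Quotients with the same level preorders are equal. -/
theorem Factorization.ext_of_le {T S : PrunedTree n} {f : T ⟶ S} {a b : Factorization f}
    (h : ∀ i x y, Hom.app a.fst i x ≤ Hom.app a.fst i y ↔ Hom.app b.fst i x ≤ Hom.app b.fst i y) :
    a = b := by
  have he : ∀ i x y, Hom.app a.fst i x = Hom.app a.fst i y ↔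
      Hom.app b.fst i x = Hom.app b.fst i y := fun i x y => by
    rw [le_antisymm_iff, le_antisymm_iff, h, h]
  obtain ⟨w, hw⟩ := exists_factor a.fst b.fst (fun i x y => (he i x y).1)
    (fun i x y _ => (h _ x y).1)
  obtain ⟨w', hw'⟩ := exists_factor b.fst a.fst (fun i x y => (he i x y).2)
    (fun i x y _ => (h _ x y).2)
  have hmid := eq_of_homs w w'
  obtain ⟨M, g, u, hu⟩ := a
  obtain ⟨M', g', u', hu'⟩ := b
  obtain rfl : M = M' := hmid
  have hg : g = g' := by
    refine hom_ext fun i x => ?_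
    -- On each level the comparison map is an order automorphism of a finite chain, hence the
    -- identity.
    have hmono : StrictMono (Hom.app w i) := by
      refine Monotone.strictMono_of_injective ?_
        (Finite.injective_iff_surjective.2 (Hom.surjective_app w i))
      intro x y hxy
      obtain ⟨x, rfl⟩ := Hom.surjective_app g i x
      obtain ⟨y, rfl⟩ := Hom.surjective_app g i y
      have h' : Hom.app g' i x ≤ Hom.app g' i y := (h i x y).1 hxy
      have hx : Hom.app w i (Hom.app g i x) = Hom.app g' i x := by rw [← comp_app, hw]
      have hy : Hom.app w i (Hom.app g i y) = Hom.app g' i y := by rw [← comp_app, hw]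
      rwa [hx, hy]
    let e : Fin (M.size i) ≃o Fin (M.size i) :=
      hmono.orderIsoOfSurjective _ (Hom.surjective_app w i)
    have := DFunLike.congr_fun (Subsingleton.elim e (OrderIso.refl _)) (Hom.app g i x)
    have h2 : Hom.app w i (Hom.app g i x) = Hom.app g i x := this
    rw [← h2, ← comp_app, hw]
  subst hg
  have : u = u' := hom_cancel g (hu.trans hu'.symm)
  subst this
  rfl

/-- A factorization is determined by the relative order of the vertices with the same image. -/
theorem Factorization.ext_of_fibres {T S : PrunedTree n} {f : T ⟶ S} {a b : Factorization f}
    (h : ∀ (i : Fin n) x y, Hom.app f i.castSucc x = Hom.app f i.castSucc y → x ≠ y →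
      Hom.app a.fst i.succ (T.map i x) = Hom.app a.fst i.succ (T.map i y) →
      Hom.app b.fst i.succ (T.map i x) = Hom.app b.fst i.succ (T.map i y) →
      (Hom.app a.fst i.castSucc x ≤ Hom.app a.fst i.castSucc y ↔
        Hom.app b.fst i.castSucc x ≤ Hom.app b.fst i.castSucc y)) :
    a = b := by
  refine ext_of_le fun i => ?_
  -- Going up from the root: different parents decide the order; with equal parents, different
  -- images under `f` decide it, since the second factor is monotone on fibres. Only ties under `f`
  -- are left to the hypothesis.
  induction i using Fin.reverseInduction with
  | last => intro x y; rw [T.subsingleton_level_last x y]; simp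
  | cast i ih =>
    intro x y
    rcases lt_trichotomy (Hom.app a.fst i.succ (T.map i x)) (Hom.app a.fst i.succ (T.map i y))
      with hl | he | hg
    · have hl' : Hom.app b.fst i.succ (T.map i x) < Hom.app b.fst i.succ (T.map i y) := by
        rw [← not_le, ← ih, not_le]; exact hl
      exact iff_of_true (app_lt_of_parent_lt _ _ hl).le (app_lt_of_parent_lt _ _ hl').le
    · have he' : Hom.app b.fst i.succ (T.map i x) = Hom.app b.fst i.succ (T.map i y) :=
        le_antisymm ((ih _ _).1 he.le) ((ih _ _).1 he.ge)
      rcases lt_trichotomy (Hom.app f i.castSucc x) (Hom.app f i.castSucc y) with hf | hf | hf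
      · have key : ∀ c : Factorization f,
            Hom.app c.fst i.succ (T.map i x) = Hom.app c.fst i.succ (T.map i y) →
            Hom.app c.fst i.castSucc x ≤ Hom.app c.fst i.castSucc y := fun c hc =>
          le_of_not_ge fun h' => absurd (c.app_le hc.symm h') (not_le.2 hf)
        exact iff_of_true (key a he) (key b he')
      · by_cases hxy : x = y
        · subst hxy; simp
        · exact h i x y hf hxy he he'
      · have key : ∀ c : Factorization f,
            Hom.app c.fst i.succ (T.map i x) = Hom.app c.fst i.succ (T.map i y) →
            ¬ Hom.app c.fst i.castSucc x ≤ Hom.app c.fst i.castSucc y := fun c hc h' =>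
          absurd (c.app_le hc h') (not_le.2 hf)
        exact iff_of_false (key a he) (key b he')
    · have hg' : Hom.app b.fst i.succ (T.map i y) < Hom.app b.fst i.succ (T.map i x) := by
        rw [← not_le, ← ih, not_le]; exact hg
      exact iff_of_false (not_le.2 (app_lt_of_parent_lt _ _ hg))
        (not_le.2 (app_lt_of_parent_lt _ _ hg'))

/-! ### Truncation -/

/-- Removing level `0` from a morphism. -/
def trHom {T S : PrunedTree (n + 1)} (f : T ⟶ S) : T.tr ⟶ S.tr where
  app i x := Hom.app f i.succ x
  surjective_app i := Hom.surjective_app f i.succ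
  comm i x := Hom.comm f i.succ x
  mono_fibre i x y h hxy := Hom.mono_fibre f i.succ x y h hxy

/-- Removing level `0` from a factorization. -/
def Factorization.tr {T S : PrunedTree (n + 1)} {f : T ⟶ S} (a : Factorization f) :
    Factorization (trHom f) where
  mid := a.mid.tr
  fst := trHom a.fst
  snd := trHom a.snd
  fac := hom_ext fun i x => eq_of_fac a i.succ x

theorem exists_nat_rank {m : ℕ} {L : Type*} [LinearOrder L] (r : Fin m → L) :
    ∃ r' : Fin m → ℕ, ∀ x y, r' x ≤ r' y ↔ r x ≤ r y := by
  classical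
  refine ⟨fun x => (Finset.univ.filter fun y => r y < r x).card,
    fun x y => ⟨fun h => ?_, fun h => ?_⟩⟩
  · by_contra hlt
    rw [not_le] at hlt
    refine absurd h (not_le.2 (Finset.card_lt_card ?_))
    rw [Finset.ssubset_iff_of_subset]
    · exact ⟨y, by simpa using hlt, by simp⟩
    · intro z hz
      simp only [Finset.mem_filter, Finset.mem_univ, true_and] at hz ⊢
      exact hz.trans hlt
  · refine Finset.card_le_card fun z hz => ?_
    simp only [Finset.mem_filter, Finset.mem_univ, true_and] at hz ⊢
    exact hz.trans_le h

/-- Extending a factorization of the truncation by a preorder on level `0`. -/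
theorem exists_extension {T S : PrunedTree (n + 1)} {f : T ⟶ S} (a : Factorization (trHom f))
    {L : Type*} [LinearOrder L] (r : Fin (T.size 0) → L)
    (h₂ : ∀ x y : Fin (T.size 0), r x ≤ r y →
      Hom.app a.fst 0 (T.map 0 x) ≤ Hom.app a.fst 0 (T.map 0 y))
    (h₃ : ∀ x y : Fin (T.size 0), T.map 0 x = T.map 0 y → x ≤ y → r x ≤ r y)
    (h₄ : ∀ x y, r x = r y → Hom.app f 0 x = Hom.app f 0 y)
    (h₅ : ∀ x y : Fin (T.size 0), Hom.app a.fst 0 (T.map 0 x) = Hom.app a.fst 0 (T.map 0 y) →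
      r x ≤ r y → Hom.app f 0 x ≤ Hom.app f 0 y) :
    ∃ b : Factorization f, b.tr = a ∧
      ∀ x y, Hom.app b.fst 0 x ≤ Hom.app b.fst 0 y ↔ r x ≤ r y := by
  obtain ⟨r', hr'⟩ := exists_nat_rank r
  -- The levels above `0` keep their positions in `a.mid`; only level `0` uses the new order.
  let ρ : ∀ i : Fin (n + 1 + 1), Fin (T.size i) → ℕ :=
    Fin.cases (motive := fun i => Fin (T.size i) → ℕ) r' fun j x => (Hom.app a.fst j x).val
  obtain ⟨M, g, hg⟩ := exists_quotient T ρ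
    (fun i => by
      refine Fin.cases ?_ (fun j => ?_) i
      · intro x y h
        exact h₂ x y ((hr' x y).1 h)
      · intro x y h
        exact app_parent_le a.fst j h)
    (fun i => by
      refine Fin.cases ?_ (fun j => ?_) i
      · intro x y h hxy
        exact (hr' x y).2 (h₃ x y h hxy)
      · intro x y h hxy
        exact Hom.mono_fibre a.fst j x y h hxy)
  have hg0 : ∀ x y, Hom.app g 0 x ≤ Hom.app g 0 y ↔ r x ≤ r y := fun x y =>
    (hg 0 x y).trans (hr' x y)
  have hgs : ∀ (j : Fin (n + 1)) x y, Hom.app g j.succ x ≤ Hom.app g j.succ y ↔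
      Hom.app a.fst j x ≤ Hom.app a.fst j y := fun j x y => hg j.succ x y
  have hgs' : ∀ (j : Fin (n + 1)) x y, Hom.app g j.succ x = Hom.app g j.succ y ↔
      Hom.app a.fst j x = Hom.app a.fst j y := fun j x y => by
    rw [le_antisymm_iff, le_antisymm_iff, hgs, hgs]
  obtain ⟨u, hu⟩ := exists_factor g f
    (fun i => by
      refine Fin.cases ?_ (fun j => ?_) i
      · intro x y h
        exact h₄ x y (le_antisymm ((hg0 _ _).1 h.le) ((hg0 _ _).1 h.ge))
      · intro x y h
        exact a.app_eq ((hgs' j x y).1 h))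
    (fun i => by
      refine Fin.cases ?_ (fun j => ?_) i
      · intro x y hp h
        exact h₅ x y ((hgs' 0 _ _).1 hp) ((hg0 _ _).1 h)
      · intro x y hp h
        exact a.app_le (i := j) ((hgs' j.succ _ _).1 hp) ((hgs j.castSucc _ _).1 h))
  refine ⟨⟨M, g, u, hu⟩, Factorization.ext_of_le fun i x y => hgs i x y, hg0⟩

theorem Factorization.ext_of_tr {T S : PrunedTree (n + 1)} {f : T ⟶ S} {a b : Factorization f}
    (h : a.tr = b.tr)
    (h₀ : ∀ x y, Hom.app a.fst 0 x ≤ Hom.app a.fst 0 y ↔ Hom.app b.fst 0 x ≤ Hom.app b.fst 0 y) :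
    a = b := by
  have hs : ∀ (i : Fin (n + 1)) x y, Hom.app a.fst i.succ x ≤ Hom.app a.fst i.succ y ↔
      Hom.app b.fst i.succ x ≤ Hom.app b.fst i.succ y := by
    intro i x y
    change Hom.app a.tr.fst i x ≤ Hom.app a.tr.fst i y ↔ Hom.app b.tr.fst i x ≤ Hom.app b.tr.fst i y
    rw [h]
  refine ext_of_le fun i => ?_
  refine Fin.cases ?_ (fun j => ?_) i
  · exact h₀
  · exact hs j

/-- Extending a factorization of the truncation by breaking ties on level `0`. -/
theorem exists_extension_lex {T S : PrunedTree (n + 1)} {f : T ⟶ S} (a : Factorization (trHom f))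
    (t : Fin (T.size 0) → ℕ)
    (ht : ∀ x y : Fin (T.size 0), T.map 0 x = T.map 0 y → Hom.app f 0 x = Hom.app f 0 y →
      x ≤ y → t x ≤ t y) :
    ∃ b : Factorization f, b.tr = a ∧
      ∀ x y : Fin (T.size 0), Hom.app a.fst 0 (T.map 0 x) = Hom.app a.fst 0 (T.map 0 y) →
        Hom.app f 0 x = Hom.app f 0 y →
        (Hom.app b.fst 0 x ≤ Hom.app b.fst 0 y ↔ t x ≤ t y) := by
  -- The parent comes first so that the structure map is monotone, then the image under `f` so that
  -- the second factor is monotone on fibres; `t` decides only the remaining ties.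
  let r : Fin (T.size 0) → (Fin (a.mid.size 0) ×ₗ Fin (S.size 0) ×ₗ ℕ) := fun x =>
    toLex (Hom.app a.fst 0 (T.map 0 x), toLex (Hom.app f 0 x, t x))
  have h₂ : ∀ x y, r x ≤ r y →
      Hom.app a.fst 0 (T.map 0 x) ≤ Hom.app a.fst 0 (T.map 0 y) := fun x y h => by
    rw [Prod.Lex.le_iff] at h
    rcases h with h | h
    · exact h.le
    · exact h.1.le
  have h₃ : ∀ x y, T.map 0 x = T.map 0 y → x ≤ y → r x ≤ r y := fun x y hp hxy => by
    have hf := Hom.mono_fibre f 0 x y hp hxy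
    rw [Prod.Lex.le_iff]
    refine Or.inr ⟨congrArg (Hom.app a.fst 0) hp, ?_⟩
    rw [Prod.Lex.le_iff]
    rcases hf.lt_or_eq with hf | hf
    · exact Or.inl hf
    · exact Or.inr ⟨hf, ht x y hp hf hxy⟩
  have h₅ : ∀ x y, Hom.app a.fst 0 (T.map 0 x) = Hom.app a.fst 0 (T.map 0 y) → r x ≤ r y →
      Hom.app f 0 x ≤ Hom.app f 0 y := fun x y hp h => by
    rw [Prod.Lex.le_iff] at h
    rcases h with h | h
    · exact absurd hp h.ne
    · have h2 := h.2
      rw [Prod.Lex.le_iff] at h2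
      rcases h2 with h2 | h2
      · exact h2.le
      · exact h2.1.le
  obtain ⟨b, hb, hb'⟩ := exists_extension a r h₂ h₃
    (fun x y h => congrArg (fun z => (ofLex (ofLex z).2).1) h) h₅
  refine ⟨b, hb, fun x y hp hf => (hb' x y).trans ?_⟩
  simp only [r, Prod.Lex.le_iff, ofLex_toLex, hp, hf, lt_irrefl, true_and, false_or]

/-- Any rule for breaking ties between vertices with the same image that respects the order of
siblings comes from a factorization. -/
theorem exists_of_tieBreak {n : ℕ} {T S : PrunedTree n} (f : T ⟶ S)
    (t : ∀ i : Fin n, Fin (T.size i.castSucc) → ℕ)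
    (ht : ∀ i x y, T.map i x = T.map i y → Hom.app f i.castSucc x = Hom.app f i.castSucc y →
      x ≤ y → t i x ≤ t i y) :
    ∃ b : Factorization f, ∀ (i : Fin n) x y,
      Hom.app b.fst i.succ (T.map i x) = Hom.app b.fst i.succ (T.map i y) →
      Hom.app f i.castSucc x = Hom.app f i.castSucc y →
      (Hom.app b.fst i.castSucc x ≤ Hom.app b.fst i.castSucc y ↔ t i x ≤ t i y) := by
  induction n with
  | zero => exact ⟨⟨T, 𝟙 T, f, Category.id_comp f⟩, fun i => i.elim0⟩
  | succ n ih =>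
    obtain ⟨a, ha⟩ := ih (trHom f) (fun i x => t i.succ x) (fun i x y => ht i.succ x y)
    obtain ⟨b, rfl, hb⟩ := exists_extension_lex a (t 0) (ht 0)
    refine ⟨b, fun i => ?_⟩
    refine Fin.cases ?_ (fun j => ?_) i
    · exact hb
    · exact ha j

end PrunedTree

namespace PrunedTree

variable {n : ℕ}

/-! ### The planar order -/

theorem path_castSucc : ∀ {n : ℕ} (T : PrunedTree n) (i : Fin n) (x : Fin (T.size i.castSucc)),
    T.path i.castSucc x = T.path i.succ (T.map i x) ++ [x.val]
  | 0, _, i, _ => i.elim0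
  | n + 1, T, i, x => by
    revert x
    refine Fin.cases ?_ (fun j => ?_) i
    · intro x; rfl
    · intro x; exact path_castSucc T.tr j x

theorem length_path (T : PrunedTree n) (i : Fin (n + 1)) (x : Fin (T.size i)) :
    (T.path i x).length + i = n := by
  induction i using Fin.reverseInduction with
  | last =>
    suffices h : T.path (Fin.last n) x = [] by simp [h]
    induction n with
    | zero => rfl
    | succ n ih => exact ih T.tr x
  | cast i ih =>
    have := ih (T.map i x)
    rw [path_castSucc]
    simp only [List.length_append, List.length_singleton, Fin.val_castSucc, Fin.val_succ] at this ⊢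
    omega

theorem path_injective (T : PrunedTree n) (i : Fin (n + 1)) : Function.Injective (T.path i) := by
  induction i using Fin.reverseInduction with
  | last => exact fun x y _ => T.subsingleton_level_last x y
  | cast i ih =>
    intro x y h
    rw [path_castSucc, path_castSucc] at h
    have := List.append_inj_right' h rfl
    simpa [Fin.ext_iff] using this

/-- The length of a path determines the level, so vertices of different levels cannot share a path.
This makes `Before` a total order on vertices. -/
theorem path_vertex_injective (T : PrunedTree n) :
    Function.Injective fun x : T.Vertex => T.path x.1.castSucc x.2 := by
  rintro ⟨i, x⟩ ⟨j, y⟩ h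
  have h₁ := T.length_path i.castSucc x
  have h₂ := T.length_path j.castSucc y
  dsimp only at h
  rw [h] at h₁
  obtain rfl : i = j := by
    ext
    simp only [Fin.val_castSucc] at h₁ h₂
    omega
  rw [T.path_injective _ h]

theorem before_or_before (T : PrunedTree n) {x y : T.Vertex} (h : x ≠ y) :
    T.Before x y ∨ T.Before y x :=
  lt_or_gt_of_ne fun h' => h (T.path_vertex_injective h')

theorem not_before_of_before (T : PrunedTree n) {x y : T.Vertex} (h : T.Before x y) :
    ¬ T.Before y x := lt_asymm (α := List ℕ) h

theorem not_before_self (T : PrunedTree n) (x : T.Vertex) : ¬ T.Before x x :=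
  lt_irrefl (α := List ℕ) _

theorem before_of_siblings (T : PrunedTree n) (i : Fin n) {x y : Fin (T.size i.castSucc)}
    (h : T.map i x = T.map i y) (hxy : x < y) : T.Before ⟨i, x⟩ ⟨i, y⟩ := by
  change T.path i.castSucc x < T.path i.castSucc y
  rw [path_castSucc, path_castSucc, h]
  exact List.append_left_lt (List.Lex.rel hxy)

/-! ### Signs of words of vertices -/

/-- The sign of a pair of vertices: `1` if they are in planar order, and `-1` otherwise. -/
def pairSign (T : PrunedTree n) (x y : T.Vertex) : ℤ := if T.Before x y then 1 else -1

theorem pairSign_swap (T : PrunedTree n) {x y : T.Vertex} (h : x ≠ y) :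
    T.pairSign y x = -T.pairSign x y := by
  rcases T.before_or_before h with h' | h' <;>
    simp [pairSign, h', T.not_before_of_before h']

theorem pairSign_mul_self (T : PrunedTree n) (x y : T.Vertex) :
    T.pairSign x y * T.pairSign x y = 1 := by
  unfold pairSign; split_ifs <;> rfl

theorem pairSign_eq_ite (T : PrunedTree n) {x y : T.Vertex} (h : x ≠ y) :
    T.pairSign x y = if T.Before y x then -1 else 1 := by
  rcases T.before_or_before h with h' | h' <;>
    simp [pairSign, h', T.not_before_of_before h']

/-- The sign of the permutation that puts a word of vertices into planar order. -/
def wordSign (T : PrunedTree n) : List T.Vertex → ℤ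
  | [] => 1
  | x :: l => (l.map (T.pairSign x)).prod * wordSign T l

theorem wordSign_mul_self (T : PrunedTree n) (l : List T.Vertex) :
    T.wordSign l * T.wordSign l = 1 := by
  have h : ∀ (x : T.Vertex) (l : List T.Vertex),
      (l.map (T.pairSign x)).prod * (l.map (T.pairSign x)).prod = 1 := by
    intro x l
    induction l with
    | nil => rfl
    | cons y l ih =>
      simp only [List.map_cons, List.prod_cons]
      rw [mul_mul_mul_comm, T.pairSign_mul_self, ih, one_mul]
  induction l with
  | nil => rfl
  | cons x l ih => rw [wordSign, mul_mul_mul_comm, h, ih, one_mul]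

theorem wordSign_swap (T : PrunedTree n) {x y : T.Vertex} (h : x ≠ y) (l : List T.Vertex) :
    T.wordSign (y :: x :: l) = -T.wordSign (x :: y :: l) := by
  simp only [wordSign, List.map_cons, List.prod_cons, T.pairSign_swap h]
  ring

theorem neg_one_pow_card_filter {α : Type*} [Fintype α] [DecidableEq α] (p : α → Prop)
    [DecidablePred p] {l : List α} (hl : l.Nodup) (hl' : ∀ x, x ∈ l) :
    (-1 : ℤ) ^ (Finset.univ.filter p).card = (l.map fun x => if p x then -1 else 1).prod := by
  have : (Finset.univ : Finset α) = l.toFinset := by ext; simp [hl']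
  rw [this, ← List.prod_toFinset _ hl, Finset.prod_ite]
  simp

theorem neg_one_pow_card_filter_prod {α : Type*} [Fintype α] [DecidableEq α] (p : α × α → Prop)
    [DecidablePred p] {l : List α} (hl : l.Nodup) (hl' : ∀ x, x ∈ l) :
    (-1 : ℤ) ^ (Finset.univ.filter p).card =
      (l.map fun x => (l.map fun y => if p (x, y) then -1 else 1).prod).prod := by
  have : (Finset.univ : Finset α) = l.toFinset := by ext; simp [hl']
  have h2 : (-1 : ℤ) ^ (Finset.univ.filter p).card = ∏ x : α × α, if p x then -1 else 1 := by
    rw [Finset.prod_ite]; simp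
  rw [h2, Fintype.prod_prod_type, this, List.prod_toFinset _ hl]
  simp only [List.prod_toFinset _ hl]

/-- An unordered pair is an inversion exactly when its signs in `T` and in `S` differ, whichever
member is listed first. The product over all pairs is therefore the product of the two sorting
signs. -/
theorem prod_inversions {T S : PrunedTree n} (f : Hom T S) {l : List T.Vertex}
    (hl : (l.map f.onVertex).Nodup) :
    (l.map fun x => (l.map fun y =>
      if T.Before x y ∧ S.Before (f.onVertex y) (f.onVertex x) then (-1 : ℤ) else 1).prod).prod =
      T.wordSign l * S.wordSign (l.map f.onVertex) := by
  induction l with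
  | nil => rfl
  | cons x l ih =>
    rw [List.map_cons, List.nodup_cons] at hl
    simp only [List.map_cons, List.prod_cons, List.prod_map_mul, ih hl.2, wordSign, List.map_map]
    have hxx : ¬ (T.Before x x ∧ S.Before (f.onVertex x) (f.onVertex x)) :=
      fun h => T.not_before_self x h.1
    rw [if_neg hxx, one_mul]
    have key : (l.map fun y =>
        if T.Before x y ∧ S.Before (f.onVertex y) (f.onVertex x) then (-1 : ℤ) else 1).prod *
        (l.map fun y =>
        if T.Before y x ∧ S.Before (f.onVertex x) (f.onVertex y) then (-1 : ℤ) else 1).prod =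
        (l.map (T.pairSign x)).prod * (l.map (S.pairSign (f.onVertex x) ∘ f.onVertex)).prod := by
      rw [← List.prod_map_mul, ← List.prod_map_mul]
      congr 1
      refine List.map_congr_left fun y hy => ?_
      have hf : f.onVertex x ≠ f.onVertex y := fun h => hl.1 (h ▸ List.mem_map_of_mem hy)
      have hxy : x ≠ y := fun h => hf (h ▸ rfl)
      rcases T.before_or_before hxy with h | h <;> rcases S.before_or_before hf with h' | h' <;>
        simp [pairSign, h, h', T.not_before_of_before h, S.not_before_of_before h']
    linear_combination (T.wordSign l * S.wordSign (l.map f.onVertex)) * key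

/-- The sign of a morphism that identifies just one pair of vertices. -/
theorem sgn_eq_wordSign {T S : PrunedTree n} (f : Hom T S) {a b : T.Vertex}
    (hab : T.Before a b) (hf : f.onVertex a = f.onVertex b)
    (hinj : ∀ x y, x ≠ y → f.onVertex x = f.onVertex y → (x = a ∧ y = b) ∨ (x = b ∧ y = a))
    {R : List T.Vertex} (hR : (a :: b :: R).Nodup) (hR' : ∀ x, x ∈ a :: b :: R) :
    f.sgn = T.wordSign (a :: b :: R) * S.wordSign (f.onVertex a :: R.map f.onVertex) := by
  have hne : a ≠ b := fun h => T.not_before_self b (h ▸ hab)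
  have hma : f.Merged a := ⟨b, hne.symm, hf.symm⟩
  have hmb : f.Merged b := ⟨a, hne, hf⟩
  have ha : ∀ y ∈ R, y ≠ a := fun y hy h => by
    subst h; exact (List.nodup_cons.1 hR).1 (List.mem_cons_of_mem _ hy)
  have hb : ∀ y ∈ R, y ≠ b := fun y hy h => by
    subst h; exact (List.nodup_cons.1 (List.nodup_cons.1 hR).2).1 hy
  have hm : ∀ y ∈ R, ¬ f.Merged y := by
    rintro y hy ⟨x, hx, hxy⟩
    rcases hinj x y hx hxy with h | h
    · exact hb y hy h.2
    · exact ha y hy h.2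
  have hm' : ∀ x, f.Merged x → f.onVertex x = f.onVertex a := by
    rintro x ⟨y, hy, hxy⟩
    rcases hinj y x hy hxy with h | h
    · rw [h.2, hf]
    · rw [h.2]
  have hRn : (R.map f.onVertex).Nodup := by
    refine List.Nodup.map_on (fun x hx y hy h => ?_) (List.nodup_cons.1 (List.nodup_cons.1 hR).2).2
    by_contra hxy
    exact hm x hx ⟨y, Ne.symm hxy, h.symm⟩
  -- Bringing `a` and `b` to the front costs one transposition for each other vertex before `a` and
  -- one for each before `b`.
  have front : (-1 : ℤ) ^ f.frontExponent =
      (R.map (T.pairSign a)).prod * (R.map (T.pairSign b)).prod := by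
    rw [Hom.frontExponent, neg_one_pow_card_filter_prod _ hR hR', ← List.prod_map_mul]
    simp only [List.map_cons, List.prod_cons, hma, hmb, not_true_eq_false, false_and, if_false,
      List.map_const', List.prod_replicate, one_pow, one_mul, true_and]
    congr 1
    refine List.map_congr_left fun y hy => ?_
    have h1 : (R.map fun z => if ¬ f.Merged y ∧ f.Merged z ∧ T.Before y z then (-1 : ℤ) else 1) =
        R.map fun _ => 1 := List.map_congr_left fun z hz => by simp [hm z hz]
    rw [h1, T.pairSign_eq_ite (ha y hy).symm, T.pairSign_eq_ite (hb y hy).symm]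
    simp [hm y hy]
  have re1 : (-1 : ℤ) ^ (Finset.univ.filter fun y : T.Vertex =>
      ¬ f.Merged y ∧ ∃ x, f.Merged x ∧ S.Before (f.onVertex y) (f.onVertex x)).card =
      (R.map (S.pairSign (f.onVertex a) ∘ f.onVertex)).prod := by
    rw [neg_one_pow_card_filter _ hR hR']
    simp only [List.map_cons, List.prod_cons, hma, hmb, not_true_eq_false, false_and, if_false,
      one_mul]
    congr 1
    refine List.map_congr_left fun y hy => ?_
    have hfy : f.onVertex a ≠ f.onVertex y := fun h => hm y hy ⟨a, (ha y hy).symm, h⟩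
    rw [Function.comp_apply, S.pairSign_eq_ite hfy]
    refine if_congr ⟨?_, fun h => ⟨hm y hy, a, hma, h⟩⟩ rfl rfl
    rintro ⟨-, x, hx, h⟩
    rwa [hm' x hx] at h
  have re2 : (-1 : ℤ) ^ (Finset.univ.filter fun p : T.Vertex × T.Vertex =>
      ¬ f.Merged p.1 ∧ ¬ f.Merged p.2 ∧ T.Before p.1 p.2 ∧
        S.Before (f.onVertex p.2) (f.onVertex p.1)).card =
      T.wordSign R * S.wordSign (R.map f.onVertex) := by
    rw [neg_one_pow_card_filter_prod _ hR hR', ← prod_inversions f hRn]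
    simp only [List.map_cons, List.prod_cons, hma, hmb, not_true_eq_false, false_and, if_false,
      List.map_const', List.prod_replicate, one_pow, one_mul, and_false]
    congr 1
    refine List.map_congr_left fun y hy => ?_
    congr 1
    refine List.map_congr_left fun z hz => ?_
    simp [hm y hy, hm z hz]
  rw [Hom.sgn, Hom.reorderExponent, pow_add, pow_add, front, re1, re2]
  simp only [wordSign, List.map_cons, List.prod_cons, List.map_map]
  have : T.pairSign a b = 1 := if_pos hab
  rw [this]
  ring

theorem sgn_mul_self {T S : PrunedTree n} (f : Hom T S) : f.sgn * f.sgn = 1 := by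
  rw [Hom.sgn, ← mul_pow]; simp

end PrunedTree

namespace PrunedTree

variable {n : ℕ}

/-! ### Morphisms of degree one -/

theorem card_vertex (T : PrunedTree n) : Fintype.card T.Vertex = T.deg := by
  simp [deg]

theorem onVertex_surjective {T S : PrunedTree n} (f : T ⟶ S) :
    Function.Surjective (Hom.onVertex f) := by
  rintro ⟨i, y⟩
  obtain ⟨x, rfl⟩ := Hom.surjective_app f i.castSucc y
  exact ⟨⟨i, x⟩, rfl⟩

theorem onVertex_mk_eq {T S : PrunedTree n} (f : T ⟶ S) {i : Fin n}
    {x y : Fin (T.size i.castSucc)} :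
    Hom.onVertex f ⟨i, x⟩ = Hom.onVertex f ⟨i, y⟩ ↔
      Hom.app f i.castSucc x = Hom.app f i.castSucc y := by
  simp [Hom.onVertex]

/-- Without `p` the map is still surjective, as `q` replaces `p`, and the cardinalities now agree.
So it is injective there, and every collision is that of `p` with `q`. -/
theorem eq_or_eq_of_card_eq_succ {α β : Type*} [Fintype α] [Fintype β] {f : α → β}
    (hf : Function.Surjective f) (hc : Fintype.card α = Fintype.card β + 1) {p q : α}
    (hpq : p ≠ q) (h : f p = f q) {x y : α} (hxy : x ≠ y) (hfxy : f x = f y) :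
    (x = p ∧ y = q) ∨ (x = q ∧ y = p) := by
  classical
  have hs : Function.Surjective fun x : {x // x ≠ p} => f x := by
    intro z
    obtain ⟨x, rfl⟩ := hf z
    by_cases hx : x = p
    · exact ⟨⟨q, hpq.symm⟩, by rw [hx, h]⟩
    · exact ⟨⟨x, hx⟩, rfl⟩
  have hc' : Fintype.card {x // x ≠ p} = Fintype.card β := by
    rw [Fintype.card_subtype_compl, Fintype.card_subtype_eq]; omega
  have hi := ((Fintype.bijective_iff_surjective_and_card _).2 ⟨hs, hc'⟩).1
  have key : ∀ x y, x ≠ p → y ≠ p → f x = f y → x = y := fun x y hx hy hh =>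
    congrArg Subtype.val (@hi ⟨x, hx⟩ ⟨y, hy⟩ hh)
  by_cases hx : x = p
  · subst hx
    exact Or.inl ⟨rfl, key y q hxy.symm hpq.symm (hfxy.symm.trans h)⟩
  · by_cases hy : y = p
    · subst hy
      exact Or.inr ⟨key x q hx hpq.symm (hfxy.trans h), rfl⟩
    · exact absurd (key x y hx hy hfxy) hxy

/-- The morphism `f` identifies the siblings `p < q` of level `i`, and no other vertices. -/
structure Merges {T S : PrunedTree n} (f : T ⟶ S) (i : Fin n)
    (p q : Fin (T.size i.castSucc)) : Prop where
  lt : p < q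
  siblings : T.map i p = T.map i q
  app_eq : Hom.app f i.castSucc p = Hom.app f i.castSucc q
  unique : ∀ x y : T.Vertex, x ≠ y → Hom.onVertex f x = Hom.onVertex f y →
    (x = ⟨i, p⟩ ∧ y = ⟨i, q⟩) ∨ (x = ⟨i, q⟩ ∧ y = ⟨i, p⟩)

theorem vertex_mk_ne {T : PrunedTree n} {i : Fin n} {x y : Fin (T.size i.castSucc)} (h : x ≠ y) :
    (⟨i, x⟩ : T.Vertex) ≠ ⟨i, y⟩ := fun h' => h (by simpa using h')

theorem vertex_mk_inj {T : PrunedTree n} {i : Fin n} {x y : Fin (T.size i.castSucc)}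
    (h : (⟨i, x⟩ : T.Vertex) = ⟨i, y⟩) : x = y := by simpa using h

theorem injective_of_unique {T S : PrunedTree n} (f : T ⟶ S) {i : Fin n}
    {p q : Fin (T.size i.castSucc)}
    (h : ∀ x y : T.Vertex, x ≠ y → Hom.onVertex f x = Hom.onVertex f y →
      (x = ⟨i, p⟩ ∧ y = ⟨i, q⟩) ∨ (x = ⟨i, q⟩ ∧ y = ⟨i, p⟩))
    {k : Fin (n + 1)} (hk : k ≠ i.castSucc) : Function.Injective (Hom.app f k) := by
  induction k using Fin.lastCases with
  | last => exact fun x y _ => T.subsingleton_level_last x y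
  | cast j =>
    intro x y hxy
    by_contra hne
    have hj : j ≠ i := fun h => hk (h ▸ rfl)
    rcases h ⟨j, x⟩ ⟨j, y⟩ (vertex_mk_ne hne) ((onVertex_mk_eq f).2 hxy) with h | h <;>
      exact hj (congrArg Sigma.fst h.1)

theorem castSucc_ne_succ_self (i : Fin n) : i.succ ≠ i.castSucc := by
  simp [Fin.ext_iff]

theorem Merges.siblings_of_app_eq {T S : PrunedTree n} {f : T ⟶ S} {i : Fin n}
    {p q : Fin (T.size i.castSucc)} (h : Merges f i p q) {x y : Fin (T.size i.castSucc)}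
    (hxy : S.map i (Hom.app f i.castSucc x) = S.map i (Hom.app f i.castSucc y)) :
    T.map i x = T.map i y :=
  injective_of_unique f h.unique (castSucc_ne_succ_self i) (by rwa [← Hom.comm, ← Hom.comm])

/-- Counting leaves exactly one collision. The level of the parents is then mapped injectively, and
the parents have the same image, so the colliding vertices are siblings. -/
theorem exists_merges {T S : PrunedTree n} (f : T ⟶ S) (hd : T.deg = S.deg + 1) :
    ∃ i p q, Merges f i p q := by
  have hc : Fintype.card T.Vertex = Fintype.card S.Vertex + 1 := by
    rw [card_vertex, card_vertex, hd]
  have hni : ¬ Function.Injective (Hom.onVertex f) := fun hi => by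
    have := Fintype.card_le_of_injective _ hi
    omega
  simp only [Function.Injective, not_forall] at hni
  obtain ⟨⟨i, x⟩, ⟨j, y⟩, hxy, hne⟩ := hni
  obtain rfl : i = j := congrArg Sigma.fst hxy
  have hxy' := (onVertex_mk_eq f).1 hxy
  have hne' : x ≠ y := fun h => hne (h ▸ rfl)
  have main : ∀ x y : Fin (T.size i.castSucc), x < y →
      Hom.app f i.castSucc x = Hom.app f i.castSucc y → Merges f i x y := by
    intro x y hlt hf
    have hu : ∀ u v : T.Vertex, u ≠ v → Hom.onVertex f u = Hom.onVertex f v →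
        (u = ⟨i, x⟩ ∧ v = ⟨i, y⟩) ∨ (u = ⟨i, y⟩ ∧ v = ⟨i, x⟩) := fun u v huv h =>
      eq_or_eq_of_card_eq_succ (onVertex_surjective f) hc (vertex_mk_ne hlt.ne)
        ((onVertex_mk_eq f).2 hf) huv h
    refine ⟨hlt, ?_, hf, hu⟩
    refine injective_of_unique f hu (castSucc_ne_succ_self i) ?_
    rw [← Hom.comm, ← Hom.comm, hf]
  rcases lt_or_gt_of_ne hne' with h | h
  · exact ⟨i, x, y, main x y h hxy'⟩
  · exact ⟨i, y, x, main y x h hxy'.symm⟩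

theorem merges_of_lt {T S : PrunedTree n} (f : T ⟶ S) (hd : T.deg = S.deg + 1) {i : Fin n}
    {x y : Fin (T.size i.castSucc)} (hlt : x < y)
    (hf : Hom.app f i.castSucc x = Hom.app f i.castSucc y) : Merges f i x y := by
  obtain ⟨j, p, q, h⟩ := exists_merges f hd
  rcases h.unique ⟨i, x⟩ ⟨i, y⟩ (vertex_mk_ne hlt.ne) ((onVertex_mk_eq f).2 hf) with hu | hu
  · obtain rfl : i = j := congrArg Sigma.fst hu.1
    obtain rfl := vertex_mk_inj hu.1
    obtain rfl := vertex_mk_inj hu.2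
    exact h
  · obtain rfl : i = j := congrArg Sigma.fst hu.1
    obtain rfl := vertex_mk_inj hu.1
    obtain rfl := vertex_mk_inj hu.2
    exact absurd hlt h.lt.asymm

theorem Merges.deg_eq {T S : PrunedTree n} {f : T ⟶ S} {i : Fin n}
    {p q : Fin (T.size i.castSucc)} (h : Merges f i p q) : T.deg = S.deg + 1 := by
  classical
  have himg : (Finset.univ.erase (⟨i, q⟩ : T.Vertex)).image (Hom.onVertex f) = Finset.univ := by
    ext y
    simp only [Finset.mem_image, Finset.mem_erase, Finset.mem_univ, and_true, iff_true]
    obtain ⟨x, rfl⟩ := onVertex_surjective f y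
    by_cases hx : x = ⟨i, q⟩
    · exact ⟨⟨i, p⟩, vertex_mk_ne h.lt.ne, by rw [hx]; exact (onVertex_mk_eq f).2 h.app_eq⟩
    · exact ⟨x, hx, rfl⟩
  have hinj : Set.InjOn (Hom.onVertex f) (Finset.univ.erase (⟨i, q⟩ : T.Vertex)) := by
    intro x hx y hy hxy
    simp only [Finset.coe_erase, Finset.coe_univ, Set.mem_sdiff, Set.mem_univ,
      Set.mem_singleton_iff, true_and] at hx hy
    by_contra hne
    rcases h.unique x y hne hxy with h | h
    · exact hy h.2
    · exact hx h.1
  have hcard := Finset.card_image_of_injOn hinj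
  rw [himg, Finset.card_erase_of_mem (Finset.mem_univ _), Finset.card_univ, Finset.card_univ,
    card_vertex, card_vertex] at hcard
  have : 0 < T.deg := by
    rw [← card_vertex]; exact Fintype.card_pos_iff.2 ⟨⟨i, q⟩⟩
  omega

theorem Merges.app_ne {T S : PrunedTree n} {f : T ⟶ S} {i : Fin n}
    {p q : Fin (T.size i.castSucc)} (h : Merges f i p q) {j : Fin n} {x y : Fin (T.size j.castSucc)}
    (hne : x ≠ y)
    (h' : ¬ (((⟨j, x⟩ : T.Vertex) = ⟨i, p⟩ ∧ (⟨j, y⟩ : T.Vertex) = ⟨i, q⟩) ∨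
      ((⟨j, x⟩ : T.Vertex) = ⟨i, q⟩ ∧ (⟨j, y⟩ : T.Vertex) = ⟨i, p⟩))) :
    Hom.app f j.castSucc x ≠ Hom.app f j.castSucc y := fun he =>
  h' (h.unique _ _ (vertex_mk_ne hne) ((onVertex_mk_eq f).2 he))

/-! ### Signs of composites of degree two -/

theorem Merges.sgn_eq {T S : PrunedTree n} {f : T ⟶ S} {i : Fin n}
    {p q : Fin (T.size i.castSucc)} (h : Merges f i p q) {R : List T.Vertex}
    (hR : ((⟨i, p⟩ : T.Vertex) :: ⟨i, q⟩ :: R).Nodup)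
    (hR' : ∀ x, x ∈ (⟨i, p⟩ : T.Vertex) :: ⟨i, q⟩ :: R) :
    Hom.sgn f = T.wordSign (⟨i, p⟩ :: ⟨i, q⟩ :: R) *
      S.wordSign (Hom.onVertex f ⟨i, p⟩ :: R.map (Hom.onVertex f)) :=
  sgn_eq_wordSign f (T.before_of_siblings i h.siblings h.lt) ((onVertex_mk_eq f).2 h.app_eq)
    h.unique hR hR'

theorem wordSign_rotate (T : PrunedTree n) {p r s : T.Vertex} (hr : p ≠ r) (hs : p ≠ s)
    (l : List T.Vertex) : T.wordSign (r :: s :: p :: l) = T.wordSign (p :: r :: s :: l) := by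
  simp only [wordSign, List.map_cons, List.prod_cons, T.pairSign_swap hr, T.pairSign_swap hs]
  ring

theorem wordSign_rotate₂ (T : PrunedTree n) {p q r s : T.Vertex} (h₁ : p ≠ r) (h₂ : p ≠ s)
    (h₃ : q ≠ r) (h₄ : q ≠ s) (l : List T.Vertex) :
    T.wordSign (r :: s :: p :: q :: l) = T.wordSign (p :: q :: r :: s :: l) := by
  simp only [wordSign, List.map_cons, List.prod_cons, T.pairSign_swap h₁, T.pairSign_swap h₂,
    T.pairSign_swap h₃, T.pairSign_swap h₄]
  ring

theorem wordSign_swap_second (T : PrunedTree n) (p q : T.Vertex) {r s : T.Vertex} (h : r ≠ s)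
    (l : List T.Vertex) :
    T.wordSign (p :: q :: s :: r :: l) = -T.wordSign (p :: q :: r :: s :: l) := by
  simp only [wordSign, List.map_cons, List.prod_cons, T.pairSign_swap h]
  ring

section

variable {T S : PrunedTree n} {f : T ⟶ S}

/-- The product of the signs of the two factors of a morphism of degree two. -/
def Factorization.sgnMul (a : Factorization f) : ℤ := Hom.sgn a.fst * Hom.sgn a.snd

theorem onVertex_fac (a : Factorization f) (x : T.Vertex) :
    Hom.onVertex a.snd (Hom.onVertex a.fst x) = Hom.onVertex f x := by
  conv_rhs => rw [← a.fac]
  rfl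

theorem map_onVertex_fac (a : Factorization f) (l : List T.Vertex) :
    (l.map (Hom.onVertex a.fst)).map (Hom.onVertex a.snd) = l.map (Hom.onVertex f) := by
  rw [List.map_map]
  exact List.map_congr_left fun x _ => onVertex_fac a x

theorem mid_nodup (a : Factorization f) {i : Fin n} {p q : Fin (T.size i.castSucc)}
    (h : Merges a.fst i p q) {R : List T.Vertex}
    (hR : ((⟨i, p⟩ : T.Vertex) :: ⟨i, q⟩ :: R).Nodup) :
    (((⟨i, p⟩ : T.Vertex) :: R).map (Hom.onVertex a.fst)).Nodup := by
  have h1 := List.nodup_cons.1 hR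
  have h2 := List.nodup_cons.1 h1.2
  refine List.Nodup.map_on (fun x hx y hy hxy => ?_)
    (List.nodup_cons.2 ⟨fun h' => h1.1 (List.mem_cons_of_mem _ h'), h2.2⟩)
  have hq : ∀ z ∈ (⟨i, p⟩ : T.Vertex) :: R, z ≠ ⟨i, q⟩ := by
    rintro z hz rfl
    rcases List.mem_cons.1 hz with h' | h'
    · exact h1.1 (h' ▸ List.mem_cons_self)
    · exact h2.1 h'
  by_contra hne
  rcases h.unique x y hne hxy with h | h
  · exact hq y hy h.2
  · exact hq x hx h.1

theorem mid_complete (a : Factorization f) {i : Fin n} {p q : Fin (T.size i.castSucc)}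
    (h : Merges a.fst i p q) {R : List T.Vertex}
    (hR : ∀ x, x ∈ (⟨i, p⟩ : T.Vertex) :: ⟨i, q⟩ :: R) (y : a.mid.Vertex) :
    y ∈ ((⟨i, p⟩ : T.Vertex) :: R).map (Hom.onVertex a.fst) := by
  obtain ⟨x, rfl⟩ := onVertex_surjective a.fst y
  rcases List.mem_cons.1 (hR x) with rfl | hx
  · exact List.mem_map_of_mem List.mem_cons_self
  · rcases List.mem_cons.1 hx with rfl | hx
    · refine List.mem_map.2 ⟨⟨i, p⟩, List.mem_cons_self, (onVertex_mk_eq a.fst).2 h.app_eq⟩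
    · exact List.mem_map_of_mem (List.mem_cons_of_mem _ hx)

/-- The two words of the middle tree differ by moving two letters past one, an even permutation, so
their signs cancel. The target word starts with the pair merged last; this asymmetry yields the
opposite signs when two disjoint merges are exchanged. -/
theorem sgnMul_of_disjoint (a : Factorization f) {i : Fin n} {p q : Fin (T.size i.castSucc)}
    (h : Merges a.fst i p q) {j : Fin n} {r s : Fin (T.size j.castSucc)}
    (h' : Merges a.snd j (Hom.app a.fst j.castSucc r) (Hom.app a.fst j.castSucc s))
    {R : List T.Vertex}
    (hR : ((⟨i, p⟩ : T.Vertex) :: ⟨i, q⟩ :: ⟨j, r⟩ :: ⟨j, s⟩ :: R).Nodup)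
    (hR' : ∀ x, x ∈ (⟨i, p⟩ : T.Vertex) :: ⟨i, q⟩ :: ⟨j, r⟩ :: ⟨j, s⟩ :: R) :
    a.sgnMul = T.wordSign (⟨i, p⟩ :: ⟨i, q⟩ :: ⟨j, r⟩ :: ⟨j, s⟩ :: R) *
      S.wordSign (Hom.onVertex f ⟨j, r⟩ :: Hom.onVertex f ⟨i, p⟩ :: R.map (Hom.onVertex f)) := by
  have hn := mid_nodup a h hR
  have hc := mid_complete a h hR'
  rw [Factorization.sgnMul, h.sgn_eq hR hR']
  simp only [List.map_cons, List.nodup_cons, List.mem_cons, not_or] at hn hc ⊢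
  have hM := h'.sgn_eq (R := Hom.onVertex a.fst ⟨i, p⟩ :: R.map (Hom.onVertex a.fst)) (by
      simp only [List.nodup_cons, List.mem_cons, not_or]
      exact ⟨⟨hn.2.1.1, Ne.symm hn.1.1, hn.2.1.2⟩, ⟨Ne.symm hn.1.2.1, hn.2.2.1⟩, hn.1.2.2, hn.2.2.2⟩)
    (by
      intro y
      have := hc y
      simp only [List.mem_cons]
      change y = Hom.onVertex a.fst ⟨j, r⟩ ∨ y = Hom.onVertex a.fst ⟨j, s⟩ ∨ _
      tauto)
  rw [hM, List.map_cons, onVertex_fac, map_onVertex_fac]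
  have e := onVertex_fac a ⟨j, r⟩
  change Hom.onVertex a.snd ⟨j, Hom.app a.fst j.castSucc r⟩ = _ at e
  rw [e]
  have hrot := a.mid.wordSign_rotate (p := Hom.onVertex a.fst ⟨i, p⟩)
    (r := Hom.onVertex a.fst ⟨j, r⟩) (s := Hom.onVertex a.fst ⟨j, s⟩) hn.1.1 hn.1.2.1
    (R.map (Hom.onVertex a.fst))
  change _ * _ * (a.mid.wordSign (Hom.onVertex a.fst ⟨j, r⟩ :: Hom.onVertex a.fst ⟨j, s⟩ ::
    Hom.onVertex a.fst ⟨i, p⟩ :: R.map (Hom.onVertex a.fst)) * _) = _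
  rw [hrot]
  have hsq := a.mid.wordSign_mul_self (Hom.onVertex a.fst ⟨i, p⟩ :: Hom.onVertex a.fst ⟨j, r⟩ ::
    Hom.onVertex a.fst ⟨j, s⟩ :: R.map (Hom.onVertex a.fst))
  linear_combination (T.wordSign (⟨i, p⟩ :: ⟨i, q⟩ :: ⟨j, r⟩ :: ⟨j, s⟩ :: R) *
      S.wordSign (Hom.onVertex f ⟨j, r⟩ :: Hom.onVertex f ⟨i, p⟩ :: R.map (Hom.onVertex f))) * hsq

/-- When the block of `p` and `q` is the left member of the second pair, both signs use the same
word of the middle tree. -/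
theorem sgnMul_of_right (a : Factorization f) {i : Fin n} {p q s : Fin (T.size i.castSucc)}
    (h : Merges a.fst i p q)
    (h' : Merges a.snd i (Hom.app a.fst i.castSucc p) (Hom.app a.fst i.castSucc s))
    {R : List T.Vertex}
    (hR : ((⟨i, p⟩ : T.Vertex) :: ⟨i, q⟩ :: ⟨i, s⟩ :: R).Nodup)
    (hR' : ∀ x, x ∈ (⟨i, p⟩ : T.Vertex) :: ⟨i, q⟩ :: ⟨i, s⟩ :: R) :
    a.sgnMul = T.wordSign (⟨i, p⟩ :: ⟨i, q⟩ :: ⟨i, s⟩ :: R) *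
      S.wordSign (Hom.onVertex f ⟨i, p⟩ :: R.map (Hom.onVertex f)) := by
  have hn := mid_nodup a h hR
  have hc := mid_complete a h hR'
  have e := onVertex_fac a ⟨i, p⟩
  have hM := h'.sgn_eq (R := R.map (Hom.onVertex a.fst)) hn hc
  rw [Factorization.sgnMul, h.sgn_eq hR hR', hM, map_onVertex_fac]
  change Hom.onVertex a.snd ⟨i, Hom.app a.fst i.castSucc p⟩ = _ at e
  rw [e]
  have hsq := a.mid.wordSign_mul_self (Hom.onVertex a.fst ⟨i, p⟩ ::
    Hom.onVertex a.fst ⟨i, s⟩ :: R.map (Hom.onVertex a.fst))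
  change _ * _ * (a.mid.wordSign (Hom.onVertex a.fst ⟨i, p⟩ ::
    Hom.onVertex a.fst ⟨i, s⟩ :: R.map (Hom.onVertex a.fst)) * _) = _
  rw [List.map_cons]
  linear_combination (T.wordSign (⟨i, p⟩ :: ⟨i, q⟩ :: ⟨i, s⟩ :: R) *
      S.wordSign (Hom.onVertex f ⟨i, p⟩ :: R.map (Hom.onVertex f))) * hsq

/-- When the block of `p` and `q` is the right member of the second pair, the two words of the
middle tree differ by one transposition; this is the source of the minus sign. -/
theorem sgnMul_of_left (a : Factorization f) {i : Fin n} {p q r : Fin (T.size i.castSucc)}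
    (h : Merges a.fst i p q)
    (h' : Merges a.snd i (Hom.app a.fst i.castSucc r) (Hom.app a.fst i.castSucc p))
    {R : List T.Vertex}
    (hR : ((⟨i, p⟩ : T.Vertex) :: ⟨i, q⟩ :: ⟨i, r⟩ :: R).Nodup)
    (hR' : ∀ x, x ∈ (⟨i, p⟩ : T.Vertex) :: ⟨i, q⟩ :: ⟨i, r⟩ :: R) :
    a.sgnMul = -(T.wordSign (⟨i, p⟩ :: ⟨i, q⟩ :: ⟨i, r⟩ :: R) *
      S.wordSign (Hom.onVertex f ⟨i, r⟩ :: R.map (Hom.onVertex f))) := by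
  have hn := mid_nodup a h hR
  have hc := mid_complete a h hR'
  rw [Factorization.sgnMul, h.sgn_eq hR hR']
  simp only [List.map_cons, List.nodup_cons, List.mem_cons, not_or] at hn hc ⊢
  have hM := h'.sgn_eq (R := R.map (Hom.onVertex a.fst)) (by
      simp only [List.nodup_cons, List.mem_cons, not_or]
      exact ⟨⟨Ne.symm hn.1.1, hn.2.1⟩, hn.1.2, hn.2.2⟩)
    (by
      intro y
      have := hc y
      simp only [List.mem_cons]
      change y = Hom.onVertex a.fst ⟨i, r⟩ ∨ y = Hom.onVertex a.fst ⟨i, p⟩ ∨ _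
      tauto)
  rw [hM, map_onVertex_fac]
  have e := onVertex_fac a ⟨i, r⟩
  change Hom.onVertex a.snd ⟨i, Hom.app a.fst i.castSucc r⟩ = _ at e
  rw [e]
  have hsw := a.mid.wordSign_swap (x := Hom.onVertex a.fst ⟨i, p⟩)
    (y := Hom.onVertex a.fst ⟨i, r⟩) hn.1.1 (R.map (Hom.onVertex a.fst))
  change _ * _ * (a.mid.wordSign (Hom.onVertex a.fst ⟨i, r⟩ :: Hom.onVertex a.fst ⟨i, p⟩ ::
    R.map (Hom.onVertex a.fst)) * _) = _
  rw [hsw]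
  have hsq := a.mid.wordSign_mul_self (Hom.onVertex a.fst ⟨i, p⟩ ::
    Hom.onVertex a.fst ⟨i, r⟩ :: R.map (Hom.onVertex a.fst))
  linear_combination -(T.wordSign (⟨i, p⟩ :: ⟨i, q⟩ :: ⟨i, r⟩ :: R) *
      S.wordSign (Hom.onVertex f ⟨i, r⟩ :: R.map (Hom.onVertex f))) * hsq

theorem exists_rest {α : Type*} [Fintype α] (l : List α) (hl : l.Nodup) :
    ∃ R, (l ++ R).Nodup ∧ ∀ x, x ∈ l ++ R := by
  classical
  refine ⟨(Finset.univ.filter (· ∉ l)).toList, ?_, fun x => ?_⟩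
  · rw [List.nodup_append']
    exact ⟨hl, Finset.nodup_toList _, fun x hx hx' => by simp at hx'; exact hx' hx⟩
  · simp only [List.mem_append, Finset.mem_toList, Finset.mem_filter, Finset.mem_univ, true_and]
    exact em _

/-! ### The two factorizations of a morphism of degree two -/

/-- The morphism `f` has exactly two factorizations into morphisms of degree one, with opposite
signs. -/
def IsDiamond (f : T ⟶ S) : Prop :=
  ∃ a b : Factorization f, a.mid.deg = S.deg + 1 ∧ b.mid.deg = S.deg + 1 ∧ a ≠ b ∧
    b.sgnMul = -a.sgnMul ∧ ∀ c : Factorization f, c.mid.deg = S.deg + 1 → c = a ∨ c = b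

/-- A collision in the quotient forces equal images under `f` and equal values of `t`, so `hu`
excludes every pair but the intended one. -/
theorem exists_merges_of_tieBreak (f : T ⟶ S) (t : T.Vertex → ℕ)
    (ht : ∀ i x y, T.map i x = T.map i y → Hom.app f i.castSucc x = Hom.app f i.castSucc y →
      x ≤ y → t ⟨i, x⟩ ≤ t ⟨i, y⟩)
    {i : Fin n} {p q : Fin (T.size i.castSucc)} (hlt : p < q) (hs : T.map i p = T.map i q)
    (hf : Hom.app f i.castSucc p = Hom.app f i.castSucc q) (hpq : t ⟨i, p⟩ = t ⟨i, q⟩)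
    (hu : ∀ (j : Fin n) (x y : Fin (T.size j.castSucc)), x ≠ y →
      Hom.app f j.castSucc x = Hom.app f j.castSucc y → t ⟨j, x⟩ = t ⟨j, y⟩ →
      ((⟨j, x⟩ : T.Vertex) = ⟨i, p⟩ ∧ (⟨j, y⟩ : T.Vertex) = ⟨i, q⟩) ∨
      ((⟨j, x⟩ : T.Vertex) = ⟨i, q⟩ ∧ (⟨j, y⟩ : T.Vertex) = ⟨i, p⟩)) :
    ∃ a : Factorization f, Merges a.fst i p q ∧ ∀ (i : Fin n) x y,
      Hom.app a.fst i.succ (T.map i x) = Hom.app a.fst i.succ (T.map i y) →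
      Hom.app f i.castSucc x = Hom.app f i.castSucc y →
      (Hom.app a.fst i.castSucc x ≤ Hom.app a.fst i.castSucc y ↔ t ⟨i, x⟩ ≤ t ⟨i, y⟩) := by
  obtain ⟨a, ha⟩ := exists_of_tieBreak f (fun i x => t ⟨i, x⟩) ht
  refine ⟨a, ⟨hlt, hs, ?_, ?_⟩, ha⟩
  · have hp : Hom.app a.fst i.succ (T.map i p) = Hom.app a.fst i.succ (T.map i q) := by rw [hs]
    exact le_antisymm ((ha i p q hp hf).2 hpq.le) ((ha i q p hp.symm hf.symm).2 hpq.ge)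
  · rintro ⟨j, x⟩ ⟨j', y⟩ hne h
    obtain rfl : j = j' := congrArg Sigma.fst h
    have h' := (onVertex_mk_eq a.fst).1 h
    have hp := app_parent_eq a.fst j h'
    have hfxy := a.app_eq h'
    exact hu j x y (fun e => hne (e ▸ rfl)) hfxy
      (le_antisymm ((ha j x y hp hfxy).1 h'.le) ((ha j y x hp.symm hfxy.symm).1 h'.ge))

/-- Every vertex is ranked by its own index, except that `q` gets the rank of `p`. By `hadj` no
sibling with the same image lies strictly between them, so sibling order survives. -/
theorem exists_merges_of_siblings (f : T ⟶ S) {i : Fin n} {p q : Fin (T.size i.castSucc)}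
    (hlt : p < q) (hs : T.map i p = T.map i q)
    (hf : Hom.app f i.castSucc p = Hom.app f i.castSucc q)
    (hadj : ∀ x, T.map i x = T.map i p → Hom.app f i.castSucc x = Hom.app f i.castSucc p →
      x ≤ p ∨ q ≤ x) :
    ∃ a : Factorization f, Merges a.fst i p q := by
  let t : T.Vertex → ℕ := fun v => if v = ⟨i, q⟩ then p.val else v.2.val
  have tq : t ⟨i, q⟩ = p.val := if_pos rfl
  have tx : ∀ (j : Fin n) (x : Fin (T.size j.castSucc)), (⟨j, x⟩ : T.Vertex) ≠ ⟨i, q⟩ →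
      t ⟨j, x⟩ = x.val := fun j x h => if_neg h
  have tp : t ⟨i, p⟩ = p.val := tx _ _ (vertex_mk_ne hlt.ne)
  have ht : ∀ i x y, T.map i x = T.map i y → Hom.app f i.castSucc x = Hom.app f i.castSucc y →
      x ≤ y → t ⟨i, x⟩ ≤ t ⟨i, y⟩ := by
    intro j x y hp hxy hle
    by_cases hy : (⟨j, y⟩ : T.Vertex) = ⟨i, q⟩
    · obtain rfl : j = i := congrArg Sigma.fst hy
      obtain rfl := vertex_mk_inj hy
      rcases hle.eq_or_lt with rfl | hlt'
      · exact le_rfl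
      · rw [tq, tx _ _ (vertex_mk_ne hlt'.ne)]
        exact (hadj x (hp.trans hs.symm) (hxy.trans hf.symm)).resolve_right (not_le.2 hlt')
    · rw [tx _ _ hy]
      by_cases hx : (⟨j, x⟩ : T.Vertex) = ⟨i, q⟩
      · obtain rfl : j = i := congrArg Sigma.fst hx
        obtain rfl := vertex_mk_inj hx
        rw [tq]
        exact (hlt.trans_le hle).le
      · rw [tx _ _ hx]
        exact hle
  obtain ⟨a, ha, -⟩ := exists_merges_of_tieBreak f t ht hlt hs hf (tp.trans tq.symm) (by
    intro j x y hne _ hxy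
    by_cases hy : (⟨j, y⟩ : T.Vertex) = ⟨i, q⟩
    · obtain rfl : j = i := congrArg Sigma.fst hy
      obtain rfl := vertex_mk_inj hy
      rw [tq, tx _ _ (vertex_mk_ne hne)] at hxy
      obtain rfl : x = p := Fin.ext hxy
      exact Or.inl ⟨rfl, rfl⟩
    · by_cases hx : (⟨j, x⟩ : T.Vertex) = ⟨i, q⟩
      · obtain rfl : j = i := congrArg Sigma.fst hx
        obtain rfl := vertex_mk_inj hx
        rw [tq, tx _ _ hy] at hxy
        obtain rfl : p = y := Fin.ext hxy
        exact Or.inr ⟨rfl, rfl⟩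
      · rw [tx _ _ hy, tx _ _ hx] at hxy
        exact absurd (Fin.ext hxy) hne)
  exact ⟨a, ha⟩

end

end PrunedTree

/-! ### Morphisms of degree two: triples, disjoint pairs and nested pairs. -/

namespace PrunedTree

variable {n : ℕ}

section

variable {T S : PrunedTree n} {f : T ⟶ S}

theorem Factorization.snd_merges (a : Factorization f) (hd : a.mid.deg = S.deg + 1) {i : Fin n}
    {x y : Fin (T.size i.castSucc)}
    (hlt : Hom.app a.fst i.castSucc x < Hom.app a.fst i.castSucc y)
    (hf : Hom.app f i.castSucc x = Hom.app f i.castSucc y) :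
    Merges a.snd i (Hom.app a.fst i.castSucc x) (Hom.app a.fst i.castSucc y) :=
  merges_of_lt a.snd hd hlt (by rw [eq_of_fac, eq_of_fac, hf])

theorem Factorization.lt_of_siblings (a : Factorization f) {i : Fin n}
    {x y : Fin (T.size i.castSucc)} (hs : T.map i x = T.map i y) (hlt : x < y)
    (hne : Hom.app a.fst i.castSucc x ≠ Hom.app a.fst i.castSucc y) :
    Hom.app a.fst i.castSucc x < Hom.app a.fst i.castSucc y :=
  lt_of_le_of_ne (Hom.mono_fibre a.fst i x y hs hlt.le) hne

/-- The first merge is either `x, y` or `y, z`. The source words differ by a 3-cycle and the target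
words agree, so the sign comes from the merged block being the left member of the second pair in one
case and the right member in the other. -/
theorem isDiamond_of_triple (hd : T.deg = S.deg + 2) {i : Fin n}
    {x y z : Fin (T.size i.castSucc)} (hxy : x < y) (hyz : y < z)
    (sxy : T.map i x = T.map i y) (syz : T.map i y = T.map i z)
    (fxy : Hom.app f i.castSucc x = Hom.app f i.castSucc y)
    (fyz : Hom.app f i.castSucc y = Hom.app f i.castSucc z)
    (hu : ∀ u v : T.Vertex, u ≠ v → Hom.onVertex f u = Hom.onVertex f v →
      (u = ⟨i, x⟩ ∨ u = ⟨i, y⟩ ∨ u = ⟨i, z⟩) ∧ (v = ⟨i, x⟩ ∨ v = ⟨i, y⟩ ∨ v = ⟨i, z⟩)) :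
    IsDiamond f := by
  have hxz := hxy.trans hyz
  have hmem : ∀ w, Hom.app f i.castSucc w = Hom.app f i.castSucc x → w = x ∨ w = y ∨ w = z := by
    intro w hw
    by_cases h : w = x
    · exact Or.inl h
    · simpa using (hu ⟨i, w⟩ ⟨i, x⟩ (vertex_mk_ne h) ((onVertex_mk_eq f).2 hw)).1
  obtain ⟨a, ha⟩ := exists_merges_of_siblings f hxy sxy fxy (fun w _ hw => by
    rcases hmem w hw with rfl | rfl | rfl
    · exact Or.inl le_rfl
    · exact Or.inr le_rfl
    · exact Or.inr hyz.le)
  obtain ⟨b, hb⟩ := exists_merges_of_siblings f hyz syz fyz (fun w _ hw => by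
    rcases hmem w (hw.trans fxy.symm) with rfl | rfl | rfl
    · exact Or.inl hxy.le
    · exact Or.inl le_rfl
    · exact Or.inr le_rfl)
  have had : a.mid.deg = S.deg + 1 := by have := ha.deg_eq; omega
  have hbd : b.mid.deg = S.deg + 1 := by have := hb.deg_eq; omega
  have left : ∀ c : Factorization f, Merges c.fst i x y →
      Hom.app c.fst i.castSucc x < Hom.app c.fst i.castSucc z := fun c hc =>
    c.lt_of_siblings (sxy.trans syz) hxz (hc.app_ne hxz.ne (by
      simp [hyz.ne', hxy.ne, hxz.ne']))
  have right : ∀ c : Factorization f, Merges c.fst i y z →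
      Hom.app c.fst i.castSucc x < Hom.app c.fst i.castSucc y := fun c hc =>
    c.lt_of_siblings sxy hxy (hc.app_ne hxy.ne (by
      simp [hxy.ne, hyz.ne, hxz.ne]))
  have hne : a ≠ b := by
    rintro rfl
    exact (right a hb).ne ha.app_eq
  have hleft : ∀ c : Factorization f, Merges c.fst i x y → c = a := by
    intro c hc
    have h1 := left a ha
    have h2 := left c hc
    refine Factorization.ext_of_fibres fun j u v huv hne _ _ => ?_
    obtain ⟨hu', hv'⟩ := hu ⟨j, u⟩ ⟨j, v⟩ (vertex_mk_ne hne) ((onVertex_mk_eq f).2 huv)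
    have hj : j = i := by
      rcases hu' with h | h | h <;> exact congrArg Sigma.fst h
    subst hj
    simp only [Sigma.mk.injEq, heq_eq_eq, true_and] at hu' hv'
    rcases hu' with rfl | rfl | rfl <;> rcases hv' with rfl | rfl | rfl <;>
      simp [← ha.app_eq, ← hc.app_eq, h1.le, h2.le, h1.not_ge, h2.not_ge]
  have hright : ∀ c : Factorization f, Merges c.fst i y z → c = b := by
    intro c hc
    have h1 := right b hb
    have h2 := right c hc
    refine Factorization.ext_of_fibres fun j u v huv hne _ _ => ?_
    obtain ⟨hu', hv'⟩ := hu ⟨j, u⟩ ⟨j, v⟩ (vertex_mk_ne hne) ((onVertex_mk_eq f).2 huv)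
    have hj : j = i := by
      rcases hu' with h | h | h <;> exact congrArg Sigma.fst h
    subst hj
    simp only [Sigma.mk.injEq, heq_eq_eq, true_and] at hu' hv'
    rcases hu' with rfl | rfl | rfl <;> rcases hv' with rfl | rfl | rfl <;>
      simp [← hb.app_eq, ← hc.app_eq, h1.le, h2.le, h1.not_ge, h2.not_ge]
  refine ⟨a, b, had, hbd, hne, ?_, fun c hcd => ?_⟩
  · obtain ⟨R, hR, hR'⟩ := exists_rest [(⟨i, x⟩ : T.Vertex), ⟨i, y⟩, ⟨i, z⟩] (by
      simp [hxy.ne, hyz.ne, hxz.ne])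
    simp only [List.cons_append, List.nil_append] at hR hR'
    have hperm : ((⟨i, y⟩ : T.Vertex) :: ⟨i, z⟩ :: ⟨i, x⟩ :: R).Perm
        (⟨i, x⟩ :: ⟨i, y⟩ :: ⟨i, z⟩ :: R) :=
      (((List.Perm.swap _ _ R).cons _).trans (List.Perm.swap _ _ _))
    rw [sgnMul_of_right a ha (a.snd_merges had (left a ha) (fxy.trans fyz)) hR hR',
      sgnMul_of_left b hb (b.snd_merges hbd (right b hb) fxy) (hperm.nodup_iff.2 hR)
        (fun v => hperm.mem_iff.2 (hR' v)),
      wordSign_rotate T (vertex_mk_ne hxy.ne) (vertex_mk_ne hxz.ne)]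
  · obtain ⟨j, p, q, hc⟩ := exists_merges c.fst (by omega)
    obtain ⟨hp, hq⟩ := hu ⟨j, p⟩ ⟨j, q⟩ (vertex_mk_ne hc.lt.ne)
      ((onVertex_mk_eq f).2 (c.app_eq hc.app_eq))
    have hj : j = i := by
      rcases hp with h | h | h <;> exact congrArg Sigma.fst h
    subst hj
    simp only [Sigma.mk.injEq, heq_eq_eq, true_and] at hp hq
    have hlt := hc.lt
    rcases hp with rfl | rfl | rfl <;> rcases hq with rfl | rfl | rfl
    · exact absurd hlt (lt_irrefl _)
    · exact Or.inl (hleft c hc)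
    -- Merging the two outer siblings first would, by monotonicity, merge the middle one as well,
    -- which is one collision too many.
    · exfalso
      have h1 := Hom.mono_fibre c.fst j p y sxy hxy.le
      have h2 := Hom.mono_fibre c.fst j y q syz hyz.le
      refine hc.app_ne hxy.ne ?_ (le_antisymm h1 (h2.trans hc.app_eq.ge))
      simp [hyz.ne, hxz.ne]
    · exact absurd hlt hxy.asymm
    · exact absurd hlt (lt_irrefl _)
    · exact Or.inr (hright c hc)
    · exact absurd hlt hxz.asymm
    · exact absurd hlt hyz.asymm
    · exact absurd hlt (lt_irrefl _)

/-- Either pair can be merged first. Exchanging two pairs of letters in the source word is even,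
while exchanging the two merged vertices in the target word is odd. -/
theorem isDiamond_of_disjoint (hd : T.deg = S.deg + 2) {i j : Fin n}
    {p q : Fin (T.size i.castSucc)} {r s : Fin (T.size j.castSucc)} (hpq : p < q) (hrs : r < s)
    (spq : T.map i p = T.map i q) (srs : T.map j r = T.map j s)
    (fpq : Hom.app f i.castSucc p = Hom.app f i.castSucc q)
    (frs : Hom.app f j.castSucc r = Hom.app f j.castSucc s)
    (hpr : (⟨i, p⟩ : T.Vertex) ≠ ⟨j, r⟩) (hps : (⟨i, p⟩ : T.Vertex) ≠ ⟨j, s⟩)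
    (hqr : (⟨i, q⟩ : T.Vertex) ≠ ⟨j, r⟩) (hqs : (⟨i, q⟩ : T.Vertex) ≠ ⟨j, s⟩)
    (hu : ∀ u v : T.Vertex, u ≠ v → Hom.onVertex f u = Hom.onVertex f v →
      (u = ⟨i, p⟩ ∧ v = ⟨i, q⟩ ∨ u = ⟨i, q⟩ ∧ v = ⟨i, p⟩) ∨
      (u = ⟨j, r⟩ ∧ v = ⟨j, s⟩ ∨ u = ⟨j, s⟩ ∧ v = ⟨j, r⟩)) :
    IsDiamond f := by
  have hmem : ∀ w, Hom.app f i.castSucc w = Hom.app f i.castSucc p → w ≤ p ∨ q ≤ w := by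
    intro w hw
    by_cases h : w = p
    · exact Or.inl h.le
    · rcases hu ⟨i, w⟩ ⟨i, p⟩ (vertex_mk_ne h) ((onVertex_mk_eq f).2 hw) with
        (h' | h') | (h' | h')
      · exact absurd (vertex_mk_inj h'.1) h
      · exact Or.inr (vertex_mk_inj h'.1).ge
      · exact absurd h'.2 hps
      · exact absurd h'.2 hpr
  have hmem' : ∀ w, Hom.app f j.castSucc w = Hom.app f j.castSucc r → w ≤ r ∨ s ≤ w := by
    intro w hw
    by_cases h : w = r
    · exact Or.inl h.le
    · rcases hu ⟨j, w⟩ ⟨j, r⟩ (vertex_mk_ne h) ((onVertex_mk_eq f).2 hw) with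
        (h' | h') | (h' | h')
      · exact absurd h'.2.symm hqr
      · exact absurd h'.2.symm hpr
      · exact absurd (vertex_mk_inj h'.1) h
      · exact Or.inr (vertex_mk_inj h'.1).ge
  obtain ⟨a, ha⟩ := exists_merges_of_siblings f hpq spq fpq (fun w _ hw => hmem w hw)
  obtain ⟨b, hb⟩ := exists_merges_of_siblings f hrs srs frs (fun w _ hw => hmem' w hw)
  have had : a.mid.deg = S.deg + 1 := by have := ha.deg_eq; omega
  have hbd : b.mid.deg = S.deg + 1 := by have := hb.deg_eq; omega
  have left : ∀ c : Factorization f, Merges c.fst i p q →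
      Hom.app c.fst j.castSucc r < Hom.app c.fst j.castSucc s := fun c hc =>
    c.lt_of_siblings srs hrs (hc.app_ne hrs.ne (by
      rintro (h | h)
      · exact hpr h.1.symm
      · exact hqr h.1.symm))
  have right : ∀ c : Factorization f, Merges c.fst j r s →
      Hom.app c.fst i.castSucc p < Hom.app c.fst i.castSucc q := fun c hc =>
    c.lt_of_siblings spq hpq (hc.app_ne hpq.ne (by
      rintro (h | h)
      · exact hpr h.1
      · exact hps h.1))
  have hne : a ≠ b := by
    rintro rfl
    exact (right a hb).ne ha.app_eq
  have hleft : ∀ c : Factorization f, Merges c.fst i p q → c = a := by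
    intro c hc
    have h1 := left a ha
    have h2 := left c hc
    refine Factorization.ext_of_fibres fun k u v huv hne _ _ => ?_
    rcases hu ⟨k, u⟩ ⟨k, v⟩ (vertex_mk_ne hne) ((onVertex_mk_eq f).2 huv) with
        (h' | h') | (h' | h') <;>
      obtain ⟨hu', hv'⟩ := h' <;> obtain rfl := congrArg Sigma.fst hu' <;>
      obtain rfl := vertex_mk_inj hu' <;> obtain rfl := vertex_mk_inj hv'
    · exact iff_of_true hc.app_eq.le ha.app_eq.le
    · exact iff_of_true hc.app_eq.ge ha.app_eq.ge
    · exact iff_of_true h2.le h1.le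
    · exact iff_of_false h2.not_ge h1.not_ge
  have hright : ∀ c : Factorization f, Merges c.fst j r s → c = b := by
    intro c hc
    have h1 := right b hb
    have h2 := right c hc
    refine Factorization.ext_of_fibres fun k u v huv hne _ _ => ?_
    rcases hu ⟨k, u⟩ ⟨k, v⟩ (vertex_mk_ne hne) ((onVertex_mk_eq f).2 huv) with
        (h' | h') | (h' | h') <;>
      obtain ⟨hu', hv'⟩ := h' <;> obtain rfl := congrArg Sigma.fst hu' <;>
      obtain rfl := vertex_mk_inj hu' <;> obtain rfl := vertex_mk_inj hv'
    · exact iff_of_true h2.le h1.le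
    · exact iff_of_false h2.not_ge h1.not_ge
    · exact iff_of_true hc.app_eq.le hb.app_eq.le
    · exact iff_of_true hc.app_eq.ge hb.app_eq.ge
  refine ⟨a, b, had, hbd, hne, ?_, fun c hcd => ?_⟩
  · obtain ⟨R, hR, hR'⟩ := exists_rest [(⟨i, p⟩ : T.Vertex), ⟨i, q⟩, ⟨j, r⟩, ⟨j, s⟩] (by
      simp only [List.nodup_cons, List.mem_cons, not_or]
      simp [vertex_mk_ne hpq.ne, vertex_mk_ne hrs.ne, hpr, hps, hqr, hqs, -Sigma.mk.injEq])
    simp only [List.cons_append, List.nil_append] at hR hR'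
    have hperm : ((⟨j, r⟩ : T.Vertex) :: ⟨j, s⟩ :: ⟨i, p⟩ :: ⟨i, q⟩ :: R).Perm
        (⟨i, p⟩ :: ⟨i, q⟩ :: ⟨j, r⟩ :: ⟨j, s⟩ :: R) :=
      (List.perm_append_comm (l₁ := [_, _]) (l₂ := [_, _])).append_right R
    rw [sgnMul_of_disjoint a ha (a.snd_merges had (left a ha) frs) hR hR',
      sgnMul_of_disjoint b hb (b.snd_merges hbd (right b hb) fpq) (hperm.nodup_iff.2 hR)
        (fun v => hperm.mem_iff.2 (hR' v)),
      wordSign_rotate₂ T hpr hps hqr hqs]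
    have hfne : Hom.onVertex f ⟨j, r⟩ ≠ Hom.onVertex f ⟨i, p⟩ := by
      intro h
      rcases hu _ _ hpr.symm h with (h' | h') | (h' | h')
      · exact hpr h'.1.symm
      · exact hqr h'.1.symm
      · exact hps h'.2
      · exact hpr h'.2
    rw [wordSign_swap S hfne]
    ring
  · obtain ⟨k, u, v, hc⟩ := exists_merges c.fst (by omega)
    have hlt := hc.lt
    rcases hu ⟨k, u⟩ ⟨k, v⟩ (vertex_mk_ne hlt.ne)
        ((onVertex_mk_eq f).2 (c.app_eq hc.app_eq)) with (h' | h') | (h' | h') <;>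
      obtain ⟨hu', hv'⟩ := h' <;> obtain rfl := congrArg Sigma.fst hu' <;>
      obtain rfl := vertex_mk_inj hu' <;> obtain rfl := vertex_mk_inj hv'
    · exact Or.inl (hleft c hc)
    · exact absurd hlt hpq.asymm
    · exact Or.inr (hright c hc)
    · exact absurd hlt hrs.asymm

/-- As `r` and `s` are not siblings in `T`, the pair `p, q` has to be merged first. The morphism
from `T` may then place `r` and `s` in either order, and exchanging them changes the source word by
a transposition and leaves the target word unchanged. -/
theorem isDiamond_of_nested (hd : T.deg = S.deg + 2) {i j : Fin n}
    {p q : Fin (T.size i.castSucc)} {r s : Fin (T.size j.castSucc)} (hpq : p < q) (hrs : r < s)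
    (spq : T.map i p = T.map i q) (srs : T.map j r ≠ T.map j s)
    (fpq : Hom.app f i.castSucc p = Hom.app f i.castSucc q)
    (frs : Hom.app f j.castSucc r = Hom.app f j.castSucc s)
    (hpr : (⟨i, p⟩ : T.Vertex) ≠ ⟨j, r⟩) (hps : (⟨i, p⟩ : T.Vertex) ≠ ⟨j, s⟩)
    (hqr : (⟨i, q⟩ : T.Vertex) ≠ ⟨j, r⟩) (hqs : (⟨i, q⟩ : T.Vertex) ≠ ⟨j, s⟩)
    (hu : ∀ u v : T.Vertex, u ≠ v → Hom.onVertex f u = Hom.onVertex f v →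
      (u = ⟨i, p⟩ ∧ v = ⟨i, q⟩ ∨ u = ⟨i, q⟩ ∧ v = ⟨i, p⟩) ∨
      (u = ⟨j, r⟩ ∧ v = ⟨j, s⟩ ∨ u = ⟨j, s⟩ ∧ v = ⟨j, r⟩)) :
    IsDiamond f := by
  -- The parents of `r` and `s` have the same image under `f` and do not lie on level `j`, where `r,
  -- s` collide. The only collision left for them is that of `p, q`, which `c` has already made.
  have hparent : ∀ c : Factorization f, Merges c.fst i p q →
      Hom.app c.fst j.succ (T.map j r) = Hom.app c.fst j.succ (T.map j s) := by
    intro c hc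
    have key : ∀ (k : Fin (n + 1)) (x y : Fin (T.size k)), k ≠ j.castSucc →
        Hom.app f k x = Hom.app f k y → Hom.app c.fst k x = Hom.app c.fst k y := by
      intro k
      induction k using Fin.lastCases with
      | last => intro x y _ _; rw [T.subsingleton_level_last x y]
      | cast l =>
        intro x y hl hf
        by_cases hxy : x = y
        · rw [hxy]
        · have hl' : l ≠ j := fun h => hl (h ▸ rfl)
          rcases hu ⟨l, x⟩ ⟨l, y⟩ (vertex_mk_ne hxy) ((onVertex_mk_eq f).2 hf) with
            (h' | h') | (h' | h')
          · obtain rfl := congrArg Sigma.fst h'.1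
            obtain rfl := vertex_mk_inj h'.1
            obtain rfl := vertex_mk_inj h'.2
            exact hc.app_eq
          · obtain rfl := congrArg Sigma.fst h'.1
            obtain rfl := vertex_mk_inj h'.1
            obtain rfl := vertex_mk_inj h'.2
            exact hc.app_eq.symm
          · exact absurd (congrArg Sigma.fst h'.1) hl'
          · exact absurd (congrArg Sigma.fst h'.1) hl'
    exact key _ _ _ (castSucc_ne_succ_self j) (app_parent_eq f j frs)
  -- The values `t₁, t₂` are the ranks of `r, s`; `0, 1` and `1, 0` give the two orders.
  have build : ∀ t₁ t₂ : ℕ, t₁ ≠ t₂ → ∃ a : Factorization f, Merges a.fst i p q ∧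
      (Hom.app a.fst j.castSucc r ≤ Hom.app a.fst j.castSucc s ↔ t₁ ≤ t₂) := by
    intro t₁ t₂ ht
    let t : T.Vertex → ℕ := fun v => if v = ⟨i, q⟩ then p.val else
      if v = ⟨j, r⟩ then t₁ else if v = ⟨j, s⟩ then t₂ else v.2.val
    have tq : t ⟨i, q⟩ = p.val := if_pos rfl
    have tp : t ⟨i, p⟩ = p.val := by
      simp only [t]
      rw [if_neg (vertex_mk_ne hpq.ne), if_neg hpr, if_neg hps]
    have tr : t ⟨j, r⟩ = t₁ := by
      change ite _ _ _ = _
      rw [if_neg hqr.symm, if_pos rfl]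
    have ts : t ⟨j, s⟩ = t₂ := by
      change ite _ _ _ = _
      rw [if_neg hqs.symm, if_neg (vertex_mk_ne hrs.ne'), if_pos rfl]
    obtain ⟨a, ha, ha'⟩ := exists_merges_of_tieBreak f t (by
      intro k x y hp hf hle
      rcases eq_or_ne x y with rfl | hxy
      · exact le_rfl
      · rcases hu ⟨k, x⟩ ⟨k, y⟩ (vertex_mk_ne hxy) ((onVertex_mk_eq f).2 hf) with
            (h' | h') | (h' | h')
        · rw [h'.1, h'.2, tp, tq]
        · rw [h'.1, h'.2, tp, tq]
        · exfalso
          obtain rfl := congrArg Sigma.fst h'.1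
          obtain rfl := vertex_mk_inj h'.1
          obtain rfl := vertex_mk_inj h'.2
          exact srs hp
        · exfalso
          obtain rfl := congrArg Sigma.fst h'.1
          obtain rfl := vertex_mk_inj h'.1
          obtain rfl := vertex_mk_inj h'.2
          exact srs hp.symm) hpq spq fpq (tp.trans tq.symm) (by
      intro k x y hxy hf h
      rcases hu ⟨k, x⟩ ⟨k, y⟩ (vertex_mk_ne hxy) ((onVertex_mk_eq f).2 hf) with h' | (h' | h')
      · exact h'
      · rw [h'.1, h'.2, tr, ts] at h
        exact absurd h ht
      · rw [h'.1, h'.2, tr, ts] at h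
        exact absurd h.symm ht)
    refine ⟨a, ha, ?_⟩
    rw [ha' j r s (hparent a ha) frs, tr, ts]
  obtain ⟨a, ha, ha'⟩ := build 0 1 (by simp)
  obtain ⟨b, hb, hb'⟩ := build 1 0 (by simp)
  have had : a.mid.deg = S.deg + 1 := by have := ha.deg_eq; omega
  have hbd : b.mid.deg = S.deg + 1 := by have := hb.deg_eq; omega
  have hrs_ne : ∀ c : Factorization f, Merges c.fst i p q →
      Hom.app c.fst j.castSucc r ≠ Hom.app c.fst j.castSucc s := fun c hc =>
    hc.app_ne hrs.ne (by
      rintro (h | h)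
      · exact hpr h.1.symm
      · exact hqr h.1.symm)
  have ha₁ := lt_of_le_of_ne (ha'.2 (by simp)) (hrs_ne a ha)
  have hb₁ : Hom.app b.fst j.castSucc s < Hom.app b.fst j.castSucc r :=
    not_le.1 fun h => absurd (hb'.1 h) (by simp)
  have hext : ∀ c d : Factorization f, Merges c.fst i p q → Merges d.fst i p q →
      (Hom.app c.fst j.castSucc r < Hom.app c.fst j.castSucc s ↔
        Hom.app d.fst j.castSucc r < Hom.app d.fst j.castSucc s) → c = d := by
    intro c d hc hd h
    refine Factorization.ext_of_fibres fun k u v huv hne _ _ => ?_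
    rcases hu ⟨k, u⟩ ⟨k, v⟩ (vertex_mk_ne hne) ((onVertex_mk_eq f).2 huv) with
        (h' | h') | (h' | h') <;>
      obtain ⟨hu', hv'⟩ := h' <;> obtain rfl := congrArg Sigma.fst hu' <;>
      obtain rfl := vertex_mk_inj hu' <;> obtain rfl := vertex_mk_inj hv'
    · exact iff_of_true hc.app_eq.le hd.app_eq.le
    · exact iff_of_true hc.app_eq.ge hd.app_eq.ge
    · rw [(hrs_ne c hc).le_iff_lt, (hrs_ne d hd).le_iff_lt]
      exact h
    · rw [← not_lt, ← not_lt]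
      exact not_congr h
  refine ⟨a, b, had, hbd, ?_, ?_, fun c hcd => ?_⟩
  · rintro rfl
    exact ha₁.asymm hb₁
  · obtain ⟨R, hR, hR'⟩ := exists_rest [(⟨i, p⟩ : T.Vertex), ⟨i, q⟩, ⟨j, r⟩, ⟨j, s⟩] (by
      simp only [List.nodup_cons, List.mem_cons, not_or]
      simp [vertex_mk_ne hpq.ne, vertex_mk_ne hrs.ne, hpr, hps, hqr, hqs, -Sigma.mk.injEq])
    simp only [List.cons_append, List.nil_append] at hR hR'
    have hperm : ((⟨i, p⟩ : T.Vertex) :: ⟨i, q⟩ :: ⟨j, s⟩ :: ⟨j, r⟩ :: R).Perm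
        (⟨i, p⟩ :: ⟨i, q⟩ :: ⟨j, r⟩ :: ⟨j, s⟩ :: R) :=
      ((List.Perm.swap _ _ R).cons _).cons _
    rw [sgnMul_of_disjoint a ha (a.snd_merges had ha₁ frs) hR hR',
      sgnMul_of_disjoint b hb (b.snd_merges hbd hb₁ frs.symm) (hperm.nodup_iff.2 hR)
        (fun v => hperm.mem_iff.2 (hR' v)),
      wordSign_swap_second T _ _ (vertex_mk_ne hrs.ne), (onVertex_mk_eq f).2 frs]
    ring
  · obtain ⟨k, u, v, hc⟩ := exists_merges c.fst (by omega)
    have hlt := hc.lt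
    rcases hu ⟨k, u⟩ ⟨k, v⟩ (vertex_mk_ne hlt.ne)
        ((onVertex_mk_eq f).2 (c.app_eq hc.app_eq)) with (h' | h') | (h' | h') <;>
      obtain ⟨hu', hv'⟩ := h' <;> obtain rfl := congrArg Sigma.fst hu' <;>
      obtain rfl := vertex_mk_inj hu' <;> obtain rfl := vertex_mk_inj hv'
    · rcases lt_or_gt_of_ne (hrs_ne c hc) with h | h
      · exact Or.inl (hext c a hc ha (iff_of_true h ha₁))
      · exact Or.inr (hext c b hc hb (iff_of_false h.asymm hb₁.asymm))
    · exact absurd hlt hpq.asymm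
    · exact absurd hc.siblings srs
    · exact absurd hc.siblings.symm srs

/-- The given factorization shows what `f` identifies: the first pair `p, q`, then the pair of
blocks of `r` and `s`. If one of these blocks is that of `p, q`, there is a triple; otherwise the
cases are separated by whether `r, s` are siblings already in `T`. -/
theorem isDiamond_of_mid (hd : T.deg = S.deg + 2) (a : Factorization f)
    (had : a.mid.deg = S.deg + 1) : IsDiamond f := by
  obtain ⟨i, p, q, ha⟩ := exists_merges a.fst (by omega)
  obtain ⟨j, r', s', hb⟩ := exists_merges a.snd had
  obtain ⟨r, rfl⟩ := Hom.surjective_app a.fst _ r'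
  obtain ⟨s, rfl⟩ := Hom.surjective_app a.fst _ s'
  have hfst : ∀ u v : T.Vertex, Hom.onVertex a.fst u = Hom.onVertex a.fst v → u = v ∨
      (u = ⟨i, p⟩ ∧ v = ⟨i, q⟩ ∨ u = ⟨i, q⟩ ∧ v = ⟨i, p⟩) := fun u v h => by
    by_cases huv : u = v
    · exact Or.inl huv
    · exact Or.inr (ha.unique u v huv h)
  have hu : ∀ u v : T.Vertex, u ≠ v → Hom.onVertex f u = Hom.onVertex f v →
      (u = ⟨i, p⟩ ∧ v = ⟨i, q⟩ ∨ u = ⟨i, q⟩ ∧ v = ⟨i, p⟩) ∨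
      (Hom.onVertex a.fst u = Hom.onVertex a.fst ⟨j, r⟩ ∧
        Hom.onVertex a.fst v = Hom.onVertex a.fst ⟨j, s⟩ ∨
      Hom.onVertex a.fst u = Hom.onVertex a.fst ⟨j, s⟩ ∧
        Hom.onVertex a.fst v = Hom.onVertex a.fst ⟨j, r⟩) := by
    intro u v huv h
    by_cases h' : Hom.onVertex a.fst u = Hom.onVertex a.fst v
    · exact Or.inl (ha.unique u v huv h')
    · exact Or.inr (hb.unique _ _ h' (by rw [onVertex_fac, onVertex_fac, h]))
  have frs : Hom.app f j.castSucc r = Hom.app f j.castSucc s := by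
    have := hb.app_eq
    rwa [eq_of_fac, eq_of_fac] at this
  have fpq : Hom.app f i.castSucc p = Hom.app f i.castSucc q := a.app_eq ha.app_eq
  have apq : Hom.onVertex a.fst ⟨i, q⟩ = Hom.onVertex a.fst ⟨i, p⟩ :=
    (onVertex_mk_eq a.fst).2 ha.app_eq.symm
  by_cases hr : Hom.onVertex a.fst ⟨j, r⟩ = Hom.onVertex a.fst ⟨i, p⟩
  · obtain rfl : j = i := congrArg Sigma.fst hr
    have hr' := (onVertex_mk_eq a.fst).1 hr
    have hps := hb.lt
    rw [hr'] at hps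
    have sps : T.map j p = T.map j s := ha.siblings_of_app_eq (by
      have := hb.siblings; rwa [hr'] at this)
    have hqs : q < s := by
      by_contra hle
      exact absurd (Hom.mono_fibre a.fst j s q (sps.symm.trans ha.siblings) (not_lt.1 hle))
        (not_le.2 (ha.app_eq ▸ hps))
    have hsne : Hom.onVertex a.fst ⟨j, s⟩ ≠ Hom.onVertex a.fst ⟨j, p⟩ := fun h =>
      hps.ne ((onVertex_mk_eq a.fst).1 h).symm
    have hs' : ∀ u, Hom.onVertex a.fst u = Hom.onVertex a.fst ⟨j, s⟩ → u = ⟨j, s⟩ := by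
      intro u h
      rcases hfst u _ h with h' | h' | h'
      · exact h'
      · rw [h'.1] at h; exact absurd h.symm hsne
      · rw [h'.1, apq] at h; exact absurd h.symm hsne
    have hp' : ∀ u, Hom.onVertex a.fst u = Hom.onVertex a.fst ⟨j, r⟩ →
        u = ⟨j, p⟩ ∨ u = ⟨j, q⟩ := by
      intro u h
      rcases hfst u _ (h.trans hr) with h' | h' | h'
      · exact Or.inl h'
      · exact Or.inl h'.1
      · exact Or.inr h'.1
    refine isDiamond_of_triple hd ha.lt hqs ha.siblings (ha.siblings.symm.trans sps) fpq
      (fpq.symm.trans ((a.app_eq hr').symm.trans frs)) fun u v huv h => ?_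
    rcases hu u v huv h with (h' | h') | (h' | h')
    · simp only [h'.1, h'.2, true_or, or_true, and_self]
    · simp only [h'.1, h'.2, true_or, or_true, and_self]
    · have h1 := hp' u h'.1
      have h2 := hs' v h'.2
      tauto
    · have h1 := hp' v h'.2
      have h2 := hs' u h'.1
      tauto
  by_cases hs : Hom.onVertex a.fst ⟨j, s⟩ = Hom.onVertex a.fst ⟨i, p⟩
  · obtain rfl : j = i := congrArg Sigma.fst hs
    have hs' := (onVertex_mk_eq a.fst).1 hs
    have hrp := hb.lt
    rw [hs'] at hrp
    have srp : T.map j r = T.map j p := ha.siblings_of_app_eq (by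
      have := hb.siblings; rwa [hs'] at this)
    have hrp' : r < p := by
      by_contra hle
      exact absurd (Hom.mono_fibre a.fst j p r srp.symm (not_lt.1 hle)) (not_le.2 hrp)
    have hr' : ∀ u, Hom.onVertex a.fst u = Hom.onVertex a.fst ⟨j, r⟩ → u = ⟨j, r⟩ := by
      intro u h
      rcases hfst u _ h with h' | h' | h'
      · exact h'
      · rw [h'.1] at h; exact absurd h.symm hr
      · rw [h'.1, apq] at h; exact absurd h.symm hr
    have hp' : ∀ u, Hom.onVertex a.fst u = Hom.onVertex a.fst ⟨j, s⟩ →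
        u = ⟨j, p⟩ ∨ u = ⟨j, q⟩ := by
      intro u h
      rcases hfst u _ (h.trans hs) with h' | h' | h'
      · exact Or.inl h'
      · exact Or.inl h'.1
      · exact Or.inr h'.1
    refine isDiamond_of_triple hd hrp' ha.lt srp ha.siblings (frs.trans (a.app_eq hs')) fpq
      fun u v huv h => ?_
    rcases hu u v huv h with (h' | h') | (h' | h')
    · simp only [h'.1, h'.2, true_or, or_true, and_self]
    · simp only [h'.1, h'.2, true_or, or_true, and_self]
    · have h1 := hr' u h'.1
      have h2 := hp' v h'.2
      tauto
    · have h1 := hr' v h'.2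
      have h2 := hp' u h'.1
      tauto
  have hinj : ∀ u x : T.Vertex, Hom.onVertex a.fst x ≠ Hom.onVertex a.fst ⟨i, p⟩ →
      Hom.onVertex a.fst u = Hom.onVertex a.fst x → u = x := by
    intro u x hx h
    rcases hfst u x h with h' | h' | h'
    · exact h'
    · rw [h'.2, apq] at hx; exact absurd rfl hx
    · rw [h'.2] at hx; exact absurd rfl hx
  have hu' : ∀ u v : T.Vertex, u ≠ v → Hom.onVertex f u = Hom.onVertex f v →
      (u = ⟨i, p⟩ ∧ v = ⟨i, q⟩ ∨ u = ⟨i, q⟩ ∧ v = ⟨i, p⟩) ∨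
      (u = ⟨j, r⟩ ∧ v = ⟨j, s⟩ ∨ u = ⟨j, s⟩ ∧ v = ⟨j, r⟩) := by
    intro u v huv h
    rcases hu u v huv h with h' | h' | h'
    · exact Or.inl h'
    · exact Or.inr (Or.inl ⟨hinj _ _ hr h'.1, hinj _ _ hs h'.2⟩)
    · exact Or.inr (Or.inr ⟨hinj _ _ hs h'.1, hinj _ _ hr h'.2⟩)
  have hpr : (⟨i, p⟩ : T.Vertex) ≠ ⟨j, r⟩ := fun h => hr (by rw [h])
  have hps : (⟨i, p⟩ : T.Vertex) ≠ ⟨j, s⟩ := fun h => hs (by rw [h])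
  have hqr : (⟨i, q⟩ : T.Vertex) ≠ ⟨j, r⟩ := fun h => hr (by rw [← h, apq])
  have hqs : (⟨i, q⟩ : T.Vertex) ≠ ⟨j, s⟩ := fun h => hs (by rw [← h, apq])
  have hrs_ne : r ≠ s := fun h => hb.lt.ne (by rw [h])
  by_cases srs : T.map j r = T.map j s
  · have hrs : r < s := by
      by_contra hle
      exact absurd (Hom.mono_fibre a.fst j s r srs.symm (not_lt.1 hle)) (not_le.2 hb.lt)
    exact isDiamond_of_disjoint hd ha.lt hrs ha.siblings srs fpq frs hpr hps hqr hqs hu'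
  · rcases lt_or_gt_of_ne hrs_ne with hrs | hrs
    · exact isDiamond_of_nested hd ha.lt hrs ha.siblings srs fpq frs hpr hps hqr hqs hu'
    · refine isDiamond_of_nested hd ha.lt hrs ha.siblings (Ne.symm srs) fpq frs.symm hps hpr hqs hqr
        fun u v huv h => (hu' u v huv h).imp_right Or.symm

/-- The signs of the factorizations of a morphism of degree two cancel. -/
theorem sum_sgnMul_eq_zero (f : T ⟶ S) (hd : T.deg = S.deg + 2)
    [Fintype {a : Factorization f // a.mid.deg = S.deg + 1}] :
    ∑ a : {a : Factorization f // a.mid.deg = S.deg + 1}, a.1.sgnMul = 0 := by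
  classical
  by_cases h : Nonempty {a : Factorization f // a.mid.deg = S.deg + 1}
  · obtain ⟨⟨a₀, h₀⟩⟩ := h
    obtain ⟨a, b, ha, hb, hne, hs, hc⟩ := isDiamond_of_mid hd a₀ h₀
    have hne' : (⟨a, ha⟩ : {a : Factorization f // a.mid.deg = S.deg + 1}) ≠ ⟨b, hb⟩ :=
      fun h => hne (congrArg Subtype.val h)
    have huniv : (Finset.univ : Finset {a : Factorization f // a.mid.deg = S.deg + 1}) =
        {⟨a, ha⟩, ⟨b, hb⟩} := by
      ext ⟨c, hcd⟩
      simpa using hc c hcd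
    rw [huniv, Finset.sum_pair hne', hs, add_neg_cancel]
  · have := not_nonempty_iff.1 h
    exact Finset.sum_of_isEmpty _

end

end PrunedTree

namespace PrunedTree

/-! ### The covering relation on factorizations -/

section

variable {n : ℕ} {T S : PrunedTree n} {f : T ⟶ S}

/-- The factorization `b` is obtained from `a` by a morphism of degree one of the middle trees. -/
def Factorization.Covers (a b : Factorization f) : Prop :=
  a.mid.deg = b.mid.deg + 1 ∧ ∃ w : a.mid ⟶ b.mid, a.fst ≫ w = b.fst

theorem deg_le_of_hom {T S : PrunedTree n} (f : T ⟶ S) : S.deg ≤ T.deg :=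
  Finset.sum_le_sum fun i _ => size_le_of_hom f i.castSucc

theorem onVertex_injective_of_deg_eq {T S : PrunedTree n} (f : T ⟶ S) (h : T.deg = S.deg) :
    Function.Injective (Hom.onVertex f) :=
  ((Fintype.bijective_iff_surjective_and_card _).2 ⟨onVertex_surjective f, by
    rw [card_vertex, card_vertex, h]⟩).1

/-- An injective `w` is strictly increasing on fibres, so it creates no ties and changes no order
between siblings of the middle tree. -/
theorem Factorization.eq_of_injective {a b : Factorization f} (w : a.mid ⟶ b.mid)
    (hw : a.fst ≫ w = b.fst)
    (hi : ∀ i : Fin n, Function.Injective (Hom.app w i.castSucc)) : a = b := by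
  have hw' : ∀ i x, Hom.app w i (Hom.app a.fst i x) = Hom.app b.fst i x := fun i x => by
    rw [← comp_app, hw]
  refine ext_of_fibres fun i x y _ _ ha _ => ⟨fun h => ?_, fun h => ?_⟩
  · rw [← hw', ← hw']
    exact Hom.mono_fibre w i _ _ (by rwa [Hom.comm, Hom.comm]) h
  · by_contra hlt
    rw [not_le] at hlt
    have h' := Hom.mono_fibre w i _ _ (by rw [Hom.comm, Hom.comm]; exact ha.symm) hlt.le
    rw [hw', hw'] at h'
    have h2 := le_antisymm h h'
    rw [← hw', ← hw'] at h2
    exact absurd (hi i h2) hlt.ne'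

theorem Factorization.eq_of_deg_eq {a b : Factorization f} (w : a.mid ⟶ b.mid)
    (hw : a.fst ≫ w = b.fst) (hd : a.mid.deg = b.mid.deg) : a = b :=
  Factorization.eq_of_injective w hw fun _ _ _ h =>
    vertex_mk_inj (onVertex_injective_of_deg_eq w hd ((onVertex_mk_eq w).2 h))

end

section

variable {n : ℕ} {T S : PrunedTree (n + 1)} {f : T ⟶ S}

theorem deg_eq_size_add (T : PrunedTree (n + 1)) : T.deg = T.size 0 + T.tr.deg := by
  rw [deg, Fin.sum_univ_succ]; rfl

theorem Factorization.le_iff_of_tr_eq {a b : Factorization f} (h : a.tr = b.tr)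
    (i : Fin (n + 1)) (x y : Fin (T.size i.succ)) :
    Hom.app a.fst i.succ x ≤ Hom.app a.fst i.succ y ↔
      Hom.app b.fst i.succ x ≤ Hom.app b.fst i.succ y := by
  change Hom.app a.tr.fst i x ≤ Hom.app a.tr.fst i y ↔ Hom.app b.tr.fst i x ≤ Hom.app b.tr.fst i y
  rw [h]

theorem Factorization.eq_iff_of_tr_eq {a b : Factorization f} (h : a.tr = b.tr)
    (i : Fin (n + 1)) (x y : Fin (T.size i.succ)) :
    Hom.app a.fst i.succ x = Hom.app a.fst i.succ y ↔
      Hom.app b.fst i.succ x = Hom.app b.fst i.succ y := by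
  rw [le_antisymm_iff, le_antisymm_iff, le_iff_of_tr_eq h, le_iff_of_tr_eq h]

/-- The position of the leaf `x` in the middle tree. -/
abbrev Factorization.leaf (a : Factorization f) (x : Fin (T.size 0)) : Fin (a.mid.size 0) :=
  Hom.app a.fst 0 x

/-- The position of the parent of the leaf `x` in the middle tree. -/
abbrev Factorization.parent (a : Factorization f) (x : Fin (T.size 0)) :
    Fin (a.mid.size (Fin.succ 0)) :=
  Hom.app a.fst (Fin.succ 0) (T.map 0 x)

theorem Factorization.parent_le (a : Factorization f) {x y : Fin (T.size 0)}
    (h : a.leaf x ≤ a.leaf y) : a.parent x ≤ a.parent y := app_parent_le a.fst 0 h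

theorem Factorization.leaf_lt_of_parent_lt (a : Factorization f) {x y : Fin (T.size 0)}
    (h : a.parent x < a.parent y) : a.leaf x < a.leaf y := app_lt_of_parent_lt a.fst 0 h

theorem Factorization.leaf_le_of_siblings (a : Factorization f) {x y : Fin (T.size 0)}
    (h : T.map 0 x = T.map 0 y) (hxy : x ≤ y) : a.leaf x ≤ a.leaf y :=
  Hom.mono_fibre a.fst 0 x y h hxy

theorem Factorization.image_le (a : Factorization f) {x y : Fin (T.size 0)}
    (hp : a.parent x = a.parent y) (h : a.leaf x ≤ a.leaf y) :
    Hom.app f 0 x ≤ Hom.app f 0 y := a.app_le (i := 0) hp h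

theorem Factorization.image_eq (a : Factorization f) {x y : Fin (T.size 0)}
    (h : a.leaf x = a.leaf y) : Hom.app f 0 x = Hom.app f 0 y := a.app_eq h

theorem Factorization.leaf_le_of_hom {a b : Factorization f} (w : a.mid ⟶ b.mid)
    (hw : a.fst ≫ w = b.fst) {x y : Fin (T.size 0)} (hp : a.parent x = a.parent y)
    (h : a.leaf x ≤ a.leaf y) : b.leaf x ≤ b.leaf y := by
  have hw' : ∀ x, Hom.app w 0 (a.leaf x) = b.leaf x := fun x => by
    rw [leaf, ← comp_app, hw]
  rw [← hw', ← hw']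
  exact Hom.mono_fibre w 0 _ _ ((Hom.comm a.fst 0 x).trans (hp.trans (Hom.comm a.fst 0 y).symm)) h

theorem Factorization.eq_of_hom {a b : Factorization f} (w : a.mid ⟶ b.mid)
    (hw : a.fst ≫ w = b.fst) {i : Fin (n + 2)} {x y : Fin (T.size i)}
    (h : Hom.app a.fst i x = Hom.app a.fst i y) : Hom.app b.fst i x = Hom.app b.fst i y := by
  rw [← hw, comp_app, comp_app, h]

theorem Factorization.leaf_le_of_hom_of_tr_eq {a b : Factorization f} (w : a.mid ⟶ b.mid)
    (hw : a.fst ≫ w = b.fst) (htr : a.tr = b.tr) {x y : Fin (T.size 0)}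
    (h : a.leaf x ≤ a.leaf y) : b.leaf x ≤ b.leaf y := by
  rcases (a.parent_le h).eq_or_lt with hp | hp
  · exact leaf_le_of_hom w hw hp h
  · refine (b.leaf_lt_of_parent_lt ?_).le
    rw [← not_le] at hp ⊢
    rwa [parent, parent, ← le_iff_of_tr_eq htr]

/-! ### Splitting a leaf off its block -/

/-- The leaf `z` is not identified with any other leaf. -/
def Factorization.Alone (a : Factorization f) (z : Fin (T.size 0)) : Prop :=
  ∀ x, a.leaf x = a.leaf z → x = z

/-- The factorization `a` is obtained from `b` by moving the leaf `z` out of its block, to the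
place right after this block. -/
structure Factorization.SplitAt (z : Fin (T.size 0)) (a b : Factorization f) : Prop where
  tr_eq : a.tr = b.tr
  not_alone : ¬ b.Alone z
  le_iff : ∀ x y, a.leaf x ≤ a.leaf y ↔
    (b.leaf x < b.leaf y ∨ (b.leaf x = b.leaf y ∧ (x = z → y = z)))

namespace Factorization

variable {a b c : Factorization f} {z : Fin (T.size 0)}

theorem SplitAt.le_of_le (h : SplitAt z a b) {x y : Fin (T.size 0)} (hxy : a.leaf x ≤ a.leaf y) :
    b.leaf x ≤ b.leaf y := by
  rcases (h.le_iff x y).1 hxy with h' | h'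
  · exact h'.le
  · exact h'.1.le

theorem SplitAt.lt_of_lt (h : SplitAt z a b) {x y : Fin (T.size 0)} (hxy : b.leaf x < b.leaf y) :
    a.leaf x < a.leaf y := by
  by_contra h'
  exact absurd (h.le_of_le (not_lt.1 h')) (not_le.2 hxy)

theorem SplitAt.alone (h : SplitAt z a b) : a.Alone z := by
  intro x hx
  rcases (h.le_iff z x).1 hx.ge with h' | h'
  · exact absurd (h.le_of_le hx.le) (not_le.2 h')
  · exact h'.2 rfl

theorem SplitAt.le_iff_of_ne (h : SplitAt z a b) {x y : Fin (T.size 0)} (hx : x ≠ z) :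
    a.leaf x ≤ a.leaf y ↔ b.leaf x ≤ b.leaf y := by
  rw [h.le_iff, le_iff_lt_or_eq]
  simp [hx]

theorem SplitAt.eq_of_ne (h : SplitAt z a b) {x y : Fin (T.size 0)} (hx : x ≠ z) (hy : y ≠ z)
    (hxy : b.leaf x = b.leaf y) : a.leaf x = a.leaf y :=
  le_antisymm ((h.le_iff_of_ne hx).2 hxy.le) ((h.le_iff_of_ne hy).2 hxy.ge)

theorem SplitAt.exists_ne (h : SplitAt z a b) : ∃ y, y ≠ z ∧ b.leaf y = b.leaf z := by
  by_contra h'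
  push Not at h'
  exact h.not_alone fun x hx => by
    by_contra hne
    exact h' x hne hx

theorem SplitAt.parent_eq_iff (h : SplitAt z a b) (x y : Fin (T.size 0)) :
    a.parent x = a.parent y ↔ b.parent x = b.parent y :=
  eq_iff_of_tr_eq h.tr_eq 0 _ _

/-- The quotient map from `a` to `b` has a single collision: `z` with the block it had left. -/
theorem SplitAt.covers (h : SplitAt z a b) : Covers a b := by
  obtain ⟨w, hw⟩ := exists_factor a.fst b.fst
    (fun i => by
      refine Fin.cases ?_ (fun j => ?_) i
      · intro x y hxy
        exact le_antisymm (h.le_of_le (le_of_eq hxy)) (h.le_of_le (le_of_eq hxy.symm))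
      · intro x y hxy
        exact (eq_iff_of_tr_eq h.tr_eq j x y).1 hxy)
    (fun i => by
      refine Fin.cases ?_ (fun j => ?_) i
      · intro x y _ hxy
        exact h.le_of_le hxy
      · intro x y _ hxy
        exact (le_iff_of_tr_eq h.tr_eq j.castSucc x y).1 hxy)
  have hw' : ∀ i x, Hom.app w i (Hom.app a.fst i x) = Hom.app b.fst i x := fun i x => by
    rw [← comp_app, hw]
  obtain ⟨y, hyz, hy⟩ := h.exists_ne
  have hlt : a.leaf y < a.leaf z :=
    lt_of_le_of_ne ((h.le_iff_of_ne hyz).2 hy.le) fun he => hyz (h.alone y he)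
  have hm : Merges w 0 (a.leaf y) (a.leaf z) := by
    refine ⟨hlt, ?_, ?_, ?_⟩
    · have hp := (h.parent_eq_iff y z).2 (app_parent_eq b.fst 0 hy)
      exact (Hom.comm a.fst 0 y).trans (hp.trans (Hom.comm a.fst 0 z).symm)
    · exact (hw' 0 y).trans (hy.trans (hw' 0 z).symm)
    · rintro ⟨k, X⟩ ⟨k', Y⟩ hne he
      obtain rfl : k = k' := congrArg Sigma.fst he
      have he' := (onVertex_mk_eq w).1 he
      have hne' : X ≠ Y := fun h => hne (h ▸ rfl)
      clear he hne
      revert X Y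
      refine Fin.cases ?_ (fun j => ?_) k
      · intro X Y he' hne'
        obtain ⟨x, rfl⟩ := Hom.surjective_app a.fst 0 X
        obtain ⟨x', rfl⟩ := Hom.surjective_app a.fst 0 Y
        have hb : b.leaf x = b.leaf x' := (hw' 0 x).symm.trans (he'.trans (hw' 0 x'))
        by_cases hx : x = z
        · subst hx
          have hx' : x' ≠ x := fun h => hne' (by rw [h])
          have := h.eq_of_ne hx' hyz (hb.symm.trans hy.symm)
          exact Or.inr ⟨rfl, congrArg (Sigma.mk _) this⟩
        · by_cases hx' : x' = z
          · subst hx'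
            have := h.eq_of_ne hx hyz (hb.trans hy.symm)
            exact Or.inl ⟨congrArg (Sigma.mk _) this, rfl⟩
          · exact absurd (h.eq_of_ne hx hx' hb) hne'
      · intro X Y he' hne'
        obtain ⟨x, rfl⟩ := Hom.surjective_app a.fst _ X
        obtain ⟨x', rfl⟩ := Hom.surjective_app a.fst _ Y
        rw [hw', hw'] at he'
        exact absurd ((eq_iff_of_tr_eq h.tr_eq j.castSucc x x').2 he') hne'
  exact ⟨hm.deg_eq, w, hw⟩

theorem SplitAt.left_unique (h : SplitAt z a c) (h' : SplitAt z b c) : a = b :=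
  ext_of_tr (h.tr_eq.trans h'.tr_eq.symm) fun x y => (h.le_iff x y).trans (h'.le_iff x y).symm

/-- The order in `b` is recovered from `a` and `z` alone: `z` goes back into the block just before
it, so another leaf precedes `z` in `b` exactly when some further block separates them in `a`. This
gives uniqueness of the partner. -/
theorem SplitAt.lt_iff (h : SplitAt z a b) (x y : Fin (T.size 0)) :
    b.leaf x < b.leaf y ↔ (x ≠ z ∧ y ≠ z ∧ a.leaf x < a.leaf y) ∨ (x = z ∧ a.leaf z < a.leaf y) ∨
      (x ≠ z ∧ y = z ∧ ∃ v, v ≠ z ∧ a.leaf x < a.leaf v ∧ a.leaf v < a.leaf z) := by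
  by_cases hx : x = z
  · subst hx
    simp only [ne_eq, not_true_eq_false, false_and, true_and, false_or, or_false]
    refine ⟨h.lt_of_lt, fun hlt => ?_⟩
    rcases (h.le_iff x y).1 hlt.le with h' | h'
    · exact h'
    · rw [h'.2 rfl] at hlt
      exact absurd hlt (lt_irrefl _)
  · by_cases hy : y = z
    · subst hy
      simp only [ne_eq, hx, not_false_eq_true, not_true_eq_false, false_and, and_false, true_and,
        false_or]
      constructor
      · intro hlt
        obtain ⟨v, hv, hvz⟩ := h.exists_ne
        refine ⟨v, hv, h.lt_of_lt (hvz ▸ hlt), ?_⟩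
        exact lt_of_le_of_ne ((h.le_iff_of_ne hv).2 hvz.le) fun he => hv (h.alone v he)
      · rintro ⟨v, hv, h1, h2⟩
        have h3 : b.leaf x < b.leaf v := by
          rw [← not_le] at h1 ⊢
          rwa [← h.le_iff_of_ne hv]
        exact h3.trans_le (h.le_of_le h2.le)
    · simp only [ne_eq, hx, hy, not_false_eq_true, true_and, false_and, or_false]
      rw [← not_le, ← not_le, h.le_iff_of_ne hy]

theorem SplitAt.right_unique (h : SplitAt z a b) (h' : SplitAt z a c) : b = c :=
  ext_of_tr (h.tr_eq.symm.trans h'.tr_eq) fun x y => by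
    have := (h.lt_iff y x).trans (h'.lt_iff y x).symm
    rw [← not_lt, ← not_lt]
    exact not_congr this

/-- Moving `z` behind its block could only violate the order of siblings if a later sibling of `z`
were in that block; such a sibling would have the same image, against `hz`. -/
theorem exists_splitAt_left (b : Factorization f) (hb : ¬ b.Alone z)
    (hz : ∀ x : Fin (T.size 0), T.map 0 x = T.map 0 z → z < x → Hom.app f 0 x ≠ Hom.app f 0 z) :
    ∃ a, SplitAt z a b := by
  classical
  let r : Fin (T.size 0) → (Fin (b.mid.size 0) ×ₗ ℕ) := fun x =>
    toLex (b.leaf x, if x = z then 1 else 0)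
  have hr : ∀ x y, r x ≤ r y ↔
      (b.leaf x < b.leaf y ∨ (b.leaf x = b.leaf y ∧ (x = z → y = z))) := by
    intro x y
    rw [Prod.Lex.le_iff]
    refine or_congr Iff.rfl (and_congr Iff.rfl ?_)
    by_cases hx : x = z <;> by_cases hy : y = z <;> simp [r, hx, hy]
  have hr' : ∀ x y, r x ≤ r y → b.leaf x ≤ b.leaf y := by
    intro x y h
    rcases (hr x y).1 h with h | h
    · exact h.le
    · exact h.1.le
  obtain ⟨a, ha, ha'⟩ := exists_extension b.tr r
    (fun x y h => b.parent_le (hr' x y h))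
    (fun x y hp hxy => by
      rw [hr]
      rcases (b.leaf_le_of_siblings hp hxy).lt_or_eq with h | h
      · exact Or.inl h
      · refine Or.inr ⟨h, ?_⟩
        rintro rfl
        by_contra hne
        exact hz y hp.symm (lt_of_le_of_ne hxy (Ne.symm hne)) (b.image_eq h.symm))
    (fun x y h => b.image_eq (le_antisymm (hr' x y h.le) (hr' y x h.ge)))
    (fun x y hp h => b.image_le hp (hr' x y h))
  exact ⟨a, ha, hb, fun x y => (ha' x y).trans (hr x y)⟩

/-- The block just before `z` is squeezed between `y` and `z`, so it has the parent and the image of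
`z` and may absorb it. -/
theorem exists_splitAt_right (a : Factorization f) (ha : a.Alone z) {y : Fin (T.size 0)}
    (hp : a.parent y = a.parent z) (hf : Hom.app f 0 y = Hom.app f 0 z)
    (hlt : a.leaf y < a.leaf z) : ∃ b, SplitAt z a b := by
  classical
  -- The subtraction is not truncated, because `y` lies before `z`.
  obtain ⟨v, hv⟩ := Hom.surjective_app a.fst 0 ⟨(a.leaf z).val - 1, by omega⟩
  have hvval : (a.leaf v).val = (a.leaf z).val - 1 := congrArg Fin.val hv
  have hvz : ∀ x, a.leaf x < a.leaf z ↔ a.leaf x ≤ a.leaf v := by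
    intro x
    have := Fin.lt_def.1 hlt
    rw [Fin.lt_def, Fin.le_def, hvval]
    omega
  have hvlt : a.leaf v < a.leaf z := (hvz v).2 le_rfl
  have hne : v ≠ z := fun h => hvlt.ne (by rw [h])
  have hyv : a.leaf y ≤ a.leaf v := (hvz y).1 hlt
  have hpv : a.parent v = a.parent z :=
    le_antisymm (a.parent_le hvlt.le) (hp ▸ a.parent_le hyv)
  have hfv : Hom.app f 0 v = Hom.app f 0 z :=
    le_antisymm (a.image_le hpv hvlt.le) (hf ▸ a.image_le (hp.trans hpv.symm) hyv)
  -- The order of `b` is that of `a` pulled back along the map sending `z` to `v`.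
  let c : Fin (T.size 0) → Fin (T.size 0) := fun x => if x = z then v else x
  have cz : c z = v := if_pos rfl
  have cx : ∀ {x}, x ≠ z → c x = x := fun h => if_neg h
  have cp : ∀ x, a.parent (c x) = a.parent x := by
    intro x
    by_cases hx : x = z
    · rw [hx, cz, hpv]
    · rw [cx hx]
  have cf : ∀ x, Hom.app f 0 (c x) = Hom.app f 0 x := by
    intro x
    by_cases hx : x = z
    · rw [hx, cz, hfv]
    · rw [cx hx]
  obtain ⟨b, hb, hb'⟩ := exists_extension a.tr (fun x => a.leaf (c x))
    (fun x y h => by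
      have := a.parent_le h
      rwa [cp, cp] at this)
    (fun x y hs hxy => by
      have h := a.leaf_le_of_siblings hs hxy
      by_cases hx : x = z
      · by_cases hy : y = z
        · rw [hx, hy]
        · rw [hx, cz, cx hy]
          rw [hx] at h
          exact hvlt.le.trans h
      · by_cases hy : y = z
        · rw [hy, cz, cx hx]
          rw [hy] at h
          exact (hvz x).1 (lt_of_le_of_ne h fun he => hx (ha x he))
        · rwa [cx hx, cx hy])
    (fun x y h => by
      have := a.image_eq h
      rwa [cf, cf] at this)
    (fun x y hpar h => by
      have hpar' : a.parent (c x) = a.parent (c y) := by rw [cp, cp]; exact hpar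
      have := a.image_le hpar' h
      rwa [cf, cf] at this)
  have hbl : ∀ x y, b.leaf x < b.leaf y ↔ a.leaf (c x) < a.leaf (c y) := fun x y => by
    rw [← not_le, ← not_le]; exact not_congr (hb' y x)
  have hbe : ∀ x y, b.leaf x = b.leaf y ↔ a.leaf (c x) = a.leaf (c y) := fun x y => by
    rw [le_antisymm_iff, le_antisymm_iff]; exact and_congr (hb' x y) (hb' y x)
  refine ⟨b, hb.symm, fun h => hne (h v ((hbe v z).2 (by rw [cz, cx hne]))), fun x y => ?_⟩
  rw [hbl, hbe]
  by_cases hx : x = z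
  · by_cases hy : y = z
    · simp [hx, hy]
    · rw [hx, cz, cx hy, ← not_lt, hvz, not_le]
      simp [hy]
  · rw [cx hx]
    simp only [hx, false_implies, and_true]
    rw [← le_iff_lt_or_eq]
    by_cases hy : y = z
    · rw [hy, cz, ← hvz]
      exact ⟨fun h => lt_of_le_of_ne h fun he => hx (ha x he), le_of_lt⟩
    · rw [cx hy]

open scoped Classical in
/-- The number of leaves that are not behind the block of `z`. -/
noncomputable def pos (a : Factorization f) (z : Fin (T.size 0)) : ℕ :=
  (Finset.univ.filter fun x => a.leaf x ≤ a.leaf z).card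

theorem pos_le (a : Factorization f) (z : Fin (T.size 0)) : a.pos z ≤ T.size 0 := by
  classical
  exact (Finset.card_filter_le _ _).trans (by simp)

theorem SplitAt.pos_eq (h : SplitAt z a b) : a.pos z = b.pos z := by
  classical
  unfold pos
  congr 1
  ext x
  simp only [Finset.mem_filter, Finset.mem_univ, true_and]
  rw [h.le_iff, le_iff_lt_or_eq]
  simp

/-- If `z` stops being alone, the one merge used joins it to another block, so level `0` alone
changes. Joining a block in front of `z` undoes a split; joining one behind it puts more leaves not
behind `z`. This dichotomy makes the matching acyclic. -/
theorem Covers.splitAt_or_pos_lt (h : Covers a b) (ha : a.Alone z) (hb : ¬ b.Alone z) :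
    a.tr = b.tr ∧ (SplitAt z a b ∨ a.pos z < b.pos z) := by
  classical
  obtain ⟨hd, w, hw⟩ := h
  have hw' : ∀ i x, Hom.app w i (Hom.app a.fst i x) = Hom.app b.fst i x := fun i x => by
    rw [← comp_app, hw]
  have hy : ∃ y, y ≠ z ∧ b.leaf y = b.leaf z := by
    by_contra h'
    push Not at h'
    exact hb fun x hx => by
      by_contra hne
      exact h' x hne hx
  obtain ⟨y, hyz, hy⟩ := hy
  have hne : a.leaf y ≠ a.leaf z := fun h => hyz (ha y h)
  have hwe : Hom.app w 0 (a.leaf y) = Hom.app w 0 (a.leaf z) :=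
    (hw' 0 y).trans (hy.trans (hw' 0 z).symm)
  have hu : ∀ u v : a.mid.Vertex, u ≠ v → Hom.onVertex w u = Hom.onVertex w v →
      (u = ⟨0, a.leaf y⟩ ∧ v = ⟨0, a.leaf z⟩) ∨ (u = ⟨0, a.leaf z⟩ ∧ v = ⟨0, a.leaf y⟩) := by
    rcases lt_or_gt_of_ne hne with hlt | hlt
    · exact (merges_of_lt w hd (i := 0) hlt hwe).unique
    · exact fun u v huv h =>
        ((merges_of_lt w hd (i := 0) hlt hwe.symm).unique u v huv h).symm
  have htr : a.tr = b.tr := by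
    refine eq_of_injective (trHom w) (hom_ext fun i x => hw' i.succ x) fun i => ?_
    exact injective_of_unique w hu (k := i.castSucc.succ) (Fin.succ_ne_zero _)
  have hmono : ∀ {x x'}, a.leaf x ≤ a.leaf x' → b.leaf x ≤ b.leaf x' := fun h =>
    leaf_le_of_hom_of_tr_eq w hw htr h
  refine ⟨htr, ?_⟩
  rcases lt_or_gt_of_ne hne with hlt | hlt
  · refine Or.inl ⟨htr, hb, fun x x' => ?_⟩
    have hcase : b.leaf x = b.leaf x' → a.leaf x = a.leaf x' ∨
        (a.leaf x = a.leaf y ∧ x' = z) ∨ (x = z ∧ a.leaf x' = a.leaf y) := by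
      intro hbx
      by_cases hax : a.leaf x = a.leaf x'
      · exact Or.inl hax
      · rcases hu ⟨0, a.leaf x⟩ ⟨0, a.leaf x'⟩ (vertex_mk_ne hax)
          ((onVertex_mk_eq w).2 ((hw' 0 x).trans (hbx.trans (hw' 0 x').symm))) with h | h
        · exact Or.inr (Or.inl ⟨vertex_mk_inj h.1, ha _ (vertex_mk_inj h.2)⟩)
        · exact Or.inr (Or.inr ⟨ha _ (vertex_mk_inj h.1), vertex_mk_inj h.2⟩)
    constructor
    · intro hle
      rcases (hmono hle).lt_or_eq with h | h
      · exact Or.inl h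
      · refine Or.inr ⟨h, ?_⟩
        rintro rfl
        rcases hcase h with h' | h' | h'
        · exact ha _ h'.symm
        · exact h'.2
        · rw [h'.2] at hle
          exact absurd hlt (not_lt.2 hle)
    · rintro (h | ⟨h, hz⟩)
      · by_contra hle
        exact absurd (hmono (not_le.1 hle).le) (not_le.2 h)
      · rcases hcase h with h' | h' | h'
        · exact h'.le
        · rw [h'.1, h'.2]; exact hlt.le
        · rw [hz h'.1, h'.1]
  · refine Or.inr (Finset.card_lt_card ?_)
    rw [Finset.ssubset_iff_of_subset]
    · exact ⟨y, by simpa using hy.le, by simpa using hlt⟩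
    · intro x hx
      simp only [Finset.mem_filter, Finset.mem_univ, true_and] at hx ⊢
      exact hmono hx

end Factorization

end

end PrunedTree

namespace PrunedTree

open Factorization

/-! ### Acyclic matchings -/

/-- A perfect matching `M` between the factorizations in `U` and the other ones, along the
covering relation, that is acyclic with respect to the rank function `r`. -/
structure IsAcyclicMatching {n : ℕ} {T S : PrunedTree n} {f : T ⟶ S}
    (U : Set (Factorization f)) (M : Factorization f → Factorization f → Prop)
    (r : Factorization f → ℕ) : Prop where
  mem : ∀ {a b}, M a b → a ∈ U
  not_mem : ∀ {a b}, M a b → b ∉ U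
  covers : ∀ {a b}, M a b → Covers a b
  exists_right : ∀ {a}, a ∈ U → ∃ b, M a b
  exists_left : ∀ {b}, b ∉ U → ∃ a, M a b
  right_unique : ∀ {a b c}, M a b → M a c → b = c
  left_unique : ∀ {a b c}, M a c → M b c → a = b
  rank_lt : ∀ {a b c}, M a b → Covers a c → c ∉ U → c ≠ b → r c < r b

/-- The factorizations of `f` have an acyclic perfect matching. -/
def HasAcyclicMatching {n : ℕ} {T S : PrunedTree n} (f : T ⟶ S) : Prop :=
  ∃ U M r, IsAcyclicMatching (f := f) U M r

theorem exists_nat_rank_of_finite {α L : Type*} [Finite α] [LinearOrder L] (r : α → L) :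
    ∃ r' : α → ℕ, ∀ x y, r x < r y → r' x < r' y := by
  classical
  have := Fintype.ofFinite α
  refine ⟨fun x => (Finset.univ.filter fun y => r y < r x).card,
    fun x y h => Finset.card_lt_card ?_⟩
  rw [Finset.ssubset_iff_of_subset]
  · exact ⟨x, by simpa using h, by simp⟩
  · intro z hz
    simp only [Finset.mem_filter, Finset.mem_univ, true_and] at hz ⊢
    exact hz.trans h

variable {n : ℕ} {T S : PrunedTree (n + 1)} {f : T ⟶ S}

/-- The matching that moves a fixed leaf, which has an identified elder sibling. -/
theorem hasAcyclicMatching_of_siblings {y z : Fin (T.size 0)} (hyz : y < z)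
    (hs : T.map 0 y = T.map 0 z) (hf : Hom.app f 0 y = Hom.app f 0 z)
    (hz : ∀ x : Fin (T.size 0), T.map 0 x = T.map 0 z → z < x → Hom.app f 0 x ≠ Hom.app f 0 z) :
    HasAcyclicMatching f := by
  -- Matched elements have equal `pos`, and any other lower neighbour of the upper element has a
  -- larger one; subtracting from the number of leaves reverses this into a decreasing rank.
  refine ⟨{a | a.Alone z}, SplitAt z, fun a => T.size 0 - a.pos z, ⟨fun h => h.alone,
    fun h => h.not_alone, fun h => h.covers, fun {a} ha => ?_, fun {b} hb => ?_,
    fun h h' => h.right_unique h', fun h h' => h.left_unique h', fun {a b c} h hc hcU hne => ?_⟩⟩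
  · refine a.exists_splitAt_right ha (y := y) (congrArg (Hom.app a.fst (Fin.succ 0)) hs) hf ?_
    exact lt_of_le_of_ne (a.leaf_le_of_siblings hs hyz.le) fun he => hyz.ne (ha y he)
  · exact b.exists_splitAt_left hb hz
  · rcases (hc.splitAt_or_pos_lt h.alone hcU).2 with h' | h'
    · exact absurd (h'.right_unique h) hne
    · have h1 := h.pos_eq
      have h2 := c.pos_le z
      omega

/-! ### Bad leaves, sorted factorizations and the matching when no sibling leaves are identified. -/

namespace Factorization

/-- The leaf `z` is not ahead of all greater leaves with the same parent and the same image. -/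
def Bad (a : Factorization f) (z : Fin (T.size 0)) : Prop :=
  ∃ y, z < y ∧ a.parent y = a.parent z ∧ Hom.app f 0 y = Hom.app f 0 z ∧ a.leaf y ≤ a.leaf z

/-- The least bad leaf. -/
structure LeastBad (a : Factorization f) (z : Fin (T.size 0)) : Prop where
  bad : a.Bad z
  not_bad : ∀ y < z, ¬ a.Bad y

/-- There is no bad leaf. -/
def Sorted (a : Factorization f) : Prop := ∀ z, ¬ a.Bad z

variable {a b c : Factorization f} {z : Fin (T.size 0)}

theorem sorted_or_exists_leastBad (a : Factorization f) : a.Sorted ∨ ∃ z, a.LeastBad z := by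
  by_cases h : a.Sorted
  · exact Or.inl h
  · right
    simp only [Sorted, not_forall, not_not] at h
    obtain ⟨z, hz, hz'⟩ := WellFounded.has_min (wellFounded_lt (α := Fin (T.size 0)))
      {z | a.Bad z} h
    exact ⟨z, hz, fun y hy hb => hz' y hb hy⟩

theorem LeastBad.not_sorted (h : a.LeastBad z) : ¬ a.Sorted := fun hs => hs z h.bad

theorem LeastBad.unique {z' : Fin (T.size 0)} (h : a.LeastBad z) (h' : a.LeastBad z') :
    z = z' := by
  rcases lt_trichotomy z z' with hlt | he | hlt
  · exact absurd h.bad (h'.not_bad z hlt)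
  · exact he
  · exact absurd h'.bad (h.not_bad z' hlt)

/-- Further merging preserves equal parents and the weak order among siblings, so badness persists
and the least bad leaf can only decrease. -/
theorem Bad.of_hom (h : a.Bad z) (w : a.mid ⟶ b.mid) (hw : a.fst ≫ w = b.fst) : b.Bad z := by
  obtain ⟨y, hzy, hp, hf, hle⟩ := h
  exact ⟨y, hzy, eq_of_hom w hw (i := Fin.succ 0) hp, hf, leaf_le_of_hom w hw hp hle⟩

theorem LeastBad.lt_of_lt (h : a.LeastBad z) {x : Fin (T.size 0)} (hx : x < z)
    (hp : a.parent x = a.parent z) (hf : Hom.app f 0 x = Hom.app f 0 z) :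
    a.leaf x < a.leaf z := by
  by_contra hle
  exact h.not_bad x hx ⟨z, hx, hp.symm, hf.symm, not_lt.1 hle⟩

theorem SplitAt.parent_eq_of_leaf_eq (h : SplitAt z a b) {x y : Fin (T.size 0)}
    (hxy : b.leaf x = b.leaf y) : a.parent x = a.parent y :=
  (h.parent_eq_iff x y).2 (app_parent_eq b.fst 0 hxy)

/-- A smaller leaf `x` could become bad only by sharing a block with `z` in `b`. A witness `v` for
the badness of `z` would lie strictly after `x` and not after `z` in `a`, hence join that block too,
although only `z` moved. -/
theorem SplitAt.leastBad_right (h : SplitAt z a b) (hz : a.LeastBad z) : b.LeastBad z := by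
  obtain ⟨-, w, hw⟩ := h.covers
  refine ⟨hz.bad.of_hom w hw, ?_⟩
  rintro x hx ⟨y, hxy, hp, hf, hle⟩
  have hp' : a.parent y = a.parent x := (h.parent_eq_iff y x).2 hp
  have hlt : a.leaf x < a.leaf y := by
    by_contra hle'
    exact hz.not_bad x hx ⟨y, hxy, hp', hf, not_lt.1 hle'⟩
  have hbe : b.leaf y = b.leaf x := le_antisymm hle (h.le_of_le hlt.le)
  have hyz : y = z := by
    by_contra hyz
    exact hlt.ne' (h.eq_of_ne hyz hx.ne hbe)
  subst hyz
  obtain ⟨v, hyv, hpv, hfv, hlev⟩ := hz.bad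
  have hvx : a.leaf x < a.leaf v := by
    by_contra hle'
    exact hz.not_bad x hx ⟨v, hx.trans hyv, hpv.trans hp', hfv.trans hf, not_lt.1 hle'⟩
  have hbv : b.leaf v = b.leaf x :=
    le_antisymm ((h.le_of_le hlev).trans hbe.le) (h.le_of_le hvx.le)
  exact hvx.ne' (h.eq_of_ne hyv.ne' hx.ne hbv)

/-- Minimality forces every block mate of `z` in `b` to be greater than `z`. After the split a mate
stands in front of `z` and witnesses that `z` is bad. -/
theorem SplitAt.leastBad_left (h : SplitAt z a b) (hz : b.LeastBad z) : a.LeastBad z := by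
  obtain ⟨-, w, hw⟩ := h.covers
  refine ⟨?_, fun x hx hb => hz.not_bad x hx (hb.of_hom w hw)⟩
  obtain ⟨y, hyz, hy⟩ := h.exists_ne
  have hp : b.parent y = b.parent z := app_parent_eq b.fst 0 hy
  have hzy : z < y := by
    rcases lt_or_gt_of_ne hyz with hlt | hlt
    · exact absurd hy (hz.lt_of_lt hlt hp (b.image_eq hy)).ne
    · exact hlt
  exact ⟨y, hzy, h.parent_eq_of_leaf_eq hy, b.image_eq hy, (h.le_iff_of_ne hyz).2 hy.le⟩

theorem Sorted.leaf_le_iff (h : a.Sorted) {x y : Fin (T.size 0)} (hp : a.parent x = a.parent y)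
    (hf : Hom.app f 0 x = Hom.app f 0 y) : a.leaf x ≤ a.leaf y ↔ x ≤ y := by
  rcases lt_trichotomy x y with hlt | rfl | hlt
  · refine iff_of_true ?_ hlt.le
    by_contra hle
    exact h x ⟨y, hlt, hp.symm, hf.symm, (not_le.1 hle).le⟩
  · simp
  · exact iff_of_false (fun hle => h y ⟨x, hlt, hp, hf, hle⟩) (not_le.2 hlt)

theorem Sorted.leaf_injective (h : a.Sorted) : Function.Injective a.leaf := by
  intro x y hxy
  have hp : a.parent x = a.parent y := app_parent_eq a.fst 0 hxy
  exact le_antisymm ((h.leaf_le_iff hp (a.image_eq hxy)).1 hxy.le)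
    ((h.leaf_le_iff hp.symm (a.image_eq hxy).symm).1 hxy.ge)

theorem Sorted.size_eq (h : a.Sorted) : a.mid.size 0 = T.size 0 := by
  have := Fintype.card_of_bijective ⟨h.leaf_injective, Hom.surjective_app a.fst 0⟩
  simpa using this.symm

theorem Sorted.eq_of_tr_eq (ha : a.Sorted) (hb : b.Sorted) (h : a.tr = b.tr) : a = b := by
  refine ext_of_fibres fun i => ?_
  refine Fin.cases ?_ (fun j => ?_) i
  · intro x y hf _ hp hp'
    exact (ha.leaf_le_iff hp hf).trans (hb.leaf_le_iff hp' hf).symm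
  · intro x y _ _ _ _
    exact le_iff_of_tr_eq h j.castSucc x y

/-- Ties are broken by the order of `T` itself; together with `Sorted.eq_of_tr_eq` this identifies
sorted factorizations with those of the truncation. -/
theorem exists_sorted (a : Factorization (trHom f)) :
    ∃ b : Factorization f, b.tr = a ∧ b.Sorted := by
  obtain ⟨b, hb, hb'⟩ := exists_extension_lex a (fun x => x.val) fun _ _ _ _ h => h
  refine ⟨b, hb, ?_⟩
  subst hb
  rintro z ⟨y, hzy, hp, hf, hle⟩
  exact absurd ((hb' y z hp hf).1 hle) (not_le.2 hzy)

theorem Covers.tr_eq_or_deg_lt (h : Covers a b) : a.tr = b.tr ∨ b.mid.tr.deg < a.mid.tr.deg := by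
  obtain ⟨-, w, hw⟩ := h
  have hw' : a.tr.fst ≫ trHom w = b.tr.fst := hom_ext fun i x => by
    change Hom.app (a.fst ≫ w) i.succ x = _
    rw [hw]; rfl
  rcases (deg_le_of_hom (trHom w)).lt_or_eq with h | h
  · exact Or.inr h
  · exact Or.inl (eq_of_deg_eq (a := a.tr) (b := b.tr) (trHom w) hw' h.symm)

theorem Covers.tr (h : Covers a b) (ha : a.Sorted) (hb : b.Sorted) : Covers a.tr b.tr := by
  obtain ⟨hd, w, hw⟩ := h
  refine ⟨?_, trHom w, hom_ext fun i x => ?_⟩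
  · rw [deg_eq_size_add, deg_eq_size_add, ha.size_eq, hb.size_eq] at hd
    change a.mid.tr.deg = b.mid.tr.deg + 1
    omega
  · change Hom.app (a.fst ≫ w) i.succ x = _
    rw [hw]; rfl

/-- Sorted factorizations keep all leaves apart, so the degrees drop as for the truncations. Among
leaves with a common parent the order is by image and then by index, so it passes from `a` to `b`.
-/
theorem Covers.of_tr (h : Covers a.tr b.tr) (ha : a.Sorted) (hb : b.Sorted) : Covers a b := by
  obtain ⟨hd, w, hw⟩ := h
  have hw' : ∀ i x, Hom.app w i (Hom.app a.tr.fst i x) = Hom.app b.tr.fst i x := fun i x => by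
    rw [← comp_app, hw]
  refine ⟨?_, exists_factor a.fst b.fst (fun i => ?_) (fun i => ?_)⟩
  · rw [deg_eq_size_add, deg_eq_size_add, ha.size_eq, hb.size_eq]
    change a.mid.tr.deg = b.mid.tr.deg + 1 at hd
    omega
  · refine Fin.cases ?_ (fun j => ?_) i
    · intro x y h
      rw [ha.leaf_injective h]
    · intro x y h
      exact (hw' j x).symm.trans ((congrArg (Hom.app w j) h).trans (hw' j y))
  · refine Fin.cases ?_ (fun j => ?_) i
    · intro x y hp hle
      have hp' : b.parent x = b.parent y :=
        (hw' 0 _).symm.trans ((congrArg (Hom.app w 0) hp).trans (hw' 0 _))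
      rcases (a.image_le hp hle).lt_or_eq with hf | hf
      · by_contra hle'
        exact absurd (b.image_le hp'.symm (not_le.1 hle').le) (not_le.2 hf)
      · exact (hb.leaf_le_iff hp' hf).2 ((ha.leaf_le_iff hp hf).1 hle)
    · intro x y hp hle
      have h1 := Hom.mono_fibre w j (Hom.app a.tr.fst j.castSucc x) (Hom.app a.tr.fst j.castSucc y)
        ((Hom.comm a.tr.fst j x).trans (Eq.trans hp (Hom.comm a.tr.fst j y).symm)) hle
      exact (hw' j.castSucc x).symm.le.trans (h1.trans (hw' j.castSucc y).le)

end Factorization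

open Factorization

/-- The matching when no siblings are identified: move the least bad leaf if there is one, and
otherwise use a matching for the truncation. -/
theorem hasAcyclicMatching_of_tr
    (hinj : ∀ x y : Fin (T.size 0), T.map 0 x = T.map 0 y → Hom.app f 0 x = Hom.app f 0 y → x = y)
    (htr : HasAcyclicMatching (trHom f)) : HasAcyclicMatching f := by
  classical
  obtain ⟨U, M, r, hM⟩ := htr
  -- Factorizations with a bad leaf rank below the sorted ones, since merging never removes badness.
  -- Among them the truncation degree, the least bad leaf and the position of that leaf are compared
  -- in turn; sorted ones use the rank of the truncation.
  let ρ : Factorization f → (ℕ ×ₗ ℕ ×ₗ ℕ ×ₗ ℕ) := fun a =>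
    if h : ∃ z, a.LeastBad z then
      toLex (0, toLex (a.mid.tr.deg, toLex (h.choose.val, T.size 0 - a.pos h.choose)))
    else toLex (1, toLex (r a.tr, toLex (0, 0)))
  have ρbad : ∀ {a z}, a.LeastBad z →
      ρ a = toLex (0, toLex (a.mid.tr.deg, toLex (z.val, T.size 0 - a.pos z))) := by
    intro a z h
    have h' : ∃ z, a.LeastBad z := ⟨z, h⟩
    simp only [ρ]
    rw [dif_pos h', h'.choose_spec.unique h]
  have ρsorted : ∀ {a}, a.Sorted → ρ a = toLex (1, toLex (r a.tr, toLex (0, 0))) := by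
    intro a h
    exact dif_neg fun ⟨z, hz⟩ => hz.not_sorted h
  obtain ⟨ρ', hρ'⟩ := exists_nat_rank_of_finite ρ
  have hU : ∀ {a : Factorization f} {z : Fin (T.size 0)}, a.LeastBad z →
      (((∃ z, a.LeastBad z ∧ a.Alone z) ∨ (a.Sorted ∧ a.tr ∈ U)) ↔ a.Alone z) := by
    intro a z h
    refine ⟨?_, fun h' => Or.inl ⟨z, h, h'⟩⟩
    rintro (⟨z', h', h''⟩ | h')
    · rwa [h.unique h']
    · exact absurd h'.1 h.not_sorted
  have hU' : ∀ {a : Factorization f}, a.Sorted →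
      (((∃ z, a.LeastBad z ∧ a.Alone z) ∨ (a.Sorted ∧ a.tr ∈ U)) ↔ a.tr ∈ U) := by
    intro a h
    refine ⟨?_, fun h' => Or.inr ⟨h, h'⟩⟩
    rintro (⟨z', h', -⟩ | h')
    · exact absurd h h'.not_sorted
    · exact h'.2
  refine ⟨{a | (∃ z, a.LeastBad z ∧ a.Alone z) ∨ (a.Sorted ∧ a.tr ∈ U)},
    fun a b => (∃ z, a.LeastBad z ∧ b.LeastBad z ∧ SplitAt z a b) ∨
      (a.Sorted ∧ b.Sorted ∧ M a.tr b.tr), ρ', ?_, ?_, ?_, ?_, ?_, ?_, ?_, ?_⟩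
  · rintro a b (⟨z, ha, -, h⟩ | ⟨ha, -, h⟩)
    · exact (hU ha).2 h.alone
    · exact (hU' ha).2 (hM.mem h)
  · rintro a b (⟨z, -, hb, h⟩ | ⟨-, hb, h⟩)
    · exact fun h' => h.not_alone ((hU hb).1 h')
    · exact fun h' => hM.not_mem h ((hU' hb).1 h')
  · rintro a b (⟨z, -, -, h⟩ | ⟨ha, hb, h⟩)
    · exact h.covers
    · exact (hM.covers h).of_tr ha hb
  · rintro a (⟨z, hz, ha⟩ | ⟨hs, ha⟩)
    · obtain ⟨y, hzy, hp, hf, hle⟩ := hz.bad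
      obtain ⟨b, hb⟩ := a.exists_splitAt_right ha hp hf
        (lt_of_le_of_ne hle fun he => hzy.ne' (ha y he))
      exact ⟨b, Or.inl ⟨z, hz, hb.leastBad_right hz, hb⟩⟩
    · obtain ⟨b', hb'⟩ := hM.exists_right ha
      obtain ⟨b, rfl, hb⟩ := exists_sorted b'
      exact ⟨b, Or.inr ⟨hs, hb, hb'⟩⟩
  · intro b hbU
    rcases b.sorted_or_exists_leastBad with hs | ⟨z, hz⟩
    · obtain ⟨a', ha'⟩ := hM.exists_left fun h => hbU ((hU' hs).2 h)
      obtain ⟨a, rfl, ha⟩ := exists_sorted a'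
      exact ⟨a, Or.inr ⟨ha, hs, ha'⟩⟩
    · obtain ⟨a, ha⟩ := b.exists_splitAt_left (fun h => hbU ((hU hz).2 h))
        (fun x hx hzx hf => hzx.ne' (hinj x z hx hf))
      exact ⟨a, Or.inl ⟨z, ha.leastBad_left hz, hz, ha⟩⟩
  · rintro a b c (⟨z, ha, -, h⟩ | ⟨ha, hb, h⟩) (⟨z', ha', -, h'⟩ | ⟨ha', hb', h'⟩)
    · obtain rfl := ha.unique ha'
      exact h.right_unique h'
    · exact absurd ha' ha.not_sorted
    · exact absurd ha ha'.not_sorted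
    · exact hb.eq_of_tr_eq hb' (hM.right_unique h h')
  · rintro a b c (⟨z, -, hc, h⟩ | ⟨ha, hc, h⟩) (⟨z', -, hc', h'⟩ | ⟨ha', hc', h'⟩)
    · obtain rfl := hc.unique hc'
      exact h.left_unique h'
    · exact absurd hc' hc.not_sorted
    · exact absurd hc hc'.not_sorted
    · exact ha.eq_of_tr_eq ha' (hM.left_unique h h')
  · rintro a b c (⟨z, ha, hb, h⟩ | ⟨ha, hb, h⟩) hc hcU hne <;> apply hρ'
    -- The leaf `z` stays bad in `c`. Either the truncation loses degree, or the least bad leaf gets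
    -- smaller, or it is again `z` and `c` joins it to a block behind it.
    · have hcz : c.Bad z := by
        obtain ⟨-, w, hw⟩ := hc
        exact ha.bad.of_hom w hw
      obtain ⟨z', hz'⟩ := c.sorted_or_exists_leastBad.resolve_left fun hs => hs z hcz
      have hca : ¬ c.Alone z' := fun h => hcU ((hU hz').2 h)
      have hzz' : z' ≤ z := not_lt.1 fun hlt => hz'.not_bad z hlt hcz
      rw [ρbad hb, ρbad hz', Prod.Lex.lt_iff]
      refine Or.inr ⟨rfl, ?_⟩
      rw [Prod.Lex.lt_iff]
      have hdeg : b.mid.tr.deg = a.mid.tr.deg := by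
        change b.tr.mid.deg = a.tr.mid.deg
        rw [h.tr_eq]
      rcases hc.tr_eq_or_deg_lt with htr | hlt
      · have hdeg' : c.mid.tr.deg = a.mid.tr.deg := by
          change c.tr.mid.deg = a.tr.mid.deg
          rw [htr]
        refine Or.inr ⟨hdeg'.trans hdeg.symm, ?_⟩
        rw [Prod.Lex.lt_iff]
        rcases hzz'.lt_or_eq with hlt | rfl
        · exact Or.inl hlt
        · refine Or.inr ⟨rfl, ?_⟩
          rcases (hc.splitAt_or_pos_lt h.alone hca).2 with h' | h'
          · exact absurd (h'.right_unique h) hne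
          · have h1 := h.pos_eq
            have h2 := c.pos_le z'
            change T.size 0 - c.pos z' < T.size 0 - b.pos z'
            omega
      · left
        change c.mid.tr.deg < b.mid.tr.deg
        rwa [hdeg]
    · rcases c.sorted_or_exists_leastBad with hs | ⟨z, hz⟩
      · rw [ρsorted hb, ρsorted hs, Prod.Lex.lt_iff]
        refine Or.inr ⟨rfl, ?_⟩
        rw [Prod.Lex.lt_iff]
        refine Or.inl (hM.rank_lt h (hc.tr ha hs) (fun h' => hcU ((hU' hs).2 h')) fun he => ?_)
        exact hne (hs.eq_of_tr_eq hb he)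
      · rw [ρsorted hb, ρbad hz, Prod.Lex.lt_iff]
        exact Or.inl Nat.zero_lt_one

/-- A morphism of positive degree has an acyclic matching on its factorizations. -/
theorem hasAcyclicMatching {n : ℕ} {T S : PrunedTree n} (f : T ⟶ S) (hd : S.deg < T.deg) :
    HasAcyclicMatching f := by
  induction n with
  | zero => simp [deg] at hd
  | succ n ih =>
    by_cases hinj : ∀ x y : Fin (T.size 0),
        T.map 0 x = T.map 0 y → Hom.app f 0 x = Hom.app f 0 y → x = y
    · refine hasAcyclicMatching_of_tr hinj (ih (trHom f) ?_)
      -- If the truncation had degree zero, identified leaves would be siblings, hence equal, and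
      -- `f` itself would have degree zero.
      refine lt_of_le_of_ne (deg_le_of_hom (trHom f)) fun he => ?_
      have hi := onVertex_injective_of_deg_eq (trHom f) he.symm
      have hi' : ∀ k : Fin (n + 1), Function.Injective (Hom.app (trHom f) k) := by
        intro k
        induction k using Fin.lastCases with
        | last => exact fun x y _ => T.tr.subsingleton_level_last x y
        | cast j => exact fun x y h => vertex_mk_inj (hi ((onVertex_mk_eq (trHom f)).2 h))
      have h0 : Function.Injective (Hom.app f 0) := fun x y h =>
        hinj x y (hi' 0 (app_parent_eq f 0 h)) h
      have hs : T.size 0 = S.size 0 := by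
        have := Fintype.card_of_bijective ⟨h0, Hom.surjective_app f 0⟩
        simpa using this
      rw [deg_eq_size_add, deg_eq_size_add, hs, he] at hd
      exact lt_irrefl _ hd
    · push Not at hinj
      have hex : ∃ z y : Fin (T.size 0), y < z ∧ T.map 0 y = T.map 0 z ∧
          Hom.app f 0 y = Hom.app f 0 z := by
        obtain ⟨x, y, hs, hf, hne⟩ := hinj
        rcases lt_or_gt_of_ne hne with h | h
        · exact ⟨y, x, h, hs, hf⟩
        · exact ⟨x, y, h, hs.symm, hf.symm⟩
      -- The order is reversed: `z` is the greatest leaf with an identified elder sibling, so no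
      -- later sibling is identified with it and it may always be moved behind its block.
      obtain ⟨z, ⟨y, hyz, hs, hf⟩, hmax⟩ := WellFounded.has_min
        (wellFounded_gt (α := Fin (T.size 0)))
        {z | ∃ y : Fin (T.size 0), y < z ∧ T.map 0 y = T.map 0 z ∧
          Hom.app f 0 y = Hom.app f 0 z} hex
      exact hasAcyclicMatching_of_siblings hyz hs hf fun x hx hzx hfx =>
        hmax x ⟨z, hzx, hx.symm, hfx.symm⟩ hzx

theorem eq_of_deg_eq {n : ℕ} {T S : PrunedTree n} (f : T ⟶ S) (hd : T.deg = S.deg) : T = S := by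
  have hi := onVertex_injective_of_deg_eq f hd
  have hi' : ∀ k : Fin (n + 1), Function.Injective (Hom.app f k) := by
    intro k
    induction k using Fin.lastCases with
    | last => exact fun x y _ => T.subsingleton_level_last x y
    | cast j => exact fun x y h => vertex_mk_inj (hi ((onVertex_mk_eq f).2 h))
  obtain ⟨g, -⟩ := exists_factor f (𝟙 T) (fun i x y h => hi' i h) fun i x y hp hle => by
    by_contra hlt
    have hlt' : y < x := not_le.1 hlt
    have h := Hom.mono_fibre f i y x (hi' _ hp).symm hlt'.le
    exact hlt'.ne' (hi' _ (le_antisymm hle h))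
  exact eq_of_homs f g

end PrunedTree

namespace PrunedTree

open Factorization

/-! ### Exactness from triangular matrices -/

section Triangular

variable {k : Type*} [CommRing k] {X Y : Type*}

/-- Outside `U`, each basis vector is the leading term of some `g x` with unit coefficient. Modulo
the image and the vectors in `U`, induction on the rank eliminates it. -/
theorem exists_eq_add_supported (g : X → (Y →₀ k)) (U : Set Y) (r : Y → ℕ)
    (h : ∀ y ∉ U, ∃ x, IsUnit (g x y) ∧ ∀ y' ∉ U, y' ≠ y → g x y' ≠ 0 → r y' < r y)
    (v : Y →₀ k) :
    ∃ x, ∃ u ∈ Finsupp.supported k k U, v = Finsupp.linearCombination k g x + u := by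
  classical
  let N : Submodule k (Y →₀ k) :=
    LinearMap.range (Finsupp.linearCombination k g) ⊔ Finsupp.supported k k U
  have hU : ∀ y ∈ U, Finsupp.single y (1 : k) ∈ N := fun y hy =>
    Submodule.mem_sup_right (Finsupp.single_mem_supported k 1 hy)
  have key : ∀ m, ∀ y, r y = m → Finsupp.single y (1 : k) ∈ N := by
    intro m
    induction m using Nat.strong_induction_on with
    | _ m ih =>
      rintro y rfl
      by_cases hy : y ∈ U
      · exact hU y hy
      · obtain ⟨x, hx, hx'⟩ := h y hy
        have h1 : g x ∈ N := Submodule.mem_sup_left ⟨Finsupp.single x 1, by simp⟩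
        have h2 : (g x).erase y ∈ N := by
          rw [← Finsupp.sum_single ((g x).erase y)]
          refine Submodule.sum_mem _ fun y' hy' => ?_
          rw [Finsupp.support_erase, Finset.mem_erase, Finsupp.mem_support_iff] at hy'
          have h3 : Finsupp.single y' (1 : k) ∈ N := by
            by_cases hyU : y' ∈ U
            · exact hU y' hyU
            · exact ih _ (hx' y' hyU hy'.1 hy'.2) y' rfl
          have := N.smul_mem (((g x).erase y) y') h3
          rwa [Finsupp.smul_single_one] at this
        have h4 : Finsupp.single y (g x y) ∈ N := by
          have := N.sub_mem h1 h2
          rwa [← Finsupp.single_add_erase y (g x), Finsupp.erase_add, Finsupp.erase_single,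
            zero_add, Finsupp.erase_idem, add_sub_cancel_right] at this
        obtain ⟨c, hc⟩ := hx
        have := N.smul_mem (↑c⁻¹ : k) h4
        rwa [Finsupp.smul_single, ← hc, smul_eq_mul, Units.inv_mul] at this
  have hv : v ∈ N := by
    rw [← Finsupp.sum_single v]
    refine Submodule.sum_mem _ fun y _ => ?_
    have := N.smul_mem (v y) (key _ y rfl)
    rwa [Finsupp.smul_single_one] at this
  obtain ⟨_, ⟨x, rfl⟩, u, hu, rfl⟩ := Submodule.mem_sup.1 hv
  exact ⟨x, u, hu, rfl⟩

/-- For `x` of maximal rank in the support of `u`, the coordinate at its partner `y` receives a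
contribution from `x` only, and the coefficient there is a unit. -/
theorem eq_zero_of_supported (g : X → (Y →₀ k)) (U : Set X) (r : X → ℕ)
    (h : ∀ x ∈ U, ∃ y, IsUnit (g x y) ∧ ∀ x' ∈ U, x' ≠ x → g x' y ≠ 0 → r x < r x')
    {u : X →₀ k} (hu : u ∈ Finsupp.supported k k U)
    (hg : Finsupp.linearCombination k g u = 0) : u = 0 := by
  classical
  by_contra hne
  obtain ⟨x, hx, hmax⟩ := Finset.exists_max_image u.support r (Finsupp.support_nonempty_iff.2 hne)
  have hU : ∀ x ∈ u.support, x ∈ U := fun x hx => (Finsupp.mem_supported k u).1 hu hx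
  obtain ⟨y, hy, hy'⟩ := h x (hU x hx)
  have h1 := DFunLike.congr_fun hg y
  rw [Finsupp.linearCombination_apply, Finsupp.sum, Finsupp.finsetSum_apply,
    Finset.sum_eq_single x] at h1
  · rw [Finsupp.smul_apply, smul_eq_mul, Finsupp.zero_apply, hy.mul_left_eq_zero] at h1
    exact Finsupp.mem_support_iff.1 hx h1
  · intro x' hx' hxx'
    rw [Finsupp.smul_apply]
    by_contra hz
    refine absurd (hy' x' (hU x' hx') hxx' fun h0 => hz ?_) (not_lt.2 (hmax x' hx'))
    rw [h0, smul_zero]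
  · exact fun h => absurd hx h

end Triangular

/-! ### The complex in terms of a basis -/

variable {n : ℕ}

/-- The basis of `K(pt_S, Ω_n^epi, Ω_n^epi(T, -))` in degree `d`: the morphisms `T ⟶ S` together
with a factorization whose second factor has degree `d`. -/
abbrev KoszulBasis (T S : PrunedTree n) (d : ℕ) : Type :=
  Σ h : T ⟶ S, {a : Factorization h // a.mid.deg = S.deg + d}

theorem Factorization.eq_of_comp_eq {T M S : PrunedTree n} {g : T ⟶ M} {u : M ⟶ S} {h : T ⟶ S}
    {c c' : Factorization u} {p : (g ≫ c.fst) ≫ c.snd = h} {p' : (g ≫ c'.fst) ≫ c'.snd = h}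
    (e : (⟨c.mid, g ≫ c.fst, c.snd, p⟩ : Factorization h) = ⟨c'.mid, g ≫ c'.fst, c'.snd, p'⟩) :
    c = c' := by
  obtain ⟨m, w, v, hf⟩ := c
  obtain ⟨m', w', v', hf'⟩ := c'
  simp only [Factorization.mk.injEq] at e
  obtain ⟨rfl, h1, h2⟩ := e
  have h1' := hom_cancel g (eq_of_heq h1)
  have h2' := eq_of_heq h2
  subst h1' h2'
  rfl

theorem Factorization.mk_comp_eq {T S : PrunedTree n} {h : T ⟶ S} {a b : Factorization h}
    {w : a.mid ⟶ b.mid} (hw : a.fst ≫ w = b.fst) (p : (a.fst ≫ w) ≫ b.snd = h) :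
    (⟨b.mid, a.fst ≫ w, b.snd, p⟩ : Factorization h) = b := by
  obtain ⟨m, f, s, hf⟩ := b
  simp only [Factorization.mk.injEq, heq_eq_eq, true_and, and_true]
  exact hw

/-! ### The differential on the basis: square zero and exactness. -/

namespace KoszulBasis

variable {T S : PrunedTree n} {d : ℕ}

/-- The second factor. -/
def mor (b : KoszulBasis T S d) : MorOfDeg n d := ⟨b.2.1.mid, S, b.2.1.snd, b.2.2⟩

/-- The basis element obtained by moving a factor of degree one to the first factor. -/
def next (b : KoszulBasis T S (d + 1)) (c : RightFactor b.mor) : KoszulBasis T S d :=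
  ⟨b.1, ⟨c.1.mid, b.2.1.fst ≫ c.1.fst, c.1.snd,
    (Category.assoc _ _ _).trans ((congrArg (b.2.1.fst ≫ ·) c.1.fac).trans b.2.1.fac)⟩, c.rest.deg_src⟩

theorem next_injective (b : KoszulBasis T S (d + 1)) : Function.Injective b.next := by
  intro c c' h
  have h' := congrArg Subtype.val (eq_of_heq (Sigma.mk.inj h).2)
  exact Subtype.ext (Factorization.eq_of_comp_eq h')

variable (k : Type u) [CommRing k]

/-- The differential of a basis element. -/
noncomputable def diff (b : KoszulBasis T S (d + 1)) : KoszulBasis T S d →₀ k :=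
  ∑ c : RightFactor b.mor, ((-1) ^ d * Hom.sgn c.1.fst) • Finsupp.single (b.next c) (1 : k)

/-- The connecting morphism is unique because `a.fst` is epic, so a single term of the differential
hits `b`, with coefficient `±1`. -/
theorem isUnit_diff (h : T ⟶ S) {a b : Factorization h} (ha : a.mid.deg = S.deg + (d + 1))
    (hb : b.mid.deg = S.deg + d) (hab : Covers a b) :
    IsUnit (diff k (⟨h, a, ha⟩ : KoszulBasis T S (d + 1)) ⟨h, b, hb⟩) := by
  classical
  obtain ⟨hd, w, hw⟩ := hab
  have hsnd : w ≫ b.snd = a.snd := hom_cancel a.fst (by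
    rw [← Category.assoc, hw, b.fac, a.fac])
  let β : KoszulBasis T S (d + 1) := ⟨h, a, ha⟩
  let c : RightFactor β.mor := ⟨⟨b.mid, w, b.snd, hsnd⟩, hd⟩
  have hc : β.next c = ⟨h, b, hb⟩ :=
    congrArg (Sigma.mk h) (Subtype.ext (Factorization.mk_comp_eq hw _))
  have h1 : diff k β ⟨h, b, hb⟩ = (((-1) ^ d * Hom.sgn c.1.fst : ℤ) : k) := by
    rw [diff, Finsupp.finsetSum_apply, Finset.sum_eq_single c]
    · rw [hc, Finsupp.smul_apply, Finsupp.single_eq_same, zsmul_one]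
    · intro c' _ hne
      rw [Finsupp.smul_apply, Finsupp.single_eq_of_ne, smul_zero]
      rw [← hc]
      exact fun h => hne (β.next_injective h.symm)
    · exact fun h => absurd (Finset.mem_univ _) h
  change IsUnit (diff k β _)
  rw [h1]
  have hu : IsUnit ((-1) ^ d * Hom.sgn c.1.fst : ℤ) :=
    (isUnit_one.neg.pow d).mul (IsUnit.of_mul_eq_one _ (sgn_mul_self _))
  exact hu.map (Int.castRingHom k)

theorem covers_of_diff_ne_zero {h h' : T ⟶ S} {a : Factorization h} {b : Factorization h'}
    (ha : a.mid.deg = S.deg + (d + 1)) (hb : b.mid.deg = S.deg + d)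
    (hab : diff k (⟨h, a, ha⟩ : KoszulBasis T S (d + 1)) ⟨h', b, hb⟩ ≠ 0) :
    ∃ e : h' = h, Covers a (e ▸ b) := by
  rw [diff, Finsupp.finsetSum_apply] at hab
  obtain ⟨c, -, hc⟩ := Finset.exists_ne_zero_of_sum_ne_zero hab
  have he : (⟨h', b, hb⟩ : KoszulBasis T S d) = next ⟨h, a, ha⟩ c := by
    by_contra hne
    rw [Finsupp.smul_apply, Finsupp.single_eq_of_ne hne, smul_zero] at hc
    exact hc rfl
  simp only [next, Sigma.mk.injEq] at he
  obtain ⟨rfl, he⟩ := he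
  have he' := congrArg Subtype.val (eq_of_heq he)
  refine ⟨rfl, ?_⟩
  dsimp only at he' ⊢
  rw [he']
  exact ⟨c.2, c.1.fst, rfl⟩

/-- Two successive factors of degree one amount to a factor of degree two with a factorization. -/
def chainEquiv {M S : PrunedTree n} (u : M ⟶ S) :
    (Σ c : {c : Factorization u // M.deg = c.mid.deg + 1},
      {c' : Factorization c.1.snd // c.1.mid.deg = c'.mid.deg + 1}) ≃
      Σ e : {e : Factorization u // M.deg = e.mid.deg + 2},
        {m : Factorization e.1.fst // m.mid.deg = e.1.mid.deg + 1} where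
  toFun x := ⟨⟨⟨x.2.1.mid, x.1.1.fst ≫ x.2.1.fst, x.2.1.snd, by
      rw [Category.assoc, x.2.1.fac, x.1.1.fac]⟩, by
        have h₁ := x.1.2
        have h₂ := x.2.2
        dsimp only at h₁ h₂ ⊢
        omega⟩, ⟨⟨x.1.1.mid, x.1.1.fst, x.2.1.fst, rfl⟩, x.2.2⟩⟩
  invFun y := ⟨⟨⟨y.2.1.mid, y.2.1.fst, y.2.1.snd ≫ y.1.1.snd, by
      rw [← Category.assoc, y.2.1.fac, y.1.1.fac]⟩, by
        have h₁ := y.1.2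
        have h₂ := y.2.2
        dsimp only at h₁ h₂ ⊢
        omega⟩, ⟨⟨y.1.1.mid, y.2.1.snd, y.1.1.snd, rfl⟩, y.2.2⟩⟩
  left_inv := by
    -- With the composites as variables, the factorization equations can be eliminated by
    -- substitution.
    have key : ∀ (m₁ m₂ : PrunedTree n) (w₁ : M ⟶ m₁) (v₁ : m₁ ⟶ S) (hf₁ : w₁ ≫ v₁ = u)
        (hd₁ : M.deg = m₁.deg + 1) (w₂ : m₁ ⟶ m₂) (v₂ : m₂ ⟶ S) (hf₂ : w₂ ≫ v₂ = v₁)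
        (hd₂ : m₁.deg = m₂.deg + 1) (p : w₁ ≫ w₂ ≫ v₂ = u),
        (⟨⟨⟨m₁, w₁, w₂ ≫ v₂, p⟩, hd₁⟩, ⟨⟨m₂, w₂, v₂, rfl⟩, hd₂⟩⟩ :
          Σ c : {c : Factorization u // M.deg = c.mid.deg + 1},
          {c' : Factorization c.1.snd // c.1.mid.deg = c'.mid.deg + 1}) =
        ⟨⟨⟨m₁, w₁, v₁, hf₁⟩, hd₁⟩, ⟨⟨m₂, w₂, v₂, hf₂⟩, hd₂⟩⟩ := by
      intros
      subst_vars
      rfl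
    rintro ⟨⟨⟨m₁, w₁, v₁, hf₁⟩, hd₁⟩, ⟨⟨m₂, w₂, v₂, hf₂⟩, hd₂⟩⟩
    exact key _ _ _ _ _ _ _ _ _ _ _
  right_inv := by
    have key : ∀ (m₁ m₂ : PrunedTree n) (w : M ⟶ m₂) (v₂ : m₂ ⟶ S) (hf : w ≫ v₂ = u)
        (hd : M.deg = m₂.deg + 2) (w₁ : M ⟶ m₁) (w₂ : m₁ ⟶ m₂) (hf' : w₁ ≫ w₂ = w)
        (hd' : m₁.deg = m₂.deg + 1) (p : (w₁ ≫ w₂) ≫ v₂ = u),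
        (⟨⟨⟨m₂, w₁ ≫ w₂, v₂, p⟩, hd⟩, ⟨⟨m₁, w₁, w₂, rfl⟩, hd'⟩⟩ :
          Σ e : {e : Factorization u // M.deg = e.mid.deg + 2},
          {m : Factorization e.1.fst // m.mid.deg = e.1.mid.deg + 1}) =
        ⟨⟨⟨m₂, w, v₂, hf⟩, hd⟩, ⟨⟨m₁, w₁, w₂, hf'⟩, hd'⟩⟩ := by
      intros
      subst_vars
      rfl
    rintro ⟨⟨⟨m₂, w, v₂, hf⟩, hd⟩, ⟨⟨m₁, w₁, w₂, hf'⟩, hd'⟩⟩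
    exact key _ _ _ _ _ _ _ _ _ _ _

/-- The terms are regrouped by the composite of the two degree-one factors, which has degree two.
The resulting basis element depends only on this composite and its complement, and the signs sum to
zero by `sum_sgnMul_eq_zero`. -/
theorem linearCombination_diff_diff (b : KoszulBasis T S (d + 1 + 1)) :
    Finsupp.linearCombination k (diff k (T := T) (S := S) (d := d)) (diff k b) = 0 := by
  classical
  let E := {e : Factorization b.2.1.snd // b.2.1.mid.deg = e.mid.deg + 2}
  have : ∀ e : E, Fintype {m : Factorization e.1.fst // m.mid.deg = e.1.mid.deg + 1} :=
    fun e => Fintype.ofFinite _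
  have : Fintype E := Fintype.ofFinite _
  let B : E → KoszulBasis T S d :=
    fun e => ⟨b.1, ⟨e.1.mid, b.2.1.fst ≫ e.1.fst, e.1.snd, by
      rw [Category.assoc, e.1.fac, b.2.1.fac]⟩, by
        have h₁ := e.2
        have h₂ := b.2.2
        dsimp only at h₁ h₂ ⊢
        omega⟩
  have h1 : Finsupp.linearCombination k (diff k (T := T) (S := S) (d := d)) (diff k b) =
      ∑ c : RightFactor b.mor, ∑ c' : RightFactor (b.next c).mor,
        (-(Hom.sgn c.1.fst * Hom.sgn c'.1.fst)) •
          Finsupp.single ((b.next c).next c') (1 : k) := by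
    rw [diff, map_sum]
    refine Finset.sum_congr rfl fun c _ => ?_
    rw [map_zsmul, Finsupp.linearCombination_single, one_smul, diff, Finset.smul_sum]
    refine Finset.sum_congr rfl fun c' _ => ?_
    rw [smul_smul]
    congr 1
    have hs : ((-1 : ℤ) ^ d) * (-1) ^ d = 1 := by rw [← mul_pow]; simp
    rw [pow_succ]
    linear_combination (-(Hom.sgn c.1.fst * Hom.sgn c'.1.fst)) * hs
  have h2 : (∑ c : RightFactor b.mor, ∑ c' : RightFactor (b.next c).mor,
        (-(Hom.sgn c.1.fst * Hom.sgn c'.1.fst)) •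
          Finsupp.single ((b.next c).next c') (1 : k)) =
      ∑ x : (Σ c : RightFactor b.mor, RightFactor (b.next c).mor),
        (-(Hom.sgn x.1.1.fst * Hom.sgn x.2.1.fst)) •
          Finsupp.single ((b.next x.1).next x.2) (1 : k) :=
    (Fintype.sum_sigma (fun x : (Σ c : RightFactor b.mor, RightFactor (b.next c).mor) =>
      (-(Hom.sgn x.1.1.fst * Hom.sgn x.2.1.fst)) •
        Finsupp.single ((b.next x.1).next x.2) (1 : k))).symm
  have h3 : (∑ x : (Σ c : RightFactor b.mor, RightFactor (b.next c).mor),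
        (-(Hom.sgn x.1.1.fst * Hom.sgn x.2.1.fst)) •
          Finsupp.single ((b.next x.1).next x.2) (1 : k)) =
      ∑ y : (Σ e : E, {m : Factorization e.1.fst // m.mid.deg = e.1.mid.deg + 1}),
        (-y.2.1.sgnMul) • Finsupp.single (B y.1) (1 : k) := by
    let ε : (Σ c : RightFactor b.mor, RightFactor (b.next c).mor) ≃
        Σ e : E, {m : Factorization e.1.fst // m.mid.deg = e.1.mid.deg + 1} :=
      chainEquiv b.2.1.snd
    refine Fintype.sum_equiv ε _ _ ?_
    rintro ⟨c, c'⟩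
    have hb : (b.next c).next c' = B (ε ⟨c, c'⟩).1 := by
      refine congrArg (Sigma.mk b.1) (Subtype.ext ?_)
      have hassoc := Category.assoc b.2.1.fst c.1.fst c'.1.fst
      have key : ∀ {m : PrunedTree n} {g g' : T ⟶ m} (s : m ⟶ S) (p : g ≫ s = b.1)
          (p' : g' ≫ s = b.1), g = g' →
          (⟨m, g, s, p⟩ : Factorization b.1) = ⟨m, g', s, p'⟩ := by
        intros
        subst_vars
        rfl
      exact key _ _ _ hassoc
    rw [hb]
    rfl
  rw [h1, h2, h3, Fintype.sum_sigma]
  refine Finset.sum_eq_zero fun e _ => ?_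
  dsimp only
  rw [← Finset.sum_smul, Finset.sum_neg_distrib, sum_sgnMul_eq_zero e.1.fst e.2, neg_zero,
    zero_smul]

theorem hasAcyclicMatching_of_ne (hne : T ≠ S) (h : T ⟶ S) : HasAcyclicMatching h :=
  hasAcyclicMatching h
    (lt_of_le_of_ne (deg_le_of_hom h) fun he => hne (eq_of_deg_eq h he.symm))

/-- Up to a boundary, every chain is supported on the upper elements of a matching. -/
theorem exists_eq_add_upper (U : ∀ h : T ⟶ S, Set (Factorization h))
    (M : ∀ h : T ⟶ S, Factorization h → Factorization h → Prop)
    (r : ∀ h : T ⟶ S, Factorization h → ℕ) (hM : ∀ h, IsAcyclicMatching (U h) (M h) (r h))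
    (v : KoszulBasis T S d →₀ k) :
    ∃ x, ∃ u ∈ Finsupp.supported k k {b : KoszulBasis T S d | b.2.1 ∈ U b.1},
      v = Finsupp.linearCombination k (diff k (T := T) (S := S) (d := d)) x + u := by
  classical
  obtain ⟨x, u, hu, rfl⟩ := exists_eq_add_supported (diff k (T := T) (S := S) (d := d))
    {b | b.2.1 ∈ U b.1} (fun b => r b.1 b.2.1) (by
      rintro ⟨h, b, hb⟩ hbU
      obtain ⟨a, ha⟩ := (hM h).exists_left hbU
      have hc := (hM h).covers ha
      have h1 : a.mid.deg = b.mid.deg + 1 := hc.1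
      refine ⟨⟨h, a, by omega⟩, isUnit_diff k h _ hb hc, ?_⟩
      rintro ⟨h', c, hcd⟩ hcU hcb hne
      obtain ⟨rfl, hac⟩ := covers_of_diff_ne_zero k _ _ hne
      refine (hM h').rank_lt ha hac hcU fun he => hcb ?_
      dsimp only at he
      subst he
      rfl) v
  exact ⟨x, u, hu, rfl⟩

/-- Cycles of positive degree are boundaries. -/
theorem exists_of_cycle (hne : T ≠ S) (v : KoszulBasis T S (d + 1) →₀ k)
    (hv : Finsupp.linearCombination k (diff k (T := T) (S := S) (d := d)) v = 0) :
    ∃ x, Finsupp.linearCombination k (diff k (T := T) (S := S) (d := d + 1)) x = v := by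
  classical
  choose U M r hM using hasAcyclicMatching_of_ne hne
  obtain ⟨x, u, hu, rfl⟩ := exists_eq_add_upper k U M r hM v
  refine ⟨x, ?_⟩
  have hz : Finsupp.linearCombination k (diff k (T := T) (S := S) (d := d))
      (Finsupp.linearCombination k (diff k (T := T) (S := S) (d := d + 1)) x) = 0 := by
    rw [Finsupp.linearCombination_apply k x, Finsupp.sum, map_sum]
    refine Finset.sum_eq_zero fun b _ => ?_
    rw [map_smul, linearCombination_diff_diff, smul_zero]
  rw [map_add, hz, zero_add] at hv
  have hu0 : u = 0 := by
    -- An upper element is ranked by its partner. If another upper element also covers that partner,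
    -- acyclicity gives it a partner of larger rank. The value `0` is used only for elements without
    -- a partner.
    let ρ : KoszulBasis T S (d + 1) → ℕ := fun b =>
      if hb : ∃ c, M b.1 b.2.1 c then r b.1 hb.choose else 0
    have hρ : ∀ {h a ha c}, M h a c → ρ ⟨h, a, ha⟩ = r h c := by
      intro h a ha c hc
      have hex : ∃ c, M h a c := ⟨c, hc⟩
      simp only [ρ]
      rw [dif_pos hex, (hM h).right_unique hex.choose_spec hc]
    refine eq_zero_of_supported (diff k (T := T) (S := S) (d := d)) {b | b.2.1 ∈ U b.1} ρ ?_ hu hv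
    rintro ⟨h, a, ha⟩ haU
    obtain ⟨c, hc⟩ := (hM h).exists_right haU
    have hac := (hM h).covers hc
    have h1 : a.mid.deg = c.mid.deg + 1 := hac.1
    refine ⟨⟨h, c, by omega⟩, isUnit_diff k h _ _ hac, ?_⟩
    rintro ⟨h', a', ha'⟩ haU' hne' hdiff
    obtain ⟨rfl, hac'⟩ := covers_of_diff_ne_zero k _ _ hdiff
    obtain ⟨c', hc'⟩ := (hM h).exists_right haU'
    rw [hρ hc, hρ hc']
    refine (hM h).rank_lt hc' hac' ((hM h).not_mem hc) fun he => hne' ?_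
    subst he
    obtain rfl := (hM h).left_unique hc hc'
    rfl
  rw [hu0, add_zero]

/-- Every element of degree zero is a boundary. -/
theorem exists_of_degree_zero (hne : T ≠ S) (v : KoszulBasis T S 0 →₀ k) :
    ∃ x, Finsupp.linearCombination k (diff k (T := T) (S := S) (d := 0)) x = v := by
  choose U M r hM using hasAcyclicMatching_of_ne hne
  obtain ⟨x, u, hu, rfl⟩ := exists_eq_add_upper k U M r hM v
  refine ⟨x, ?_⟩
  -- The partner of an upper element in degree zero would have smaller degree than `S`.
  have hempty : {b : KoszulBasis T S 0 | b.2.1 ∈ U b.1} = ∅ := by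
    refine Set.eq_empty_of_forall_notMem ?_
    rintro ⟨h, a, ha⟩ haU
    obtain ⟨c, hc⟩ := (hM h).exists_right haU
    have h1 : a.mid.deg = c.mid.deg + 1 := ((hM h).covers hc).1
    have h2 := deg_le_of_hom c.snd
    omega
  rw [hempty, Finsupp.supported_empty, Submodule.mem_bot] at hu
  rw [hu, add_zero]

end KoszulBasis

end PrunedTree

namespace PrunedTree

/-! ### Comparison of the Koszul complex with the free module on the basis. -/

namespace KoszulBasis

variable {n : ℕ} (k : Type u) [CommRing k] (T S : PrunedTree n) (d : ℕ)

/-- The Koszul complex with coefficients in `pt_S` and `Ω_n^epi(T, -)`, in degree `d`. -/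
abbrev Module : Type u := KoszulModule (pt k S) (yonedaDiagram k T) d

variable {T S d}

/-- The generator of the summand of `f` that belongs to `g : T ⟶ f.src`. -/
noncomputable def generator (f : MorOfDeg n d) (g : T ⟶ f.src) : Module k T S d :=
  koszulIncl (pt k S) (yonedaDiagram k T) f
    ((show ((pt k S).obj (op f.tgt) : Type u) from fun _ => (1 : k)) ⊗ₜ[k]
      (show ((yonedaDiagram k T).obj f.src : Type u) from Finsupp.single g (1 : k)))

/-- The map from the free module on the basis. -/
noncomputable def ofBasis : (KoszulBasis T S d →₀ k) →ₗ[k] Module k T S d :=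
  Finsupp.linearCombination k fun b => generator k b.mor b.2.1.fst

/-- The basis element that belongs to a generator. -/
def mk (f : MorOfDeg n d) (hf : f.tgt = S) (g : T ⟶ f.src) : KoszulBasis T S d :=
  hf ▸ (⟨g ≫ f.mor, ⟨f.src, g, f.mor, rfl⟩, f.deg_src⟩ : KoszulBasis T f.tgt d)

open scoped Classical in
/-- The coordinates with respect to the basis. -/
noncomputable def toBasis : Module k T S d →ₗ[k] (KoszulBasis T S d →₀ k) :=
  DirectSum.toModule k (MorOfDeg n d) (KoszulBasis T S d →₀ k) fun f =>
    if hf : f.tgt = S then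
      TensorProduct.lift
        ((LinearMap.proj (R := k) (φ := fun _ : PLift (f.tgt = S) => k) ⟨hf⟩).smulRight
          (Finsupp.lmapDomain k k (mk f hf)))
    else 0

theorem mk_mor (b : KoszulBasis T S d) : mk b.mor rfl b.2.1.fst = b := by
  obtain ⟨h, ⟨m, f, s, hf⟩, hd⟩ := b
  subst hf
  rfl

theorem toBasis_generator (b : KoszulBasis T S d) :
    toBasis k (generator k b.mor b.2.1.fst) = Finsupp.single b 1 := by
  classical
  refine (DirectSum.toModule_lof k b.mor _).trans ?_
  rw [dif_pos (show b.mor.tgt = S from rfl)]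
  refine (TensorProduct.lift.tmul _ _).trans ?_
  refine (one_smul k _).trans ?_
  exact Finsupp.mapDomain_single.trans (congrArg (fun c => Finsupp.single c (1 : k)) (mk_mor b))

theorem ofBasis_single (b : KoszulBasis T S d) :
    ofBasis k (Finsupp.single b 1) = generator k b.mor b.2.1.fst := by
  rw [ofBasis, Finsupp.linearCombination_single, one_smul]

/-- Only the injectivity of `ofBasis` is needed: it turns cycles of the Koszul complex into cycles
of the free model. -/
theorem toBasis_ofBasis (v : KoszulBasis T S d →₀ k) : toBasis k (ofBasis k v) = v := by
  have : toBasis k ∘ₗ ofBasis k = (LinearMap.id : (KoszulBasis T S d →₀ k) →ₗ[k] _) := by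
    refine Finsupp.lhom_ext' fun b => LinearMap.ext_ring ?_
    change toBasis k (ofBasis k (Finsupp.single b 1)) = Finsupp.single b 1
    rw [ofBasis_single, toBasis_generator]
  exact LinearMap.congr_fun this v

theorem smul_const_tmul_single {p : Prop} {ι : Type*} (a : PLift p → k) (h : p) (g : ι) (c : k) :
    (a ⟨h⟩ * c) • ((fun _ => 1 : PLift p → k) ⊗ₜ[k] Finsupp.single g (1 : k)) =
      a ⊗ₜ[k] Finsupp.single g c := by
  have ha : (a ⟨h⟩) • (fun _ => 1 : PLift p → k) = a := funext fun _ => mul_one _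
  rw [mul_smul, ← TensorProduct.tmul_smul, TensorProduct.smul_tmul', ha, Finsupp.smul_single,
    smul_eq_mul, mul_one]

/-- The coefficient module is free on the constant function `1` if `f` ends at `S`, and zero
otherwise. -/
theorem koszulIncl_mem_range (f : MorOfDeg n d)
    (t : ((pt k S).obj (op f.tgt) : Type u) ⊗[k] ((yonedaDiagram k T).obj f.src : Type u)) :
    koszulIncl (pt k S) (yonedaDiagram k T) f t ∈
      LinearMap.range (ofBasis k (T := T) (S := S) (d := d)) := by
  induction t using TensorProduct.induction_on with
  | zero => rw [map_zero]; exact Submodule.zero_mem _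
  | add x y hx hy => rw [map_add]; exact Submodule.add_mem _ hx hy
  | tmul a y =>
    by_cases hf : f.tgt = S
    · have key : ∀ y : (T ⟶ f.src) →₀ k, koszulIncl (pt k S) (yonedaDiagram k T) f
          (a ⊗ₜ[k] (show ((yonedaDiagram k T).obj f.src : Type u) from y)) ∈
          LinearMap.range (ofBasis k (T := T) (S := S) (d := d)) := by
        intro y
        induction y using Finsupp.induction_linear with
        | zero =>
          refine (congrArg (· ∈ LinearMap.range (ofBasis k (T := T) (S := S) (d := d))) ?_).mpr
            (Submodule.zero_mem _)
          exact (congrArg _ (TensorProduct.tmul_zero _ a)).trans (map_zero _)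
        | add x y hx hy =>
          refine (congrArg (· ∈ LinearMap.range (ofBasis k (T := T) (S := S) (d := d))) ?_).mpr
            (Submodule.add_mem _ hx hy)
          exact (congrArg _ (TensorProduct.tmul_add a _ _)).trans (map_add _ _ _)
        | single g c =>
          obtain ⟨src, tgt, u, hdeg⟩ := f
          dsimp only at hf
          subst hf
          refine ⟨Finsupp.single ⟨g ≫ u, ⟨src, g, u, rfl⟩, hdeg⟩ (a ⟨rfl⟩ * c), ?_⟩
          rw [ofBasis, Finsupp.linearCombination_single]
          refine (map_smul (koszulIncl (pt k tgt) (yonedaDiagram k T) ⟨src, tgt, u, hdeg⟩)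
            (a ⟨rfl⟩ * c) _).symm.trans (congrArg _ ?_)
          exact smul_const_tmul_single k (p := tgt = tgt) a rfl g c
      exact key y
    · have ha : a = 0 := by
        funext ⟨h⟩
        exact absurd h hf
      rw [ha, TensorProduct.zero_tmul, map_zero]
      exact Submodule.zero_mem _

theorem ofBasis_surjective : Function.Surjective (ofBasis k (T := T) (S := S) (d := d)) := by
  classical
  rw [← LinearMap.range_eq_top, eq_top_iff]
  rintro x -
  induction x using DirectSum.induction_on with
  | zero => exact Submodule.zero_mem _
  | add x y hx hy => exact Submodule.add_mem _ hx hy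
  | of f t =>
    convert koszulIncl_mem_range k f t using 1
    rw [koszulIncl, DirectSum.lof_eq_of]

theorem koszulDiff_koszulIncl (P : (PrunedTree n)ᵒᵖ ⥤ ModuleCat.{v} k)
    (Q : PrunedTree n ⥤ ModuleCat.{w} k) (f : MorOfDeg n (d + 1))
    (x : (P.obj (op f.tgt) : Type v)) (y : (Q.obj f.src : Type w)) :
    koszulDiff P Q d (koszulIncl P Q f (x ⊗ₜ[k] y)) =
      (∑ a : LeftFactor f, Hom.sgn a.1.snd •
        koszulIncl P Q a.rest ((P.map a.1.snd.op).hom x ⊗ₜ[k] y)) +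
      ∑ a : RightFactor f, ((-1) ^ d * Hom.sgn a.1.fst) •
        koszulIncl P Q a.rest (x ⊗ₜ[k] (Q.map a.1.fst).hom y) := by
  classical
  refine (DirectSum.toModule_lof k f _).trans ?_
  exact congrArg₂ (fun a b : KoszulModule P Q d => a + b) (LinearMap.sum_apply _ _ _)
    (LinearMap.sum_apply _ _ _)

/-- In the first sum the middle tree has degree one more than `S`, so it is not `S` and `pt_S`
vanishes there. The second sum is `diff` by definition of the Yoneda diagram. -/
theorem koszulDiff_generator (b : KoszulBasis T S (d + 1)) :
    koszulDiff (pt k S) (yonedaDiagram k T) d (generator k b.mor b.2.1.fst) =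
      ofBasis k (diff k b) := by
  classical
  refine (koszulDiff_koszulIncl k _ _ _ _ _).trans ?_
  refine (congrArg₂ (· + ·) (Finset.sum_eq_zero fun c _ => ?_) ?_).trans (zero_add _)
  · have hne : c.1.mid ≠ S := fun h => by
      have h1 := c.2
      have h2 : b.mor.tgt = S := rfl
      rw [h, h2] at h1
      omega
    have h0 : ∀ x : ((pt k S).obj (op c.1.mid) : Type u), x = 0 := fun x => by
      funext ⟨h⟩
      exact absurd h hne
    refine (congrArg _ ((congrArg _ ?_).trans (map_zero _))).trans (smul_zero _)
    exact (congrArg (· ⊗ₜ[k] _) (h0 _)).trans (TensorProduct.zero_tmul _ _)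
  · rw [diff, map_sum]
    refine Finset.sum_congr rfl fun c _ => ?_
    rw [map_zsmul, ofBasis_single]
    refine congrArg (((-1) ^ d * Hom.sgn c.1.fst) • ·) ?_
    refine congrArg (koszulIncl (pt k S) (yonedaDiagram k T) c.rest) ?_
    exact congrArg _ Finsupp.mapDomain_single

theorem koszulDiff_ofBasis (v : KoszulBasis T S (d + 1) →₀ k) :
    koszulDiff (pt k S) (yonedaDiagram k T) d (ofBasis k v) =
      ofBasis k (Finsupp.linearCombination k (diff k) v) := by
  have : koszulDiff (pt k S) (yonedaDiagram k T) d ∘ₗ ofBasis k =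
      ofBasis k ∘ₗ Finsupp.linearCombination k (diff k (T := T) (S := S) (d := d)) := by
    refine Finsupp.lhom_ext' fun b => LinearMap.ext_ring ?_
    change koszulDiff _ _ d (ofBasis k (Finsupp.single b 1)) =
      ofBasis k (Finsupp.linearCombination k (diff k) (Finsupp.single b 1))
    rw [ofBasis_single, koszulDiff_generator, Finsupp.linearCombination_single, one_smul]
  exact LinearMap.congr_fun this v

theorem koszulSquareZero (T S : PrunedTree n) :
    KoszulSquareZero (pt k S) (yonedaDiagram k T) := by
  intro d
  refine LinearMap.ext fun x => ?_
  obtain ⟨v, rfl⟩ := ofBasis_surjective k x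
  rw [LinearMap.comp_apply, koszulDiff_ofBasis, koszulDiff_ofBasis,
    Finsupp.linearCombination_apply k v, Finsupp.sum, map_sum, Finset.sum_eq_zero, map_zero]
  · rfl
  · intro b _
    rw [map_smul, linearCombination_diff_diff, smul_zero]

theorem exists_koszulDiff_of_cycle (hne : T ≠ S) (x : Module k T S (d + 1))
    (hx : koszulDiff (pt k S) (yonedaDiagram k T) d x = 0) :
    ∃ y, koszulDiff (pt k S) (yonedaDiagram k T) (d + 1) y = x := by
  obtain ⟨v, rfl⟩ := ofBasis_surjective k x
  rw [koszulDiff_ofBasis] at hx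
  have hv := toBasis_ofBasis k (Finsupp.linearCombination k (diff k) v)
  rw [hx, map_zero] at hv
  obtain ⟨y, rfl⟩ := exists_of_cycle k hne v hv.symm
  exact ⟨ofBasis k y, koszulDiff_ofBasis k y⟩

theorem exists_koszulDiff_of_degree_zero (hne : T ≠ S) (x : Module k T S 0) :
    ∃ y, koszulDiff (pt k S) (yonedaDiagram k T) 0 y = x := by
  obtain ⟨v, rfl⟩ := ofBasis_surjective k x
  obtain ⟨y, rfl⟩ := exists_of_degree_zero k hne v
  exact ⟨ofBasis k y, koszulDiff_ofBasis k y⟩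

theorem exactAt_koszulComplex (hne : T ≠ S) (i : ℕ) :
    (koszulComplex (pt k S) (yonedaDiagram k T) (koszulSquareZero k T S)).ExactAt i := by
  have e : ∀ j, (koszulComplex (pt k S) (yonedaDiagram k T) (koszulSquareZero k T S)).d (j + 1) j =
      ModuleCat.ofHom (koszulDiff (pt k S) (yonedaDiagram k T) j) := fun j =>
    ChainComplex.of_d (fun d => ModuleCat.of k (Module k T S d))
      (fun d => ModuleCat.ofHom (koszulDiff (pt k S) (yonedaDiagram k T) d)) j
  cases i with
  | zero =>
    -- In degree zero the outgoing map is zero, so the whole module has to be hit.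
    rw [HomologicalComplex.exactAt_iff' _ 1 0 0 (by simp) (by simp),
      ShortComplex.moduleCat_exact_iff]
    intro x _
    obtain ⟨y, hy⟩ := exists_koszulDiff_of_degree_zero k hne x
    exact ⟨y, (congrArg (fun φ => φ.hom y) (e 0)).trans hy⟩
  | succ d =>
    rw [HomologicalComplex.exactAt_iff' _ (d + 2) (d + 1) d (by simp) (by simp),
      ShortComplex.moduleCat_exact_iff]
    intro x hx
    obtain ⟨y, hy⟩ := exists_koszulDiff_of_cycle k hne x
      ((congrArg (fun φ => φ.hom x) (e d)).symm.trans hx)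
    exact ⟨y, (congrArg (fun φ => φ.hom y) (e (d + 1))).trans hy⟩

end KoszulBasis

end PrunedTree

theorem mainTheorem2 {k : Type*} [CommRing k] (n : ℕ) (τ σ : PrunedTree n) :
    ∃ h : PrunedTree.KoszulSquareZero (PrunedTree.pt k σ) (PrunedTree.yonedaDiagram k τ),
      τ ≠ σ → ∀ i : ℕ, CategoryTheory.Limits.IsZero
        ((PrunedTree.koszulComplex (PrunedTree.pt k σ) (PrunedTree.yonedaDiagram k τ) h).homology i) :=
  ⟨PrunedTree.KoszulBasis.koszulSquareZero k τ σ, fun hne i =>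
    (PrunedTree.KoszulBasis.exactAt_koszulComplex k hne i).isZero_homology⟩
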